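/- **Lemma (Korn's First Inequality: Irrotational Version).** Let $\Omega\subset\mathbb{R}^N$ be a bounded domain with boundary $\Gamma=\partial\Omega$ and let $\Gamma_t\subset\Gamma$ be relatively open. Assume that $\Gamma$ is (weakly) Lipschitz at every point of $\Gamma_t$, i.e. every $x\in\Gamma_t$ has an open neighbourhood $U$ with a bi-Lipschitz homeomorphism of $U$ onto an open subset of $\mathbb{R}^N$ taking $U\cap\Omega$ to the part in an open half space and $U\cap\Gamma$ to the part in its bounding hyperplane. *Notation.* Norms, inner products and orthogonality are those of $L^2(\Omega)$, with the Frobenius inner product on $\mathbb{R}^{N\times N}$; $\operatorname{sym}T=\frac12(T+T^{\top})$, $\operatorname{skew}T=\frac12(T-T^{\top})$, and $\mathfrak{so}(N)$ is the space of constant skew-symmetric tensor fields. For a vector field $v$, $\operatorname{curl}v=(\partial_iv_j-\partial_jv_i)_{i<j}$ in the weak sense; $\operatorname{Grad}v$ is the Jacobian of $v\in H^1(\Omega;\mathbb{R}^N)$, and $\operatorname{Curl}$ acts row-wise. $H(\operatorname{curl};\Omega)$ is the space of $v\in L^2(\Omega)$ with $\operatorname{curl}v\in L^2(\Omega)$,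 with the graph norm; $\mathring H(\operatorname{curl};\Gamma_t,\Omega)$ is the closure in it of the restrictions to $\Omega$ of those fields in $C_c^\infty(\mathbb{R}^N)$ whose restriction to $\Omega$ has support at positive distance from $\Gamma_t$. $H_0(\operatorname{Curl};\Omega)$ and $\mathring H_0(\operatorname{Curl};\Gamma_t,\Omega)$ consist of the tensor fields $T:\Omega\to\mathbb{R}^{N\times N}$ whose rows lie in $H(\operatorname{curl};\Omega)$, respectively $\mathring H(\operatorname{curl};\Gamma_t,\Omega)$, and for which $\operatorname{Curl}T=0$. A domain $D$ has the *Korn property* if there is $c>0$ with $c\|\operatorname{Grad}v\|_{L^2(D)}\le\|v\|_{L^2(D)}+\|\operatorname{sym}\operatorname{Grad}v\|_{L^2(D)}$ for all $v\in H^1(D;\mathbb{R}^N)$ and the embedding $H^1(D)\hookrightarrow L^2(D)$ is compact. Assume that $(\Omega,\Gamma_t)$ is *sliceable*: there are disjoint, open, simply connected subdomains $\Omega_1,\dots,\Omega_J$ of $\Omega$ having the Korn property such that $\Omega\setminus(\Omega_1\cup\dots\cup\Omega_J)$ has Lebesgue measure zero and, if $\Gamma_t\ne\emptyset$, the interior of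 $\overline{\Omega_j}\cap\Gamma_t$ relative to $\Gamma$ is nonempty for each $j$. Fix such $\Omega_1,\dots,\Omega_J$. *Claim.* For every $c_{\mathtt{k},t}>0$ there is a constant $c_{\mathtt{k}}\ge c_{\mathtt{k},t}$ (not depending on $T$) such that: - **(i)** If $\Gamma_t\neq\emptyset$, then for all $T\in\mathring H_0(\operatorname{Curl};\Gamma_t,\Omega)$ $$\|T\|\le c_{\mathtt{k}}\|\operatorname{sym}T\|.\qquad(*)$$ - **(ii)** If $\Gamma_t=\emptyset$, then for all $T\in H_0(\operatorname{Curl};\Omega)$ there is a skew-symmetric tensor field $S$, constant on each $\Omega_j$, with $$\|T-S\|\le c_{\mathtt{k}}\|\operatorname{sym}T\|.$$ - **(ii')** If $\Gamma_t=\emptyset$ and $\Omega$ is additionally simply connected, then for all $T\in H_0(\operatorname{Curl};\Omega)$ the inequality in (ii) holds with the constant tensor $S=S_T:=\operatorname{skew}\big(\lambda(\Omega)^{-1}\int_\Omega T\,d\lambda\big)$, which is the orthogonal projection $\pi_{\mathfrak{so}(N)}T$, i.e. the unique $S\in\mathfrak{so}(N)$ with $T-S\perp\mathfrak{so}(N)$.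 Moreover $T-S_T\in H_0(\operatorname{Curl};\Omega)\cap\mathfrak{so}(N)^{\perp}$, and $S_T=0$ if and only if $T\perp\mathfrak{so}(N)$. Thus $(*)$ holds for all $T\in H_0(\operatorname{Curl};\Omega)\cap\mathfrak{so}(N)^{\perp}$ as well. -/

import Mathlib

open MeasureTheory Filter Topology Matrix
open scoped ContDiff

noncomputable section

namespace KornIrrot

/-- `ℝ^N` with the Euclidean norm. -/
abbrev Space (N : ℕ) : Type := EuclideanSpace ℝ (Fin N)

variable {N : ℕ}

/-- The `i`-th classical partial derivative of `φ`. -/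
def partialD (i : Fin N) (φ : Space N → ℝ) (x : Space N) : ℝ :=
  fderiv ℝ φ x (EuclideanSpace.single i 1)

/-- Test functions: `φ ∈ C_c^∞(Ω)`. -/
def IsTest (Ω : Set (Space N)) (φ : Space N → ℝ) : Prop :=
  ContDiff ℝ ∞ φ ∧ HasCompactSupport φ ∧ tsupport φ ⊆ Ω

/-! ### Lebesgue spaces and norms -/

/-- `u ∈ L²(Ω, ℝ)`. -/
def ScalarL2 (Ω : Set (Space N)) (u : Space N → ℝ) : Prop :=
  MemLp u 2 (volume.restrict Ω)

/-- `v ∈ L²(Ω, ℝ^N)`. -/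
def VecL2 (Ω : Set (Space N)) (v : Space N → Fin N → ℝ) : Prop :=
  ∀ i, ScalarL2 Ω (fun x => v x i)

/-- `T ∈ L²(Ω, ℝ^{N×N})`. -/
def TensorL2 (Ω : Set (Space N)) (T : Space N → Matrix (Fin N) (Fin N) ℝ) : Prop :=
  ∀ i j, ScalarL2 Ω (fun x => T x i j)

/-- The `L²(Ω, ℝ)` norm. -/
def scalarNorm (Ω : Set (Space N)) (u : Space N → ℝ) : ℝ :=
  √(∫ x in Ω, u x ^ 2)

/-- The `L²(Ω, ℝ^N)` norm (Euclidean norm on `ℝ^N`). -/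
def vecNorm (Ω : Set (Space N)) (v : Space N → Fin N → ℝ) : ℝ :=
  √(∫ x in Ω, ∑ i, v x i ^ 2)

/-- The `L²(Ω, ℝ^{N×N})` norm (Frobenius norm on `ℝ^{N×N}`). -/
def tensorNorm (Ω : Set (Space N)) (T : Space N → Matrix (Fin N) (Fin N) ℝ) : ℝ :=
  √(∫ x in Ω, ∑ i, ∑ j, T x i j ^ 2)

/-- The `L²(Ω, ℝ^{N×N})` inner product (Frobenius inner product on `ℝ^{N×N}`). -/
def tensorInner (Ω : Set (Space N)) (T S : Space N → Matrix (Fin N) (Fin N) ℝ) : ℝ :=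
  ∫ x in Ω, ∑ i, ∑ j, T x i j * S x i j

/-! ### Symmetric and skew-symmetric parts -/

/-- `sym A = (A + Aᵀ) / 2`. -/
def symPart (A : Matrix (Fin N) (Fin N) ℝ) : Matrix (Fin N) (Fin N) ℝ :=
  (1 / 2 : ℝ) • (A + Aᵀ)

/-- `skew A = (A - Aᵀ) / 2`. -/
def skewPart (A : Matrix (Fin N) (Fin N) ℝ) : Matrix (Fin N) (Fin N) ℝ :=
  (1 / 2 : ℝ) • (A - Aᵀ)

/-- `so(N)`, the set of skew-symmetric matrices. -/
def so (N : ℕ) : Set (Matrix (Fin N) (Fin N) ℝ) :=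
  {A | Aᵀ = -A}

/-- The mean value of the tensor field `T` over `Ω`. -/
def tensorMean (Ω : Set (Space N)) (T : Space N → Matrix (Fin N) (Fin N) ℝ) :
    Matrix (Fin N) (Fin N) ℝ :=
  Matrix.of fun i j => ⨍ x in Ω, T x i j

/-- `S_T = skew ⨍_Ω T`. -/
def skewMean (Ω : Set (Space N)) (T : Space N → Matrix (Fin N) (Fin N) ℝ) :
    Matrix (Fin N) (Fin N) ℝ :=
  skewPart (tensorMean Ω T)

/-- `T ⊥ so(N)` in `L²(Ω)`. -/
def PerpSo (Ω : Set (Space N)) (T : Space N → Matrix (Fin N) (Fin N) ℝ) : Prop :=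
  ∀ B ∈ so N, tensorInner Ω T (fun _ => B) = 0

/-- The matrix `S` is the `L²(Ω)`-orthogonal projection of `T` onto the constant
skew-symmetric tensor fields. -/
def IsSoProjection (Ω : Set (Space N)) (T : Space N → Matrix (Fin N) (Fin N) ℝ)
    (S : Matrix (Fin N) (Fin N) ℝ) : Prop :=
  S ∈ so N ∧ PerpSo Ω (fun x => T x - S)

/-! ### Weak derivatives and Sobolev spaces -/

/-- `∂_i u = g` in `Ω` in the weak sense. -/
def HasWeakPartial (Ω : Set (Space N)) (i : Fin N) (u g : Space N → ℝ) : Prop :=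
  ∀ φ, IsTest Ω φ → ∫ x in Ω, u x * partialD i φ x = -∫ x in Ω, g x * φ x

/-- `u ∈ H(grad; Ω) = H¹(Ω)`, with weak gradient `g`. -/
def MemH1 (Ω : Set (Space N)) (u : Space N → ℝ) (g : Space N → Fin N → ℝ) : Prop :=
  ScalarL2 Ω u ∧ VecL2 Ω g ∧ ∀ i, HasWeakPartial Ω i u (fun x => g x i)

/-- `v ∈ H(Grad; Ω) = H¹(Ω, ℝ^N)`, with `Grad v = G` the weak Jacobian: the `n`-th row of `G` is
the gradient of the `n`-th component of `v`. -/
def MemHGrad (Ω : Set (Space N)) (v : Space N → Fin N → ℝ)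
    (G : Space N → Matrix (Fin N) (Fin N) ℝ) : Prop :=
  ∀ n, MemH1 Ω (fun x => v x n) (fun x => G x n)

/-- `curl v = w` in `Ω` in the weak sense, `(curl v)_{ij} = ∂_i v_j - ∂_j v_i`.  All index pairs
are listed instead of the pairs `i < j` only; the entries are antisymmetric. -/
def HasWeakCurl (Ω : Set (Space N)) (v : Space N → Fin N → ℝ)
    (w : Space N → Matrix (Fin N) (Fin N) ℝ) : Prop :=
  ∀ i j φ, IsTest Ω φ →
    ∫ x in Ω, (v x j * partialD i φ x - v x i * partialD j φ x) = -∫ x in Ω, w x i j * φ x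

/-- The classical curl of a vector field. -/
def classicalCurl (v : Space N → Fin N → ℝ) (x : Space N) : Matrix (Fin N) (Fin N) ℝ :=
  Matrix.of fun i j => partialD i (fun y => v y j) x - partialD j (fun y => v y i) x

/-- `Φ|_Ω` belongs to `C^∞_∘(Γt, Ω)`: `Φ` is smooth with compact support in `ℝ^N`, and the support
of `Φ|_Ω` has positive distance to `Γt`. -/
def IsBoundaryTest (Ω Γt : Set (Space N)) (Φ : Space N → Fin N → ℝ) : Prop :=
  ContDiff ℝ ∞ Φ ∧ HasCompactSupport Φ ∧
    ∃ δ > 0, ∀ x ∈ Ω, Φ x ≠ 0 → ∀ y ∈ Γt, δ ≤ dist x y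

/-- `v ∈ H(curl; Ω)`, i.e. `v` and its weak curl are square integrable. -/
def MemHcurl (Ω : Set (Space N)) (v : Space N → Fin N → ℝ) : Prop :=
  VecL2 Ω v ∧ ∃ w, TensorL2 Ω w ∧ HasWeakCurl Ω v w

/-- `v` belongs to `H_∘(curl; Γt, Ω)`, the closure of `C^∞_∘(Γt, Ω)` in `H(curl; Ω)`. -/
def MemHcurlCirc (Ω Γt : Set (Space N)) (v : Space N → Fin N → ℝ) : Prop :=
  VecL2 Ω v ∧ ∃ w, TensorL2 Ω w ∧ HasWeakCurl Ω v w ∧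
    ∀ ε > 0, ∃ Φ, IsBoundaryTest Ω Γt Φ ∧
      vecNorm Ω (fun x => v x - Φ x) < ε ∧
      tensorNorm Ω (fun x => w x - classicalCurl Φ x) < ε

/-- `T ∈ H_0(Curl; Ω)`: the rows of `T` lie in `H(curl; Ω)` and have vanishing curl. -/
def MemHCurlZero (Ω : Set (Space N)) (T : Space N → Matrix (Fin N) (Fin N) ℝ) : Prop :=
  ∀ n, MemHcurl Ω (fun x => T x n) ∧ HasWeakCurl Ω (fun x => T x n) 0

/-- `T` belongs to `H_{∘,0}(Curl; Γt, Ω)`: the rows of `T` lie in `H_∘(curl; Γt, Ω)` and have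
vanishing curl. -/
def MemHCurlCircZero (Ω Γt : Set (Space N)) (T : Space N → Matrix (Fin N) (Fin N) ℝ) : Prop :=
  ∀ n, MemHcurlCirc Ω Γt (fun x => T x n) ∧ HasWeakCurl Ω (fun x => T x n) 0

/-! ### Domains -/

/-- Korn's second inequality holds in `Ω`. -/
def KornSecond (Ω : Set (Space N)) : Prop :=
  ∃ c : ℝ, 0 < c ∧ ∀ v G, MemHGrad Ω v G →
    c * tensorNorm Ω G ≤ vecNorm Ω v + tensorNorm Ω (fun x => symPart (G x))

/-- Rellich's selection theorem holds in `Ω`: every bounded sequence in `H¹(Ω)` has a subsequence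
which converges in `L²(Ω)`. -/
def Rellich (Ω : Set (Space N)) : Prop :=
  ∀ (u : ℕ → Space N → ℝ) (g : ℕ → Space N → Fin N → ℝ) (C : ℝ),
    (∀ k, MemH1 Ω (u k) (g k) ∧ scalarNorm Ω (u k) ≤ C ∧ vecNorm Ω (g k) ≤ C) →
    ∃ (s : ℕ → ℕ) (u₀ : Space N → ℝ), StrictMono s ∧ ScalarL2 Ω u₀ ∧
      Tendsto (fun k => scalarNorm Ω (fun x => u (s k) x - u₀ x)) atTop (𝓝 0)

/-- The Korn property. -/
def KornProperty (Ω : Set (Space N)) : Prop :=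
  KornSecond Ω ∧ Rellich Ω

/-- A bounded domain (nonempty, open, connected, bounded). -/
def IsBoundedDomain (Ω : Set (Space N)) : Prop :=
  IsOpen Ω ∧ IsConnected Ω ∧ Bornology.IsBounded Ω

/-- `Γt` is a relatively open subset of the boundary of `Ω`. -/
def IsBoundaryPart (Ω Γt : Set (Space N)) : Prop :=
  ∃ U, IsOpen U ∧ Γt = U ∩ frontier Ω

/-- The interior of a subset `A` of the boundary of `Ω`, in the topology of that boundary. -/
def boundaryInterior (Ω A : Set (Space N)) : Set (Space N) :=
  Subtype.val '' interior ((Subtype.val : frontier Ω → Space N) ⁻¹' A)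

/-- The family `P` is a slicing of the pair `(Ω, Γt)`: the sets `P j` are disjoint, open, simply
connected subdomains of `Ω` with the Korn property, they exhaust `Ω` up to a Lebesgue null set,
and if `Γt` is nonempty then each of them touches `Γt` in a set with nonempty relative interior.
The pair is sliceable iff it has a slicing. -/
structure IsSlicing (Ω Γt : Set (Space N)) {J : ℕ} (P : Fin J → Set (Space N)) : Prop where
  null : volume (Ω \ ⋃ j, P j) = 0
  disjoint : Pairwise fun j k => Disjoint (P j) (P k)
  subset : ∀ j, P j ⊆ Ω
  isOpen : ∀ j, IsOpen (P j)
  simplyConnected : ∀ j, IsSimplyConnected (P j)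
  korn : ∀ j, KornProperty (P j)
  touches : Γt.Nonempty → ∀ j, (boundaryInterior Ω (closure (P j) ∩ Γt)).Nonempty

/-- `Ω` has (weakly) Lipschitz boundary at `x`: some bi-Lipschitz chart `e` around `x` maps `Ω` to
a half space and the boundary of `Ω` to the bounding hyperplane. -/
def LipschitzBoundaryAt (Ω : Set (Space N)) (x : Space N) : Prop :=
  ∃ (e : OpenPartialHomeomorph (Space N) (Space N)) (i : Fin N) (K : NNReal),
    x ∈ e.source ∧ LipschitzOnWith K e e.source ∧ LipschitzOnWith K e.symm e.target ∧
    ∀ y ∈ e.source, (y ∈ Ω ↔ 0 < e y i) ∧ (y ∈ frontier Ω ↔ e y i = 0)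

/-- `S` is a skew-symmetric tensor field which is constant on each of the sets `P j`. -/
def IsPiecewiseConstSkew {J : ℕ} (P : Fin J → Set (Space N))
    (S : Space N → Matrix (Fin N) (Fin N) ℝ) : Prop :=
  ∀ j, ∃ A ∈ so N, ∀ x ∈ P j, S x = A

end KornIrrot

end

open KornIrrot

open MeasureTheory Filter Topology Matrix
open scoped ContDiff

noncomputable section

namespace KornIrrot

variable {N : ℕ}

/-! ### The scalar `L²` norm -/

/-! The proof is a compactness argument by contradiction (`exists_coercivity_const`). If the
estimate fails on a class of irrotational fields closed under scaling, there are `T k` in it of norm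
one with `sym (T k) → 0`. On a simply connected slice every row of `T k` is a gradient, and
Poincaré's inequality bounds its potential. Rellich's theorem makes a subsequence of the potentials
Cauchy in `L²`, and Korn's second inequality, applied to differences, makes `T k` itself Cauchy
(`exists_l2Cauchy_subseq_piece`). Finitely many slices fill `Ω` up to a null set, so a subsequence
converges in `L²(Ω)`.

The limit `S` is irrotational and skew. As `∂_i S_nj` is symmetric in `i, j` and skew in `n, j`, it
vanishes, so `S` is a constant skew matrix on the connected set `Ω` (`exists_ae_eq_so`). It remains
to see that this constant is zero, which contradicts norm one. For fields orthogonal to `so N` this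
is immediate, orthogonality being preserved in the limit (`exists_korn_const_perpSo`); subtracting
`skewMean Ω T` then yields (ii) and (ii'). For (i), fields with vanishing tangential trace on `Γt`
extend by zero to irrotational fields on `Ω ∪ W`, with `W` a ball around a point of `Γt`
(`hasWeakCurl_indicator`). The extended limit is constant on this larger connected set and vanishes
on the part of `W` outside `closure Ω`, which is nonempty by the Lipschitz chart
(`exists_korn_const_circ`).

Most of the work is the passage from weak curl zero to an `L²` potential. Mollification and an `L¹`
Poincaré inequality give potentials on small balls, a covering space glues them
(`exists_potential`), and truncation by `arctan` together with Rellich's theorem upgrades local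
integrability to `L²` (`scalarL2_of_weakGradient`). -/

theorem scalarNorm_nonneg (Ω : Set (Space N)) (u : Space N → ℝ) : 0 ≤ scalarNorm Ω u :=
  Real.sqrt_nonneg _

theorem ScalarL2.memLp {Ω : Set (Space N)} {u : Space N → ℝ} (hu : ScalarL2 Ω u) :
    MemLp u 2 (volume.restrict Ω) :=
  hu

theorem ScalarL2.sq_integrable {Ω : Set (Space N)} {u : Space N → ℝ} (hu : ScalarL2 Ω u) :
    IntegrableOn (fun x => u x ^ 2) Ω :=
  MemLp.integrable_sq hu

theorem scalarNorm_sq (Ω : Set (Space N)) (u : Space N → ℝ) :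
    scalarNorm Ω u ^ 2 = ∫ x in Ω, u x ^ 2 :=
  Real.sq_sqrt (integral_nonneg fun _ => sq_nonneg _)

/-- The integral in `scalarNorm` has the default value zero when `u ^ 2` is not integrable, so
membership in `L²` is what gives access to the triangle inequality, definiteness and completeness of
`eLpNorm`. -/
theorem scalarNorm_eq_toReal {Ω : Set (Space N)} {u : Space N → ℝ} (hu : ScalarL2 Ω u) :
    scalarNorm Ω u = (eLpNorm u 2 (volume.restrict Ω)).toReal := by
  rw [MemLp.eLpNorm_eq_integral_rpow_norm (by norm_num) (by norm_num) hu, ENNReal.toReal_ofReal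
    (by positivity), scalarNorm, Real.sqrt_eq_rpow]
  simp

theorem scalarNorm_congr_ae {Ω : Set (Space N)} {u w : Space N → ℝ}
    (h : u =ᵐ[volume.restrict Ω] w) : scalarNorm Ω u = scalarNorm Ω w := by
  unfold scalarNorm
  congr 1
  exact integral_congr_ae (h.mono fun x hx => by simp [hx])

theorem scalarNorm_add_le {Ω : Set (Space N)} {u w : Space N → ℝ} (hu : ScalarL2 Ω u)
    (hw : ScalarL2 Ω w) :
    scalarNorm Ω (fun x => u x + w x) ≤ scalarNorm Ω u + scalarNorm Ω w := by
  have h : ScalarL2 Ω (fun x => u x + w x) := MemLp.add hu hw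
  rw [scalarNorm_eq_toReal h, scalarNorm_eq_toReal hu, scalarNorm_eq_toReal hw,
    ← ENNReal.toReal_add hu.2.ne hw.2.ne]
  exact ENNReal.toReal_mono (ENNReal.add_ne_top.2 ⟨hu.2.ne, hw.2.ne⟩)
    (eLpNorm_add_le hu.1 hw.1 (by norm_num))

theorem scalarNorm_smul (Ω : Set (Space N)) (a : ℝ) (u : Space N → ℝ) :
    scalarNorm Ω (fun x => a * u x) = |a| * scalarNorm Ω u := by
  unfold scalarNorm
  simp_rw [mul_pow]
  rw [integral_const_mul, Real.sqrt_mul (sq_nonneg a), Real.sqrt_sq_eq_abs]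

theorem scalarNorm_neg (Ω : Set (Space N)) (u : Space N → ℝ) :
    scalarNorm Ω (fun x => -u x) = scalarNorm Ω u := by
  simpa using scalarNorm_smul Ω (-1) u

theorem scalarNorm_sub_le {Ω : Set (Space N)} {u w : Space N → ℝ} (hu : ScalarL2 Ω u)
    (hw : ScalarL2 Ω w) :
    scalarNorm Ω (fun x => u x - w x) ≤ scalarNorm Ω u + scalarNorm Ω w := by
  have h := scalarNorm_add_le hu (w := fun x => -w x) (MemLp.neg hw)
  rw [scalarNorm_neg] at h
  simpa [sub_eq_add_neg] using h

theorem scalarNorm_mono_set {D Ω : Set (Space N)} (hD : D ⊆ Ω) {u : Space N → ℝ}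
    (hu : ScalarL2 Ω u) : scalarNorm D u ≤ scalarNorm Ω u :=
  Real.sqrt_le_sqrt (setIntegral_mono_set hu.sq_integrable (ae_of_all _ fun _ => sq_nonneg _)
    hD.eventuallyLE)

theorem ScalarL2.mono {D Ω : Set (Space N)} (hD : D ⊆ Ω) {u : Space N → ℝ}
    (hu : ScalarL2 Ω u) : ScalarL2 D u :=
  MemLp.mono_measure (Measure.restrict_mono hD le_rfl) hu

theorem abs_integral_mul_le {Ω : Set (Space N)} {u w : Space N → ℝ} (hu : ScalarL2 Ω u)
    (hw : ScalarL2 Ω w) : |∫ x in Ω, u x * w x| ≤ scalarNorm Ω u * scalarNorm Ω w := by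
  have h := integral_mul_norm_le_Lp_mul_Lq (μ := volume.restrict Ω) (f := u) (g := w)
    (p := 2) (q := 2) Real.HolderConjugate.two_two (by simpa using hu.memLp)
    (by simpa using hw.memLp)
  refine (abs_integral_le_integral_abs).trans ?_
  simpa [scalarNorm, Real.sqrt_eq_rpow, abs_mul] using h

theorem scalarNorm_eq_zero {Ω : Set (Space N)} {u : Space N → ℝ} (hu : ScalarL2 Ω u)
    (h : scalarNorm Ω u = 0) : u =ᵐ[volume.restrict Ω] 0 := by
  rw [scalarNorm_eq_toReal hu, ENNReal.toReal_eq_zero_iff] at h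
  exact (eLpNorm_eq_zero_iff hu.1 (by norm_num)).1 (h.resolve_right hu.2.ne)

theorem ScalarL2.const_mul {Ω : Set (Space N)} {u : Space N → ℝ} (hu : ScalarL2 Ω u) (a : ℝ) :
    ScalarL2 Ω (fun x => a * u x) :=
  MemLp.const_mul hu a

theorem ScalarL2.sub {Ω : Set (Space N)} {u w : Space N → ℝ} (hu : ScalarL2 Ω u)
    (hw : ScalarL2 Ω w) : ScalarL2 Ω (fun x => u x - w x) :=
  MemLp.sub hu hw

theorem ScalarL2.add {Ω : Set (Space N)} {u w : Space N → ℝ} (hu : ScalarL2 Ω u)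
    (hw : ScalarL2 Ω w) : ScalarL2 Ω (fun x => u x + w x) :=
  MemLp.add hu hw

theorem scalarL2_const {Ω : Set (Space N)} (hΩ : Bornology.IsBounded Ω) (a : ℝ) :
    ScalarL2 Ω (fun _ => a) := by
  have : IsFiniteMeasure (volume.restrict Ω) := ⟨by simpa using hΩ.measure_lt_top⟩
  exact memLp_const a

theorem ScalarL2.integrableOn {Ω : Set (Space N)} (hΩ : Bornology.IsBounded Ω)
    {u : Space N → ℝ} (hu : ScalarL2 Ω u) : IntegrableOn u Ω := by
  have : IsFiniteMeasure (volume.restrict Ω) := ⟨by simpa using hΩ.measure_lt_top⟩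
  exact MemLp.integrable (by norm_num) hu

theorem scalarL2_of_continuous {Ω : Set (Space N)} {φ : Space N → ℝ}
    (hφ : Continuous φ) (hc : HasCompactSupport φ) : ScalarL2 Ω φ :=
  (hφ.memLp_of_hasCompactSupport hc).restrict Ω

/-- If `u k → w` in `L²(Ω)`, then `∫ u k * φ → ∫ w * φ` for `φ ∈ L²(Ω)`. -/
theorem tendsto_integral_mul_of_scalarNorm {Ω : Set (Space N)} {u : ℕ → Space N → ℝ}
    {w φ : Space N → ℝ} (hu : ∀ k, ScalarL2 Ω (u k)) (hw : ScalarL2 Ω w) (hφ : ScalarL2 Ω φ)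
    (h : Tendsto (fun k => scalarNorm Ω (fun x => u k x - w x)) atTop (𝓝 0)) :
    Tendsto (fun k => ∫ x in Ω, u k x * φ x) atTop (𝓝 (∫ x in Ω, w x * φ x)) := by
  rw [tendsto_iff_dist_tendsto_zero]
  refine squeeze_zero (fun _ => dist_nonneg) (fun k => ?_)
    (by simpa using h.mul_const (scalarNorm Ω φ))
  have h1 : Integrable (fun x => u k x * φ x) (volume.restrict Ω) :=
    MemLp.integrable_mul (hu k).memLp hφ.memLp
  have h2 : Integrable (fun x => w x * φ x) (volume.restrict Ω) :=
    MemLp.integrable_mul hw.memLp hφ.memLp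
  rw [Real.dist_eq, ← integral_sub h1 h2]
  simp_rw [← sub_mul]
  exact abs_integral_mul_le ((hu k).sub hw) hφ

/-- Completeness of `L²(Ω)`. -/
theorem exists_tendsto_of_cauchy {Ω : Set (Space N)} {u : ℕ → Space N → ℝ}
    (hu : ∀ k, ScalarL2 Ω (u k))
    (h : ∀ ε > 0, ∃ n, ∀ k ≥ n, ∀ l ≥ n, scalarNorm Ω (fun x => u k x - u l x) < ε) :
    ∃ w, ScalarL2 Ω w ∧ Tendsto (fun k => scalarNorm Ω (fun x => u k x - w x)) atTop (𝓝 0) := by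
  have hd : ∀ k l, dist ((hu k).memLp.toLp) ((hu l).memLp.toLp) =
      scalarNorm Ω (fun x => u k x - u l x) := by
    intro k l
    rw [dist_eq_norm, ← MemLp.toLp_sub, Lp.norm_toLp, scalarNorm_eq_toReal ((hu k).sub (hu l))]
    rfl
  have hc : CauchySeq fun k => (hu k).memLp.toLp := by
    rw [Metric.cauchySeq_iff]
    intro ε hε
    obtain ⟨n, hn⟩ := h ε hε
    exact ⟨n, fun k hk l hl => by rw [hd]; exact hn k hk l hl⟩
  obtain ⟨w, hw⟩ := cauchySeq_tendsto_of_complete hc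
  have hwm : ScalarL2 Ω w := Lp.memLp w
  refine ⟨w, hwm, ?_⟩
  rw [tendsto_iff_dist_tendsto_zero] at hw
  refine hw.congr fun k => ?_
  rw [scalarNorm_eq_toReal ((hu k).sub hwm), Lp.dist_def]
  congr 1
  exact eLpNorm_congr_ae (((hu k).memLp.coeFn_toLp).sub (ae_eq_refl _))

/-! ### Vector and tensor norms in terms of components -/

theorem vecNorm_nonneg (Ω : Set (Space N)) (v : Space N → Fin N → ℝ) : 0 ≤ vecNorm Ω v :=
  Real.sqrt_nonneg _

theorem tensorNorm_nonneg (Ω : Set (Space N)) (T : Space N → Matrix (Fin N) (Fin N) ℝ) :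
    0 ≤ tensorNorm Ω T :=
  Real.sqrt_nonneg _

theorem vecNorm_sq {Ω : Set (Space N)} {v : Space N → Fin N → ℝ} (hv : VecL2 Ω v) :
    vecNorm Ω v ^ 2 = ∑ i, scalarNorm Ω (fun x => v x i) ^ 2 := by
  simp_rw [scalarNorm_sq]
  rw [vecNorm, Real.sq_sqrt (integral_nonneg fun _ => Finset.sum_nonneg fun _ _ => sq_nonneg _),
    integral_finsetSum _ fun i _ => (hv i).sq_integrable]

theorem tensorNorm_sq {Ω : Set (Space N)} {T : Space N → Matrix (Fin N) (Fin N) ℝ}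
    (hT : TensorL2 Ω T) :
    tensorNorm Ω T ^ 2 = ∑ i, ∑ j, scalarNorm Ω (fun x => T x i j) ^ 2 := by
  simp_rw [scalarNorm_sq]
  refine (Real.sq_sqrt (integral_nonneg fun _ => Finset.sum_nonneg fun _ _ =>
      Finset.sum_nonneg fun _ _ => sq_nonneg _)).trans ?_
  rw [integral_finsetSum _ fun i _ => integrable_finsetSum _ fun j _ => (hT i j).sq_integrable]
  exact Finset.sum_congr rfl fun i _ => integral_finsetSum _ fun j _ => (hT i j).sq_integrable

theorem scalarNorm_le_vecNorm {Ω : Set (Space N)} {v : Space N → Fin N → ℝ} (hv : VecL2 Ω v)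
    (i : Fin N) : scalarNorm Ω (fun x => v x i) ≤ vecNorm Ω v := by
  refine abs_le_of_sq_le_sq' ?_ (vecNorm_nonneg Ω v) |>.2
  rw [vecNorm_sq hv]
  exact Finset.single_le_sum (f := fun i => scalarNorm Ω (fun x => v x i) ^ 2)
    (fun _ _ => sq_nonneg _) (Finset.mem_univ i)

theorem scalarNorm_le_tensorNorm {Ω : Set (Space N)} {T : Space N → Matrix (Fin N) (Fin N) ℝ}
    (hT : TensorL2 Ω T) (i j : Fin N) : scalarNorm Ω (fun x => T x i j) ≤ tensorNorm Ω T := by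
  refine abs_le_of_sq_le_sq' ?_ (tensorNorm_nonneg Ω T) |>.2
  rw [tensorNorm_sq hT]
  refine le_trans ?_ (Finset.single_le_sum (f := fun i => ∑ j, scalarNorm Ω (fun x => T x i j) ^ 2)
    (fun _ _ => Finset.sum_nonneg fun _ _ => sq_nonneg _) (Finset.mem_univ i))
  exact Finset.single_le_sum (f := fun j => scalarNorm Ω (fun x => T x i j) ^ 2)
    (fun _ _ => sq_nonneg _) (Finset.mem_univ j)

/-- The `ℓ²` norm is at most the `ℓ¹` norm. It reduces tensor estimates to entries; the dimensional
factors lost are harmless, because the final constant comes from compactness. -/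
theorem sum_sq_le_sq_sum {ι : Type*} (s : Finset ι) (f : ι → ℝ) (hf : ∀ i, 0 ≤ f i) :
    ∑ i ∈ s, f i ^ 2 ≤ (∑ i ∈ s, f i) ^ 2 := by
  rw [sq, Finset.sum_mul]
  refine Finset.sum_le_sum fun i hi => ?_
  rw [sq]
  exact mul_le_mul_of_nonneg_left (Finset.single_le_sum (fun j _ => hf j) hi) (hf i)

theorem vecNorm_le_sum {Ω : Set (Space N)} {v : Space N → Fin N → ℝ} (hv : VecL2 Ω v) :
    vecNorm Ω v ≤ ∑ i, scalarNorm Ω (fun x => v x i) := by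
  refine abs_le_of_sq_le_sq' ?_ (Finset.sum_nonneg fun _ _ => scalarNorm_nonneg _ _) |>.2
  rw [vecNorm_sq hv]
  exact sum_sq_le_sq_sum _ _ fun _ => scalarNorm_nonneg _ _

theorem tensorNorm_le_sum {Ω : Set (Space N)} {T : Space N → Matrix (Fin N) (Fin N) ℝ}
    (hT : TensorL2 Ω T) : tensorNorm Ω T ≤ ∑ i, ∑ j, scalarNorm Ω (fun x => T x i j) := by
  refine abs_le_of_sq_le_sq' ?_ (Finset.sum_nonneg fun _ _ => Finset.sum_nonneg fun _ _ =>
    scalarNorm_nonneg _ _) |>.2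
  rw [tensorNorm_sq hT]
  refine le_trans (Finset.sum_le_sum fun i _ => sum_sq_le_sq_sum _ _ fun _ => scalarNorm_nonneg _ _)
    (sum_sq_le_sq_sum _ _ fun _ => Finset.sum_nonneg fun _ _ => scalarNorm_nonneg _ _)

theorem tensorNorm_smul (Ω : Set (Space N)) (a : ℝ) (T : Space N → Matrix (Fin N) (Fin N) ℝ) :
    tensorNorm Ω (fun x => a • T x) = |a| * tensorNorm Ω T := by
  unfold tensorNorm
  simp_rw [Matrix.smul_apply, smul_eq_mul, mul_pow, ← Finset.mul_sum]
  rw [integral_const_mul, Real.sqrt_mul (sq_nonneg a), Real.sqrt_sq_eq_abs]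

theorem TensorL2.symPart {Ω : Set (Space N)} {T : Space N → Matrix (Fin N) (Fin N) ℝ}
    (hT : TensorL2 Ω T) : TensorL2 Ω (fun x => symPart (T x)) :=
  fun i j => ((hT i j).add (hT j i)).const_mul (1 / 2)

/-! ### Subsequences -/

/-- Finitely many properties, each of which can be reached by passing to a subsequence and is
inherited by subsequences, can be reached simultaneously. -/
theorem exists_common_subseq {ι : Type*} [Finite ι] (Q : ι → (ℕ → ℕ) → Prop)
    (hsub : ∀ i (s t : ℕ → ℕ), StrictMono t → Q i s → Q i (s ∘ t))
    (hex : ∀ i (s : ℕ → ℕ), StrictMono s → ∃ t, StrictMono t ∧ Q i (s ∘ t)) :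
    ∃ s, StrictMono s ∧ ∀ i, Q i s := by
  classical
  cases nonempty_fintype ι
  suffices h : ∀ F : Finset ι, ∃ s, StrictMono s ∧ ∀ i ∈ F, Q i s by
    obtain ⟨s, hs, h⟩ := h Finset.univ
    exact ⟨s, hs, fun i => h i (Finset.mem_univ i)⟩
  intro F
  induction F using Finset.induction_on with
  | empty => exact ⟨id, strictMono_id, by simp⟩
  | insert a F _ ih =>
    obtain ⟨s, hs, h⟩ := ih
    obtain ⟨t, ht, hQ⟩ := hex a s hs
    refine ⟨s ∘ t, hs.comp ht, fun i hi => ?_⟩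
    rcases Finset.mem_insert.1 hi with rfl | hi
    · exact hQ
    · exact hsub i s t ht (h i hi)

/-! ### Integrals against test functions -/

theorem partialD_eq_zero_of_notMem {φ : Space N → ℝ} {x : Space N} (i : Fin N)
    (hx : x ∉ tsupport φ) : partialD i φ x = 0 := by
  have : x ∉ tsupport (fderiv ℝ φ) := fun h => hx (tsupport_fderiv_subset ℝ h)
  rw [partialD, image_eq_zero_of_notMem_tsupport this]
  rfl

theorem continuous_partialD {φ : Space N → ℝ} (hφ : ContDiff ℝ ∞ φ) (i : Fin N) :
    Continuous (partialD i φ) :=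
  (hφ.continuous_fderiv (by simp)).clm_apply continuous_const

theorem hasCompactSupport_partialD {φ : Space N → ℝ} (hφ : HasCompactSupport φ) (i : Fin N) :
    HasCompactSupport (partialD i φ) :=
  HasCompactSupport.intro hφ fun _ hx => partialD_eq_zero_of_notMem i hx

/-- Integrals against a test function do not see the domain. Weak identities are moved between
domains by passing through the integral over the whole space. -/
theorem setIntegral_mul_test {D : Set (Space N)} {φ : Space N → ℝ} (hφ : tsupport φ ⊆ D)
    (u : Space N → ℝ) : ∫ x in D, u x * φ x = ∫ x, u x * φ x :=
  setIntegral_eq_integral_of_forall_compl_eq_zero fun x hx => by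
    rw [image_eq_zero_of_notMem_tsupport fun h => hx (hφ h), mul_zero]

theorem setIntegral_mul_partialD {D : Set (Space N)} {φ : Space N → ℝ} (hφ : tsupport φ ⊆ D)
    (u : Space N → ℝ) (i : Fin N) :
    ∫ x in D, u x * partialD i φ x = ∫ x, u x * partialD i φ x :=
  setIntegral_eq_integral_of_forall_compl_eq_zero fun x hx => by
    rw [partialD_eq_zero_of_notMem i fun h => hx (hφ h), mul_zero]

theorem IsTest.mono {D D' : Set (Space N)} (h : D' ⊆ D) {φ : Space N → ℝ} (hφ : IsTest D' φ) :
    IsTest D φ :=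
  ⟨hφ.1, hφ.2.1, hφ.2.2.trans h⟩

theorem HasWeakPartial.mono {D D' : Set (Space N)} (h : D' ⊆ D) {i : Fin N} {u g : Space N → ℝ}
    (hu : HasWeakPartial D i u g) : HasWeakPartial D' i u g := by
  intro φ hφ
  have := hu φ (hφ.mono h)
  rwa [setIntegral_mul_test (hφ.mono h).2.2, setIntegral_mul_partialD (hφ.mono h).2.2,
    ← setIntegral_mul_test hφ.2.2, ← setIntegral_mul_partialD hφ.2.2] at this

theorem HasWeakPartial.congr_ae {D : Set (Space N)} {i : Fin N} {u g u' g' : Space N → ℝ}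
    (hu : HasWeakPartial D i u g) (h : u =ᵐ[volume.restrict D] u')
    (h' : g =ᵐ[volume.restrict D] g') : HasWeakPartial D i u' g' := by
  intro φ hφ
  have h1 : ∫ x in D, u x * partialD i φ x = ∫ x in D, u' x * partialD i φ x :=
    integral_congr_ae (h.mono fun x hx => by simp only [hx])
  have h2 : ∫ x in D, g x * φ x = ∫ x in D, g' x * φ x :=
    integral_congr_ae (h'.mono fun x hx => by simp only [hx])
  rw [← h1, ← h2]
  exact hu φ hφ

theorem HasWeakCurl.mono {D D' : Set (Space N)} (h : D' ⊆ D) {v : Space N → Fin N → ℝ}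
    {w : Space N → Matrix (Fin N) (Fin N) ℝ}
    (hv : HasWeakCurl D v w) : HasWeakCurl D' v w := by
  intro i j φ hφ
  have := hv i j φ (hφ.mono h)
  have key : ∀ E : Set (Space N), tsupport φ ⊆ E →
      ∫ x in E, (v x j * partialD i φ x - v x i * partialD j φ x) =
        ∫ x, (v x j * partialD i φ x - v x i * partialD j φ x) := fun E hE =>
    setIntegral_eq_integral_of_forall_compl_eq_zero fun x hx => by
      rw [partialD_eq_zero_of_notMem i fun h => hx (hE h),
        partialD_eq_zero_of_notMem j fun h => hx (hE h), mul_zero, mul_zero, sub_zero]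
  rwa [key _ (hφ.mono h).2.2, setIntegral_mul_test (hφ.mono h).2.2,
    ← key _ hφ.2.2, ← setIntegral_mul_test hφ.2.2] at this

/-- A locally integrable function times a continuous function with compact support in the
domain is integrable. -/
theorem integrable_mul_of_tsupport_subset {D : Set (Space N)} {u ψ : Space N → ℝ}
    (hu : LocallyIntegrableOn u D) (hψ : Continuous ψ) (hc : HasCompactSupport ψ)
    (hs : tsupport ψ ⊆ D) : Integrable fun x => u x * ψ x := by
  have h1 : IntegrableOn u (tsupport ψ) := hu.integrableOn_compact_subset hs hc
  have h2 : IntegrableOn (fun x => u x * ψ x) (tsupport ψ) :=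
    h1.mul_continuousOn hψ.continuousOn hc
  refine (integrableOn_iff_integrable_of_support_subset ?_).1 h2
  intro x hx
  by_contra h
  exact hx (by simp [image_eq_zero_of_notMem_tsupport h])

/-! ### Mollification -/

/-- A standard bump function, supported in the ball of radius `1 / (n + 1)`. -/
def mollBump (N n : ℕ) : ContDiffBump (0 : Space N) where
  rIn := 1 / (n + 1) / 2
  rOut := 1 / (n + 1)
  rIn_pos := by positivity
  rIn_lt_rOut := by
    have : (0 : ℝ) < 1 / (n + 1) := by positivity
    linarith

open scoped Convolution in
/-- Mollification at scale `1 / (n + 1)`. -/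
def moll (n : ℕ) (f : Space N → ℝ) : Space N → ℝ :=
  (mollBump N n).normed volume ⋆[ContinuousLinearMap.lsmul ℝ ℝ, volume] f

/-- The kernel `t ↦ η (x - t)` of the mollification at the point `x`. -/
def mollKernel (n : ℕ) (x t : Space N) : ℝ :=
  (mollBump N n).normed volume (x - t)

theorem contDiff_moll (n : ℕ) {f : Space N → ℝ} (hf : LocallyIntegrable f) :
    ContDiff ℝ ∞ (moll n f) :=
  HasCompactSupport.contDiff_convolution_left (n := ⊤) _ (mollBump N n).hasCompactSupport_normed
    (mollBump N n).contDiff_normed hf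

theorem moll_apply (n : ℕ) (f : Space N → ℝ) (x : Space N) :
    moll n f x = ∫ t, f t * mollKernel n x t := by
  rw [moll, convolution_eq_swap]
  simp [mollKernel, mul_comm]

theorem contDiff_mollKernel (n : ℕ) (x : Space N) : ContDiff ℝ ∞ (mollKernel n x) :=
  ((mollBump N n).contDiff_normed (n := ⊤)).comp (contDiff_const.sub contDiff_id)

theorem tsupport_mollKernel (n : ℕ) (x : Space N) :
    tsupport (mollKernel n x) ⊆ Metric.closedBall x (1 / (n + 1)) := by
  refine closure_minimal (fun t ht => ?_) Metric.isClosed_closedBall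
  have h : x - t ∈ Function.support ((mollBump N n).normed volume) := ht
  rw [ContDiffBump.support_normed_eq, mem_ball_zero_iff, ← dist_eq_norm, dist_comm] at h
  exact h.le

theorem isTest_mollKernel {n : ℕ} {x : Space N} {D : Set (Space N)}
    (h : Metric.closedBall x (1 / (n + 1)) ⊆ D) : IsTest D (mollKernel n x) :=
  ⟨contDiff_mollKernel n x, HasCompactSupport.of_support_subset_isCompact
    (isCompact_closedBall x (1 / (n + 1))) ((subset_tsupport _).trans (tsupport_mollKernel n x)),
    (tsupport_mollKernel n x).trans h⟩

-- The derivative falls on the kernel `η (x - t)`; taking it in `t` instead of `x` produces the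
-- sign.
open scoped Convolution in
theorem partialD_moll (n : ℕ) {f : Space N → ℝ} (hf : LocallyIntegrable f) (i : Fin N)
    (x : Space N) :
    partialD i (moll n f) x = -∫ t, f t * partialD i (mollKernel n x) t := by
  have hc := (mollBump N n).hasCompactSupport_normed (μ := (volume : Measure (Space N)))
  have hs : ContDiff ℝ 1 ((mollBump N n).normed (volume : Measure (Space N))) :=
    (mollBump N n).contDiff_normed (n := 1)
  have h1 : moll n f = (f ⋆[(ContinuousLinearMap.lsmul ℝ ℝ).flip, volume]
      (mollBump N n).normed volume) := by rw [moll, convolution_flip]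
  rw [partialD, h1, (hc.hasFDerivAt_convolution_right _ hf hs x).fderiv,
    convolution_precompR_apply _ hf (hc.fderiv ℝ) (hs.continuous_fderiv one_ne_zero),
    convolution_def, ← integral_neg]
  refine integral_congr_ae (ae_of_all _ fun t => ?_)
  have h2 : HasFDerivAt (mollKernel n x) _ t :=
    (hs.differentiable one_ne_zero (x - t)).hasFDerivAt.comp t ((hasFDerivAt_id t).const_sub x)
  simp [partialD, h2.fderiv, mul_comm]

/-- Mollification turns weak derivatives into classical ones. -/
theorem partialD_moll_eq {n : ℕ} {u g : Space N → ℝ} (hu : LocallyIntegrable u)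
    {D : Set (Space N)} {i : Fin N} (h : HasWeakPartial D i u g) {x : Space N}
    (hx : Metric.closedBall x (1 / (n + 1)) ⊆ D) : partialD i (moll n u) x = moll n g x := by
  have ht := isTest_mollKernel hx
  have := h _ ht
  rw [setIntegral_mul_test ht.2.2, setIntegral_mul_partialD ht.2.2] at this
  rw [partialD_moll n hu, this, neg_neg, moll_apply]

/-- As long as the ball of mollification stays inside `D`, the kernel itself is an admissible test
function in the weak identity. -/
theorem curl_moll_eq_zero {n : ℕ} {v : Space N → Fin N → ℝ}
    (hv : ∀ i, LocallyIntegrable fun x => v x i) {D : Set (Space N)} (h : HasWeakCurl D v 0)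
    {x : Space N} (hx : Metric.closedBall x (1 / (n + 1)) ⊆ D) (i j : Fin N) :
    partialD i (moll n fun x => v x j) x = partialD j (moll n fun x => v x i) x := by
  have ht := isTest_mollKernel hx
  have h1 := h i j _ ht
  have hint : ∀ k l, Integrable fun t => v t k * partialD l (mollKernel n x) t := fun k l =>
    integrable_mul_of_tsupport_subset ((hv k).locallyIntegrableOn Set.univ)
      (continuous_partialD ht.1 l) (hasCompactSupport_partialD ht.2.1 l) (Set.subset_univ _)
  rw [integral_sub (hint j i).integrableOn (hint i j).integrableOn,
    setIntegral_mul_partialD (u := fun x => v x j) ht.2.2,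
    setIntegral_mul_partialD (u := fun x => v x i) ht.2.2] at h1
  simp only [Pi.zero_apply, Matrix.zero_apply, zero_mul, integral_zero, neg_zero] at h1
  rw [partialD_moll n (hv j), partialD_moll n (hv i), sub_eq_zero.1 h1]

theorem ae_tendsto_moll {f : Space N → ℝ} (hf : LocallyIntegrable f) :
    ∀ᵐ x, Tendsto (fun n => moll n f x) atTop (𝓝 (f x)) := by
  -- The two radii of `mollBump` have ratio `2`; Lebesgue differentiation needs this ratio bounded
  -- as the scale shrinks.
  refine ContDiffBump.ae_convolution_tendsto_right_of_locallyIntegrable (K := 2)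
    tendsto_one_div_add_atTop_nhds_zero_nat (Eventually.of_forall fun n => ?_) hf
  simp only [mollBump]
  linarith

theorem integrable_moll (n : ℕ) {f : Space N → ℝ} (hf : Integrable f) : Integrable (moll n f) :=
  (mollBump N n).integrable_normed.integrable_convolution _ hf

/-- The kernel is nonnegative with mass one: `|moll n f| ≤ moll n |f|` pointwise, and mollification
preserves the integral. -/
theorem integral_abs_moll_le (n : ℕ) {f : Space N → ℝ} (hf : Integrable f) :
    ∫ x, |moll n f x| ≤ ∫ x, |f x| := by
  have h1 : ∫ x, moll n (fun x => |f x|) x = ∫ x, |f x| := by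
    rw [moll, integral_convolution _ (mollBump N n).integrable_normed hf.abs]
    simp [ContDiffBump.integral_normed]
  rw [← h1]
  refine integral_mono (integrable_moll n hf).abs (integrable_moll n hf.abs) fun x => ?_
  simp only [moll_apply]
  refine abs_integral_le_integral_abs.trans_eq (integral_congr_ae (ae_of_all _ fun t => ?_))
  simp [abs_mul, mollKernel, abs_of_nonneg ((mollBump N n).nonneg_normed _)]

theorem moll_sub (n : ℕ) {f g : Space N → ℝ} (hf : LocallyIntegrable f)
    (hg : LocallyIntegrable g) (x : Space N) :
    moll n (fun x => f x - g x) x = moll n f x - moll n g x := by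
  simp only [moll_apply, sub_mul]
  have ht := isTest_mollKernel (n := n) (x := x) (Set.subset_univ _)
  exact integral_sub
    (integrable_mul_of_tsupport_subset (hf.locallyIntegrableOn Set.univ) ht.1.continuous ht.2.1
      ht.2.2)
    (integrable_mul_of_tsupport_subset (hg.locallyIntegrableOn Set.univ) ht.1.continuous ht.2.1
      ht.2.2)

/-- Uniform continuity makes the difference uniformly small. All mollification radii are at most
`1`, so it lives in one ball of finite volume. -/
theorem tendsto_integral_abs_moll_sub_of_continuous {g : Space N → ℝ} (hg : Continuous g)
    (hc : HasCompactSupport g) :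
    Tendsto (fun n => ∫ x, |moll n g x - g x|) atTop (𝓝 0) := by
  obtain ⟨R, hR⟩ := hc.isCompact.isBounded.subset_closedBall (0 : Space N)
  have hu : UniformContinuous g := hg.uniformContinuous_of_tendsto_cocompact hc.is_zero_at_infty
  set V := volume.real (Metric.closedBall (0 : Space N) (R + 1))
  rw [Metric.tendsto_atTop]
  intro ε hε
  set ε' := ε / (2 * (V + 1))
  have hV : 0 ≤ V := measureReal_nonneg
  have hε' : 0 < ε' := by positivity
  obtain ⟨δ, hδ, hgδ⟩ := Metric.uniformContinuous_iff.1 hu ε' hε'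
  obtain ⟨n₀, hn₀⟩ := exists_nat_one_div_lt hδ
  refine ⟨n₀, fun n hn => ?_⟩
  have hn' : (1 : ℝ) / (n + 1) < δ := (one_div_le_one_div_of_le (by positivity)
    (by exact_mod_cast Nat.succ_le_succ hn)).trans_lt hn₀
  have hbd : ∀ x, |moll n g x - g x| ≤ ε' := fun x =>
    (mollBump N n).dist_normed_convolution_le hg.aestronglyMeasurable fun y hy =>
      (hgδ ((Metric.mem_ball.1 hy).trans hn')).le
  have hsupp : ∀ x ∉ Metric.closedBall (0 : Space N) (R + 1), |moll n g x - g x| = 0 := by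
    intro x hx
    rw [mem_closedBall_zero_iff, not_le] at hx
    have hz : ∀ t, ‖t‖ > R → g t = 0 := fun t ht => image_eq_zero_of_notMem_tsupport fun h => by
      have := hR h
      rw [mem_closedBall_zero_iff] at this
      linarith
    rw [hz x (by linarith), moll_apply, integral_eq_zero_of_ae, sub_zero, abs_zero]
    refine ae_of_all _ fun t => ?_
    by_cases ht : ‖t‖ > R
    · simp [hz t ht]
    · have : t ∉ tsupport (mollKernel n x) := fun h => by
        have h1 := tsupport_mollKernel n x h
        rw [Metric.mem_closedBall, dist_comm, dist_eq_norm] at h1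
        have h2 : (1 : ℝ) / (n + 1) ≤ 1 := by
          rw [div_le_one (by positivity)]
          have : (0 : ℝ) ≤ n := n.cast_nonneg
          linarith
        have h3 := norm_sub_norm_le x t
        linarith
      simp [image_eq_zero_of_notMem_tsupport this]
  rw [Real.dist_eq, sub_zero, abs_of_nonneg (integral_nonneg fun _ => abs_nonneg _),
    ← setIntegral_eq_integral_of_forall_compl_eq_zero hsupp]
  have hle : ∫ x in Metric.closedBall (0 : Space N) (R + 1), |moll n g x - g x| ≤ ε' * V := by
    have := norm_setIntegral_le_of_norm_le_const (f := fun x => |moll n g x - g x|) (C := ε')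
      (s := Metric.closedBall (0 : Space N) (R + 1)) (μ := volume) measure_closedBall_lt_top
      fun x _ => by simpa using hbd x
    exact (le_abs_self _).trans this
  refine hle.trans_lt ?_
  calc ε' * V ≤ ε' * (V + 1) := by gcongr; linarith
    _ = ε / 2 := by simp only [ε']; field_simp
    _ < ε := by linarith

/-- Mollifications of an integrable function converge in `L¹`. -/
theorem tendsto_integral_abs_moll_sub {f : Space N → ℝ} (hf : Integrable f) :
    Tendsto (fun n => ∫ x, |moll n f x - f x|) atTop (𝓝 0) := by
  rw [Metric.tendsto_atTop]
  intro ε hε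
  -- Three terms of size `ε / 4`: `moll n (f - g)` by the `L¹` contraction, `moll n g - g` by the
  -- continuous case, and `f - g` by density.
  obtain ⟨g, hgc, hfg, hg, hgi⟩ := hf.exists_hasCompactSupport_integral_sub_le
    (show 0 < ε / 4 by positivity)
  obtain ⟨n₀, hn₀⟩ := Metric.tendsto_atTop.1
    (tendsto_integral_abs_moll_sub_of_continuous hg hgc) (ε / 4) (by positivity)
  refine ⟨n₀, fun n hn => ?_⟩
  have h0 := hn₀ n hn
  rw [Real.dist_eq, sub_zero, abs_of_nonneg (integral_nonneg fun _ => abs_nonneg _)] at h0 ⊢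
  have h1 := integral_abs_moll_le n (hf.sub hgi)
  have hi1 := (integrable_moll n (hf.sub hgi)).abs
  have hi2 := ((integrable_moll n hgi).sub hgi).abs
  have hi3 := (hf.sub hgi).abs
  have hsum : ∫ x, |moll n f x - f x| ≤ ∫ x, (|moll n (fun x => f x - g x) x| +
      |moll n g x - g x| + |f x - g x|) := by
    refine integral_mono ((integrable_moll n hf).sub hf).abs ((hi1.add hi2).add hi3) fun x => ?_
    simp only [moll_sub n hf.locallyIntegrable hgi.locallyIntegrable]
    calc |moll n f x - f x|
        = |(moll n f x - moll n g x) + (moll n g x - g x) + -(f x - g x)| := by ring_nf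
      _ ≤ |(moll n f x - moll n g x) + (moll n g x - g x)| + |-(f x - g x)| := abs_add_le _ _
      _ ≤ _ := by rw [abs_neg]; gcongr; exact abs_add_le _ _
  have h2 : ∫ x, (|moll n (fun x => f x - g x) x| + |moll n g x - g x| + |f x - g x|) =
      (∫ x, |moll n (fun x => f x - g x) x|) + (∫ x, |moll n g x - g x|) +
        ∫ x, |f x - g x| :=
    (integral_add (hi1.add hi2) hi3).trans (congrArg (· + _) (integral_add hi1 hi2))
  simp only [Real.norm_eq_abs] at hfg
  have h3 : ∫ x, |moll n (fun x => f x - g x) x| ≤ ∫ x, |f x - g x| := h1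
  linarith

/-! ### Functions with vanishing weak gradient -/

theorem integrable_indicator_of_locallyIntegrableOn {U K : Set (Space N)} {u : Space N → ℝ}
    (hu : LocallyIntegrableOn u U) (hK : IsCompact K) (hKU : K ⊆ U) :
    Integrable (K.indicator u) :=
  (hu.integrableOn_compact_subset hKU hK).integrable_indicator hK.measurableSet

theorem indicator_ae_eq_restrict {D K : Set (Space N)} (h : D ⊆ K) (hD : MeasurableSet D)
    (u : Space N → ℝ) : u =ᵐ[volume.restrict D] K.indicator u := by
  filter_upwards [ae_restrict_mem hD] with x hx
  rw [Set.indicator_of_mem (h hx)]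

theorem HasFDerivAt.eq_zero_of_partialD {φ : Space N → ℝ} {x : Space N}
    (h : ∀ i, partialD i φ x = 0) : fderiv ℝ φ x = 0 := by
  ext y
  have hy : y = ∑ i, y i • EuclideanSpace.single i (1 : ℝ) := by
    simpa using ((EuclideanSpace.basisFun (Fin N) ℝ).sum_repr y).symm
  rw [hy, map_sum]
  simp only [map_smul]
  exact Finset.sum_eq_zero fun i _ => by rw [show fderiv ℝ φ x _ = 0 from h i, smul_zero]

/-- Mollifications have vanishing classical gradient on the ball, so they are constant there, and
they converge to `u` almost everywhere. Cutting off at radius `2 * r` gives a globally integrable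
function and leaves a margin `r` for the mollification. -/
theorem exists_ae_eq_const_ball {U : Set (Space N)} {u : Space N → ℝ}
    (hu : LocallyIntegrableOn u U) (h : ∀ i, HasWeakPartial U i u 0) {x : Space N} {r : ℝ}
    (hr : 0 < r) (hx : Metric.closedBall x (2 * r) ⊆ U) :
    ∃ c, ∀ᵐ y, y ∈ Metric.ball x r → u y = c := by
  set K := Metric.closedBall x (2 * r)
  set w := K.indicator u
  have hw : Integrable w :=
    integrable_indicator_of_locallyIntegrableOn hu (isCompact_closedBall x _) hx
  have hwk : ∀ i, HasWeakPartial (Metric.ball x (2 * r)) i w 0 := fun i =>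
    ((h i).mono (Metric.ball_subset_closedBall.trans hx)).congr_ae
      (indicator_ae_eq_restrict Metric.ball_subset_closedBall measurableSet_ball u) (ae_eq_refl _)
  have hlim := ae_tendsto_moll hw.locallyIntegrable
  obtain ⟨n₀, hn₀⟩ := exists_nat_one_div_lt hr
  have hconst : ∀ n ≥ n₀, ∀ y ∈ Metric.ball x r, moll n w y = moll n w x := by
    intro n hn y hy
    refine (convex_ball x r).is_const_of_fderivWithin_eq_zero (𝕜 := ℝ)
      (((contDiff_moll n hw.locallyIntegrable).differentiable (by simp)).differentiableOn)
      (fun z hz => ?_) hy (Metric.mem_ball_self hr)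
    rw [fderivWithin_of_isOpen Metric.isOpen_ball hz]
    refine HasFDerivAt.eq_zero_of_partialD fun i => ?_
    rw [partialD_moll_eq hw.locallyIntegrable (hwk i) (x := z), moll_apply]
    · simp
    · intro t ht
      rw [Metric.mem_closedBall] at ht
      rw [Metric.mem_ball] at hz ⊢
      have h1 : (1 : ℝ) / (n + 1) ≤ 1 / (n₀ + 1) := one_div_le_one_div_of_le (by positivity)
        (by exact_mod_cast Nat.succ_le_succ hn)
      linarith [dist_triangle t z x]
  -- One point of convergence is enough to know that the sequence of constants `moll n w x`
  -- converges.
  have hne : ∃ y ∈ Metric.ball x r, Tendsto (fun n => moll n w y) atTop (𝓝 (w y)) := by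
    by_contra! hcon
    have h0 : volume (Metric.ball x r) = 0 := measure_mono_null (fun y hy => hcon y hy) hlim
    exact (Metric.measure_ball_pos volume x hr).ne' h0
  obtain ⟨y, hy, hyl⟩ := hne
  refine ⟨w y, ?_⟩
  filter_upwards [hlim] with z hz hzb
  have h1 : Tendsto (fun n => moll n w z) atTop (𝓝 (w y)) := by
    refine hyl.congr' ?_
    filter_upwards [eventually_ge_atTop n₀] with n hn
    rw [hconst n hn y hy, hconst n hn z hzb]
  rw [← tendsto_nhds_unique hz h1]
  exact (Set.indicator_of_mem (Metric.ball_subset_closedBall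
    (Metric.ball_subset_ball (by linarith) hzb)) u).symm

theorem eq_of_ae_eq_const {V : Set (Space N)} (hV : IsOpen V) (hne : V.Nonempty)
    {u : Space N → ℝ} {a b : ℝ} (ha : ∀ᵐ y, y ∈ V → u y = a) (hb : ∀ᵐ y, y ∈ V → u y = b) :
    a = b := by
  by_contra hab
  have h0 : volume V = 0 := by
    refine measure_mono_null ?_ (ha.and hb)
    intro y hy h
    exact hab ((h.1 hy).symm.trans (h.2 hy))
  exact (hV.measure_pos volume hne).ne' h0

/-- A locally integrable function with vanishing weak gradient on a connected open set is almost
everywhere constant. -/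
theorem exists_ae_eq_const {U : Set (Space N)} (hU : IsOpen U) (hc : IsPreconnected U)
    {u : Space N → ℝ} (hu : LocallyIntegrableOn u U) (h : ∀ i, HasWeakPartial U i u 0) :
    ∃ c, ∀ᵐ y, y ∈ U → u y = c := by
  have hloc : ∀ x : U, ∃ r > 0, Metric.ball (x : Space N) r ⊆ U ∧
      ∃ c, ∀ᵐ y, y ∈ Metric.ball (x : Space N) r → u y = c := by
    rintro ⟨x, hx⟩
    obtain ⟨ε, hε, hεU⟩ := Metric.nhds_basis_closedBall.mem_iff.1 (hU.mem_nhds hx)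
    refine ⟨ε / 2, by positivity, (Metric.ball_subset_closedBall.trans
      (Metric.closedBall_subset_closedBall (by linarith))).trans hεU, ?_⟩
    exact exists_ae_eq_const_ball hu h (by positivity) (by rwa [mul_div_cancel₀ _ two_ne_zero])
  choose r hr hrU c hc' using hloc
  -- Overlapping balls share an open set of positive measure, which forces their constants to agree.
  have hlc : IsLocallyConstant c := by
    refine (IsLocallyConstant.iff_eventually_eq c).2 fun x => ?_
    have : ∀ᶠ y : U in 𝓝 x, (y : Space N) ∈ Metric.ball (x : Space N) (r x) :=
      continuous_subtype_val.continuousAt.eventually (Metric.ball_mem_nhds _ (hr x))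
    filter_upwards [this] with y hy
    exact eq_of_ae_eq_const (V := Metric.ball (y : Space N) (r y) ∩ Metric.ball (x : Space N) (r x))
      (Metric.isOpen_ball.inter Metric.isOpen_ball)
      ⟨(y : Space N), Metric.mem_ball_self (hr y), hy⟩
      ((hc' y).mono fun z hz h => hz h.1) ((hc' x).mono fun z hz h => hz h.2)
  rcases U.eq_empty_or_nonempty with rfl | ⟨x₀, hx₀⟩
  · exact ⟨0, by simp⟩
  have := isPreconnected_iff_preconnectedSpace.1 hc
  refine ⟨c ⟨x₀, hx₀⟩, ?_⟩
  rw [ae_iff]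
  refine measure_null_of_locally_null _ fun y hy => ?_
  simp only [Classical.not_imp, Set.mem_ofPred_eq] at hy
  refine ⟨_, inter_mem_nhdsWithin _ (Metric.ball_mem_nhds y (hr ⟨y, hy.1⟩)), ?_⟩
  refine measure_mono_null ?_ (hc' ⟨y, hy.1⟩)
  rintro z ⟨hz, hzb⟩ h
  simp only [Classical.not_imp, Set.mem_ofPred_eq] at hz
  exact hz.2 ((h hzb).trans (hlc.apply_eq_of_preconnectedSpace _ _))

/-- An irrotational tensor field with skew-symmetric values on a connected open set is almost
everywhere equal to a constant skew-symmetric matrix. -/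
theorem exists_ae_eq_so {U : Set (Space N)} (hU : IsOpen U) (hc : IsConnected U)
    {T : Space N → Matrix (Fin N) (Fin N) ℝ}
    (hT : ∀ i j, LocallyIntegrableOn (fun x => T x i j) U)
    (hcurl : ∀ n, HasWeakCurl U (fun x => T x n) 0)
    (hsym : ∀ᵐ x, x ∈ U → symPart (T x) = 0) :
    ∃ A ∈ so N, ∀ᵐ x, x ∈ U → T x = A := by
  have hskew : ∀ n j, ∀ᵐ x, x ∈ U → T x n j = -T x j n := by
    intro n j
    filter_upwards [hsym] with x hx hxU
    have := congrFun (congrFun (hx hxU) n) j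
    simp only [symPart, Matrix.smul_apply, Matrix.add_apply, Matrix.transpose_apply,
      Matrix.zero_apply, smul_eq_mul] at this
    linarith
  have hsw : ∀ φ, IsTest U φ → ∀ n i j, ∫ x in U, T x n j * partialD i φ x =
      ∫ x in U, T x n i * partialD j φ x := by
    intro φ hφ n i j
    have hint : ∀ k l, IntegrableOn (fun x => T x n k * partialD l φ x) U := fun k l =>
      (integrable_mul_of_tsupport_subset (hT n k) (continuous_partialD hφ.1 l)
        (hasCompactSupport_partialD hφ.2.1 l) ((closure_minimal (fun x hx => by
          by_contra h
          exact hx (partialD_eq_zero_of_notMem l h)) (isClosed_tsupport φ)).trans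
            hφ.2.2)).integrableOn
    have := hcurl n i j φ hφ
    rw [integral_sub (hint j i) (hint i j)] at this
    simp only [Pi.zero_apply, Matrix.zero_apply, zero_mul, integral_zero, neg_zero] at this
    linarith
  have hanti : ∀ φ : Space N → ℝ, ∀ n i j, ∫ x in U, T x n j * partialD i φ x =
      -∫ x in U, T x j n * partialD i φ x := by
    intro φ n i j
    rw [← integral_neg]
    refine setIntegral_congr_ae hU.measurableSet ?_
    filter_upwards [hskew n j] with x hx hxU
    rw [hx hxU, neg_mul]
  -- Alternating the two symmetries gives `∂_i T_nj = ∂_j T_ni = -∂_j T_in = -∂_n T_ij = ∂_n T_ji =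
  -- ∂_i T_jn = -∂_i T_nj`.
  have hzero : ∀ n j i, HasWeakPartial U i (fun x => T x n j) 0 := by
    intro n j i φ hφ
    have h1 := hsw φ hφ n i j
    have h2 := hanti φ n j i
    have h3 := hsw φ hφ i j n
    have h4 := hanti φ i n j
    have h5 := hsw φ hφ j n i
    have h6 := hanti φ j i n
    simp only [Pi.zero_apply, zero_mul, integral_zero, neg_zero]
    linarith
  choose A hA using fun n j => exists_ae_eq_const hU hc.isPreconnected (hT n j) (hzero n j)
  refine ⟨Matrix.of A, ?_, ?_⟩
  · ext n j
    simp only [Matrix.transpose_apply, Matrix.of_apply, Matrix.neg_apply]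
    refine eq_of_ae_eq_const hU hc.nonempty (hA j n) ?_
    filter_upwards [hA n j, hskew j n] with x hx hx' hxU
    rw [hx' hxU, hx hxU]
  · have : ∀ᵐ x, ∀ n j, x ∈ U → T x n j = A n j :=
      ae_all_iff.2 fun n => ae_all_iff.2 fun j => hA n j
    filter_upwards [this] with x hx hxU
    ext n j
    exact hx n j hxU

/-! ### `L¹` limits -/

theorem exists_tendsto_integral_abs_of_cauchy {μ : Measure (Space N)} {u : ℕ → Space N → ℝ}
    (hu : ∀ k, Integrable (u k) μ)
    (h : ∀ ε > 0, ∃ n, ∀ k ≥ n, ∀ l ≥ n, ∫ x, |u k x - u l x| ∂μ < ε) :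
    ∃ w, Integrable w μ ∧ Tendsto (fun k => ∫ x, |u k x - w x| ∂μ) atTop (𝓝 0) := by
  have hd : ∀ {f g : Space N → ℝ} (hf : Integrable f μ) (hg : Integrable g μ),
      dist (hf.toL1 f) (hg.toL1 g) = ∫ x, |f x - g x| ∂μ := by
    intro f g hf hg
    rw [dist_eq_norm, ← Integrable.toL1_sub, L1.norm_of_fun_eq_integral_norm]
    rfl
  have hc : CauchySeq fun k => (hu k).toL1 (u k) := by
    rw [Metric.cauchySeq_iff]
    intro ε hε
    obtain ⟨n, hn⟩ := h ε hε
    exact ⟨n, fun k hk l hl => by rw [hd]; exact hn k hk l hl⟩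
  obtain ⟨w, hw⟩ := cauchySeq_tendsto_of_complete hc
  refine ⟨w, L1.integrable_coeFn w, ?_⟩
  rw [tendsto_iff_dist_tendsto_zero] at hw
  refine hw.congr fun k => ?_
  rw [← hd (hu k) (L1.integrable_coeFn w), Integrable.toL1_coeFn]

theorem tendsto_integral_mul_of_integral_abs {μ : Measure (Space N)} {u : ℕ → Space N → ℝ}
    {w ψ : Space N → ℝ} (hu : ∀ k, Integrable (u k) μ) (hw : Integrable w μ)
    (h : Tendsto (fun k => ∫ x, |u k x - w x| ∂μ) atTop (𝓝 0)) (hψ : Continuous ψ)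
    (hc : HasCompactSupport ψ) :
    Tendsto (fun k => ∫ x, u k x * ψ x ∂μ) atTop (𝓝 (∫ x, w x * ψ x ∂μ)) := by
  obtain ⟨C, hC⟩ := hc.exists_bound_of_continuous hψ
  have hi : ∀ f, Integrable f μ → Integrable (fun x => f x * ψ x) μ := fun f hf =>
    hf.mul_bdd (c := C) hψ.aestronglyMeasurable (ae_of_all _ hC)
  rw [tendsto_iff_dist_tendsto_zero]
  refine squeeze_zero (fun _ => dist_nonneg) (fun k => ?_) (by simpa using h.mul_const C)
  rw [Real.dist_eq, ← integral_sub (hi _ (hu k)) (hi _ hw), ← integral_mul_const]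
  refine abs_integral_le_integral_abs.trans (integral_mono ((hi _ (hu k)).sub (hi _ hw)).abs
    (((hu k).sub hw).abs.mul_const C) fun x => ?_)
  simp only [← sub_mul, abs_mul]
  gcongr
  exact hC x

/-! ### A Poincaré inequality in `L¹` of a ball -/

/-- The fundamental theorem of calculus along the segment. The indicator confines the gradient to
`V`, so that later integrations can run over the whole space and use translation invariance. -/
theorem enorm_sub_le_lintegral_segment {h : Space N → ℝ} {dh : Space N → Space N →L[ℝ] ℝ}
    {V : Set (Space N)} (hV : Convex ℝ V) (hdh : Continuous dh)
    (hd : ∀ y ∈ V, HasFDerivAt h (dh y) y) {x z : Space N} (hx : x ∈ V) (hz : x + z ∈ V) :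
    ‖h x - h (x + z)‖ₑ ≤
      ‖z‖ₑ * ∫⁻ t in Set.Icc (0 : ℝ) 1, V.indicator (fun y => ‖dh y‖ₑ) (x + t • z) := by
  have hmem : ∀ t ∈ Set.Icc (0 : ℝ) 1, x + t • z ∈ V := fun t ht => by
    simpa using hV.add_smul_mem hx hz ht
  have hderiv : ∀ t ∈ Set.uIcc (0 : ℝ) 1,
      HasDerivAt (fun t : ℝ => h (x + t • z)) (dh (x + t • z) z) t := by
    intro t ht
    rw [Set.uIcc_of_le zero_le_one] at ht
    have h1 : HasDerivAt (fun t : ℝ => x + t • z) z t := by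
      simpa using ((hasDerivAt_id t).smul_const z).const_add x
    exact (hd _ (hmem t ht)).comp_hasDerivAt t h1
  have hcont : Continuous fun t : ℝ => dh (x + t • z) z := by fun_prop
  have hint := intervalIntegral.integral_eq_sub_of_hasDerivAt hderiv
    (hcont.intervalIntegrable 0 1)
  rw [one_smul, zero_smul, add_zero, intervalIntegral.integral_of_le zero_le_one,
    ← integral_Icc_eq_integral_Ioc] at hint
  rw [← enorm_neg, neg_sub, ← hint]
  refine (enorm_integral_le_lintegral_enorm _).trans ?_
  rw [← lintegral_const_mul' _ _ enorm_ne_top]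
  refine setLIntegral_mono' measurableSet_Icc fun t ht => ?_
  rw [Set.indicator_of_mem (hmem t ht), mul_comm]
  exact (dh (x + t • z)).le_opENorm z

/-- Put `y = x + z` with `‖z‖ < 2 * r` and bound the difference along the segment. By Tonelli and a
translation by `t • z`, each pair `(z, t)` contributes exactly the integral of `‖dh‖ₑ` over the
ball. -/
theorem lintegral_lintegral_enorm_sub_le {h : Space N → ℝ} {dh : Space N → Space N →L[ℝ] ℝ}
    (hdh : Continuous dh) {x₀ : Space N} {r : ℝ}
    (hd : ∀ y ∈ Metric.ball x₀ r, HasFDerivAt h (dh y) y) :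
    ∫⁻ x in Metric.ball x₀ r, ∫⁻ y in Metric.ball x₀ r, ‖h x - h y‖ₑ ≤
      volume (Metric.ball (0 : Space N) (2 * r)) * ENNReal.ofReal (2 * r) *
        ∫⁻ x in Metric.ball x₀ r, ‖dh x‖ₑ := by
  set B := Metric.ball x₀ r
  set B' := Metric.ball (0 : Space N) (2 * r)
  set g : Space N → ENNReal := B.indicator fun y => ‖dh y‖ₑ
  have hBm : MeasurableSet B := measurableSet_ball
  have hg : Measurable g := hdh.enorm.measurable.indicator hBm
  have hgt : Measurable fun p : (Space N × Space N) × ℝ => g (p.1.1 + p.2 • p.1.2) :=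
    hg.comp (by fun_prop)
  have hkey : ∀ x ∈ B, ∫⁻ y in B, ‖h x - h y‖ₑ ≤
      ∫⁻ z in B', ENNReal.ofReal (2 * r) * ∫⁻ t in Set.Icc (0 : ℝ) 1, g (x + t • z) := by
    intro x hx
    rw [← lintegral_indicator hBm, ← lintegral_add_left_eq_self _ x,
      ← lintegral_indicator measurableSet_ball]
    refine lintegral_mono fun z => ?_
    by_cases hz : x + z ∈ B
    · have hzn : ‖z‖ < 2 * r := by
        have h1 : dist (x + z) x ≤ dist (x + z) x₀ + dist x x₀ := dist_triangle_right _ _ _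
        rw [Metric.mem_ball] at hz hx
        rw [dist_self_add_left] at h1
        linarith
      rw [Set.indicator_of_mem hz, Set.indicator_of_mem (mem_ball_zero_iff.2 hzn)]
      refine (enorm_sub_le_lintegral_segment (convex_ball x₀ r) hdh hd hx hz).trans ?_
      gcongr
      rw [← ofReal_norm]
      exact ENNReal.ofReal_le_ofReal hzn.le
    · rw [Set.indicator_of_notMem hz]
      exact zero_le
  calc ∫⁻ x in B, ∫⁻ y in B, ‖h x - h y‖ₑ
      ≤ ∫⁻ x in B, ∫⁻ z in B', ENNReal.ofReal (2 * r) *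
          ∫⁻ t in Set.Icc (0 : ℝ) 1, g (x + t • z) := setLIntegral_mono' hBm hkey
    _ ≤ ∫⁻ x, ∫⁻ z in B', ENNReal.ofReal (2 * r) *
          ∫⁻ t in Set.Icc (0 : ℝ) 1, g (x + t • z) := setLIntegral_le_lintegral _ _
    _ = ∫⁻ z in B', ∫⁻ x, ENNReal.ofReal (2 * r) *
          ∫⁻ t in Set.Icc (0 : ℝ) 1, g (x + t • z) := by
        refine lintegral_lintegral_swap (Measurable.aemeasurable ?_)
        exact (hgt.lintegral_prod_right').const_mul _
    _ = ∫⁻ z in B', ENNReal.ofReal (2 * r) * ∫⁻ x, g x := by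
        refine lintegral_congr fun z => ?_
        rw [lintegral_const_mul' _ _ ENNReal.ofReal_ne_top, lintegral_lintegral_swap]
        · simp_rw [lintegral_add_right_eq_self]
          simp
        · exact Measurable.aemeasurable (hg.comp (by fun_prop))
    _ = _ := by
        rw [lintegral_const, lintegral_indicator hBm, Measure.restrict_apply_univ]
        ring

/-- For mean zero, the volume of the ball times `h x` is the integral of `h x - h y` over `y`. -/
theorem lintegral_enorm_le_of_integral_eq_zero {h : Space N → ℝ}
    {dh : Space N → Space N →L[ℝ] ℝ} (hdh : Continuous dh) {x₀ : Space N} {r : ℝ}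
    (hd : ∀ y ∈ Metric.ball x₀ r, HasFDerivAt h (dh y) y)
    (hi : IntegrableOn h (Metric.ball x₀ r)) (h0 : ∫ x in Metric.ball x₀ r, h x = 0) :
    volume (Metric.ball x₀ r) * ∫⁻ x in Metric.ball x₀ r, ‖h x‖ₑ ≤
      volume (Metric.ball (0 : Space N) (2 * r)) * ENNReal.ofReal (2 * r) *
        ∫⁻ x in Metric.ball x₀ r, ‖dh x‖ₑ := by
  refine le_trans ?_ (lintegral_lintegral_enorm_sub_le hdh hd)
  rw [← lintegral_const_mul' _ _ measure_ball_lt_top.ne]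
  have : IsFiniteMeasure (volume.restrict (Metric.ball x₀ r)) :=
    ⟨by simpa using measure_ball_lt_top⟩
  refine lintegral_mono fun x => ?_
  have h1 : ∫ y in Metric.ball x₀ r, (h x - h y) = volume.real (Metric.ball x₀ r) * h x := by
    rw [integral_sub (integrable_const _) hi, h0, sub_zero, setIntegral_const, smul_eq_mul]
  calc volume (Metric.ball x₀ r) * ‖h x‖ₑ = ‖∫ y in Metric.ball x₀ r, (h x - h y)‖ₑ := by
        rw [h1, enorm_mul, Real.enorm_eq_ofReal measureReal_nonneg, ofReal_measureReal]
    _ ≤ _ := enorm_integral_le_lintegral_enorm _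

/-- Poincaré's inequality in `L¹(B)` for functions of vanishing mean, with the gradient given by
its components. -/
theorem exists_poincare_ball (x₀ : Space N) {r : ℝ} (hr : 0 < r) :
    ∃ C : ℝ, 0 ≤ C ∧ ∀ (h : Space N → ℝ) (v : Fin N → Space N → ℝ), (∀ i, Continuous (v i)) →
      (∀ y ∈ Metric.ball x₀ r,
        HasFDerivAt h (∑ i, v i y • (EuclideanSpace.proj i : Space N →L[ℝ] ℝ)) y) →
      IntegrableOn h (Metric.ball x₀ r) → ∫ x in Metric.ball x₀ r, h x = 0 →
      ∫ x in Metric.ball x₀ r, |h x| ≤ C * ∑ i, ∫ x in Metric.ball x₀ r, |v i x| := by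
  set B := Metric.ball x₀ r
  set V := volume B
  have hV0 : V ≠ 0 := (Metric.measure_ball_pos volume x₀ hr).ne'
  have hVt : V ≠ ⊤ := measure_ball_lt_top.ne
  set C' := volume (Metric.ball (0 : Space N) (2 * r)) * ENNReal.ofReal (2 * r)
  have hC't : C' ≠ ⊤ := ENNReal.mul_ne_top measure_ball_lt_top.ne ENNReal.ofReal_ne_top
  refine ⟨(C' / V).toReal, ENNReal.toReal_nonneg, fun h v hv hd hi h0 => ?_⟩
  have hdh : Continuous fun y => ∑ i, v i y • (EuclideanSpace.proj i : Space N →L[ℝ] ℝ) :=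
    continuous_finsetSum _ fun i _ => (hv i).smul continuous_const
  have key := lintegral_enorm_le_of_integral_eq_zero hdh hd hi h0
  have hvi : ∀ i, IntegrableOn (v i) B := fun i =>
    ((hv i).continuousOn.integrableOn_compact (isCompact_closedBall x₀ r)).mono_set
      Metric.ball_subset_closedBall
  have hsum : ∫⁻ x in B, ‖∑ i, v i x • (EuclideanSpace.proj i : Space N →L[ℝ] ℝ)‖ₑ ≤
      ENNReal.ofReal (∑ i, ∫ x in B, |v i x|) := by
    rw [← integral_finsetSum _ fun i _ => (hvi i).abs,
      ofReal_integral_eq_lintegral_ofReal (integrable_finsetSum _ fun i _ => (hvi i).abs)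
        (ae_of_all _ fun x => Finset.sum_nonneg fun _ _ => abs_nonneg _)]
    refine lintegral_mono fun x => ?_
    rw [← ofReal_norm]
    refine ENNReal.ofReal_le_ofReal ((norm_sum_le _ _).trans (Finset.sum_le_sum fun i _ => ?_))
    rw [norm_smul, Real.norm_eq_abs]
    refine mul_le_of_le_one_right (abs_nonneg _) (ContinuousLinearMap.opNorm_le_bound _
      zero_le_one fun y => ?_)
    simpa using PiLp.norm_apply_le y i
  have h1 : ∫⁻ x in B, ‖h x‖ₑ ≤ C' / V * ENNReal.ofReal (∑ i, ∫ x in B, |v i x|) := by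
    rw [← ENNReal.mul_div_right_comm, ENNReal.le_div_iff_mul_le (Or.inl hV0) (Or.inl hVt), mul_comm]
    exact key.trans (by gcongr)
  have h2 : ∫ x in B, |h x| = (∫⁻ x in B, ‖h x‖ₑ).toReal :=
    integral_norm_eq_lintegral_enorm hi.aestronglyMeasurable
  rw [h2]
  refine (ENNReal.toReal_mono (ENNReal.mul_ne_top (ENNReal.div_ne_top hC't hV0)
    ENNReal.ofReal_ne_top) h1).trans_eq ?_
  rw [ENNReal.toReal_mul, ENNReal.toReal_ofReal
    (Finset.sum_nonneg fun i _ => integral_nonneg fun _ => abs_nonneg _)]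

/-! ### Local potentials of irrotational fields -/

theorem fderiv_apply_eq_sum (φ : Space N → ℝ) (a y : Space N) :
    fderiv ℝ φ a y = ∑ j, y j * partialD j φ a := by
  have hy : y = ∑ i, y i • EuclideanSpace.single i (1 : ℝ) := by
    simpa using ((EuclideanSpace.basisFun (Fin N) ℝ).sum_repr y).symm
  conv_lhs => rw [hy, map_sum]
  simp only [map_smul, smul_eq_mul, partialD]

/-- A smooth irrotational field on a convex open set is a gradient. -/
theorem exists_hasFDerivAt_of_curl_eq_zero {V : Set (Space N)} (hV : Convex ℝ V) (hVo : IsOpen V)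
    {v : Fin N → Space N → ℝ} (hv : ∀ i, ContDiff ℝ ∞ (v i))
    (hcurl : ∀ x ∈ V, ∀ i j, partialD i (v j) x = partialD j (v i) x) :
    ∃ h : Space N → ℝ, ∀ y ∈ V,
      HasFDerivAt h (∑ i, v i y • (EuclideanSpace.proj i : Space N →L[ℝ] ℝ)) y := by
  have hd : ∀ a, HasFDerivAt
      (fun y => ∑ i, v i y • (EuclideanSpace.proj i : Space N →L[ℝ] ℝ))
      (∑ i, (fderiv ℝ (v i) a).smulRight (EuclideanSpace.proj i : Space N →L[ℝ] ℝ)) a := fun a =>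
    HasFDerivAt.fun_sum fun i _ =>
      (((hv i).differentiable (by simp)) a).hasFDerivAt.smul_const
        (EuclideanSpace.proj i : Space N →L[ℝ] ℝ)
  -- Poincaré's lemma for the one-form `∑ i, v i dx_i`; vanishing curl is the symmetry of its
  -- derivative.
  refine hV.exists_forall_hasFDerivAt_of_fderiv_symmetric hVo
    (fun a _ => (hd a).differentiableAt.differentiableWithinAt) fun a ha x y => ?_
  rw [(hd a).fderiv]
  have hp : ∀ (k : Fin N) (z : Space N), (EuclideanSpace.proj k : Space N →L[ℝ] ℝ) z = z k :=
    fun _ _ => rfl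
  simp only [_root_.sum_apply, ContinuousLinearMap.smulRight_apply, _root_.smul_apply, hp,
    smul_eq_mul, fderiv_apply_eq_sum,
    Finset.sum_mul]
  rw [Finset.sum_comm]
  refine Finset.sum_congr rfl fun i _ => Finset.sum_congr rfl fun j _ => ?_
  rw [hcurl a ha i j]
  ring

/-- Nothing is known of `h` outside `D`; integration by parts asks for differentiability only on the
support of the test function. -/
theorem hasWeakPartial_of_hasFDerivAt {D : Set (Space N)} {h : Space N → ℝ}
    {v : Fin N → Space N → ℝ} (hv : ∀ i, Continuous (v i))
    (hd : ∀ y ∈ D, HasFDerivAt h (∑ i, v i y • (EuclideanSpace.proj i : Space N →L[ℝ] ℝ)) y)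
    (hDo : IsOpen D) (i : Fin N) : HasWeakPartial D i h (v i) := by
  intro φ hφ
  have hpart : ∀ y ∈ D, fderiv ℝ h y (EuclideanSpace.single i 1) = v i y := by
    intro y hy
    rw [(hd y hy).fderiv]
    simp
  have hloc : LocallyIntegrableOn h D :=
    ContinuousOn.locallyIntegrableOn (fun y hy => (hd y hy).continuousAt.continuousWithinAt)
      hDo.measurableSet
  have heq : ∀ x, fderiv ℝ h x (EuclideanSpace.single i 1) * φ x = v i x * φ x := by
    intro x
    by_cases hx : x ∈ tsupport φ
    · rw [hpart x (hφ.2.2 hx)]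
    · rw [image_eq_zero_of_notMem_tsupport hx, mul_zero, mul_zero]
  rw [setIntegral_mul_partialD hφ.2.2, setIntegral_mul_test hφ.2.2]
  have := integral_mul_fderiv_eq_neg_fderiv_mul_of_integrable (μ := volume) (f := h) (g := φ)
    (v := EuclideanSpace.single i (1 : ℝ)) ?_ ?_ ?_
    (fun x hx => (hd x (hφ.2.2 hx)).differentiableAt)
    (fun x _ => (hφ.1.differentiable (by simp)) x)
  · simp only [heq] at this
    exact this
  · simp only [heq]
    exact integrable_mul_of_tsupport_subset ((hv i).locallyIntegrable.locallyIntegrableOn D)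
      hφ.1.continuous hφ.2.1 hφ.2.2
  · exact integrable_mul_of_tsupport_subset hloc (continuous_partialD hφ.1 i)
      (hasCompactSupport_partialD hφ.2.1 i) ((closure_minimal (fun x hx => by
          by_contra h
          exact hx (partialD_eq_zero_of_notMem i h)) (isClosed_tsupport φ)).trans hφ.2.2)
  · exact integrable_mul_of_tsupport_subset hloc hφ.1.continuous hφ.2.1 hφ.2.2

/-- An irrotational field has a potential on small balls. -/
theorem exists_potential_ball {D : Set (Space N)} {v : Space N → Fin N → ℝ}
    (hv : ∀ i, LocallyIntegrableOn (fun x => v x i) D) (hcurl : HasWeakCurl D v 0)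
    {x₀ : Space N} {r : ℝ} (hr : 0 < r) (hx₀ : Metric.closedBall x₀ (3 * r) ⊆ D) :
    ∃ u, IntegrableOn u (Metric.ball x₀ r) ∧
      ∀ i, HasWeakPartial (Metric.ball x₀ r) i u (fun x => v x i) := by
  set B := Metric.ball x₀ r
  -- Three radii: the field is cut off at `3 * r`, mollified at scales below `r` and hence
  -- irrotational up to `2 * r`, and the potentials are compared on radius `r`.
  set K := Metric.closedBall x₀ (3 * r)
  set w : Space N → Fin N → ℝ := fun x i => K.indicator (fun x => v x i) x
  have hw : ∀ i, Integrable fun x => w x i := fun i =>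
    integrable_indicator_of_locallyIntegrableOn (hv i) (isCompact_closedBall _ _) hx₀
  have hwc : HasWeakCurl (Metric.ball x₀ (3 * r)) w 0 := by
    intro i j φ hφ
    rw [← hcurl.mono (Metric.ball_subset_closedBall.trans hx₀) i j φ hφ]
    refine setIntegral_congr_fun measurableSet_ball fun x hx => ?_
    have hxK : x ∈ K := Metric.ball_subset_closedBall hx
    simp only [w, Set.indicator_of_mem hxK]
  obtain ⟨n₀, hn₀⟩ := exists_nat_one_div_lt hr
  set a : ℕ → Fin N → Space N → ℝ := fun n i => moll (n + n₀) fun x => w x i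
  have hac : ∀ n i, ContDiff ℝ ∞ (a n i) := fun n i => contDiff_moll _ (hw i).locallyIntegrable
  have hacurl : ∀ n, ∀ x ∈ Metric.ball x₀ (2 * r), ∀ i j,
      partialD i (a n j) x = partialD j (a n i) x := by
    intro n x hx i j
    refine curl_moll_eq_zero (fun i => (hw i).locallyIntegrable) hwc (fun t ht => ?_) i j
    rw [Metric.mem_closedBall] at ht
    rw [Metric.mem_ball] at hx ⊢
    have h1 : (1 : ℝ) / ((n + n₀ : ℕ) + 1) ≤ 1 / (n₀ + 1) :=
      one_div_le_one_div_of_le (by positivity) (by push_cast; linarith [n.cast_nonneg (α := ℝ)])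
    linarith [dist_triangle t x x₀]
  choose h hh using fun n => exists_hasFDerivAt_of_curl_eq_zero
    (convex_ball x₀ (2 * r)) Metric.isOpen_ball (hac n) (hacurl n)
  have hsub : Metric.closedBall x₀ r ⊆ Metric.ball x₀ (2 * r) :=
    Metric.closedBall_subset_ball (by linarith)
  have hsub' : B ⊆ Metric.ball x₀ (2 * r) := Metric.ball_subset_closedBall.trans hsub
  have hhi : ∀ n, IntegrableOn (h n) B := fun n =>
    (ContinuousOn.integrableOn_compact (isCompact_closedBall x₀ r) fun y hy =>
      (hh n y (hsub hy)).continuousAt.continuousWithinAt).mono_set Metric.ball_subset_closedBall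
  have hai : ∀ n i, IntegrableOn (a n i) B := fun n i => (integrable_moll _ (hw i)).integrableOn
  have halim : ∀ i, Tendsto (fun n => ∫ x in B, |a n i x - w x i|) atTop (𝓝 0) := by
    intro i
    refine squeeze_zero (fun n => integral_nonneg fun _ => abs_nonneg _) (fun n => ?_)
      ((tendsto_add_atTop_iff_nat n₀).2 (tendsto_integral_abs_moll_sub (hw i)))
    exact setIntegral_le_integral ((integrable_moll _ (hw i)).sub (hw i)).abs
      (ae_of_all _ fun _ => abs_nonneg _)
  -- Potentials are fixed only up to constants. Normalising the means to zero lets Poincaré's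
  -- inequality control `u k - u l` by the difference of the gradients, so `u` is Cauchy in `L¹`.
  set m : ℕ → ℝ := fun n => ⨍ x in B, h n x
  set u : ℕ → Space N → ℝ := fun n x => h n x - m n
  have hBf : volume B ≠ ⊤ := measure_ball_lt_top.ne
  have : IsFiniteMeasure (volume.restrict B) := ⟨by simpa using hBf.lt_top⟩
  have hui : ∀ n, IntegrableOn (u n) B := fun n =>
    (hhi n).sub (integrableOn_const hBf)
  have hu0 : ∀ n, ∫ x in B, u n x = 0 := fun n => integral_sub_average _ _
  have hud : ∀ n, ∀ y ∈ B, HasFDerivAt (u n)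
      (∑ i, a n i y • (EuclideanSpace.proj i : Space N →L[ℝ] ℝ)) y := fun n y hy =>
    (hh n y (hsub' hy)).sub_const _
  obtain ⟨C, hC0, hC⟩ := exists_poincare_ball x₀ hr
  have hest : ∀ k l, ∫ x in B, |u k x - u l x| ≤
      C * ∑ i, ((∫ x in B, |a k i x - w x i|) + ∫ x in B, |a l i x - w x i|) := by
    intro k l
    refine (hC (fun x => u k x - u l x) (fun i x => a k i x - a l i x)
      (fun i => (hac k i).continuous.sub (hac l i).continuous) (fun y hy => ?_)
      ((hui k).sub (hui l)) ?_).trans ?_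
    · exact ((hud k y hy).sub (hud l y hy)).congr_fderiv
        (by simp only [sub_smul, Finset.sum_sub_distrib])
    · rw [integral_sub (hui k) (hui l), hu0, hu0, sub_zero]
    · gcongr with i
      have hk := ((hai k i).sub (hw i).integrableOn).abs
      have hl := ((hai l i).sub (hw i).integrableOn).abs
      refine le_trans (integral_mono ((hai k i).sub (hai l i)).abs (hk.add hl) fun x => ?_)
        (integral_add hk hl).le
      have := abs_sub_le (a k i x) (w x i) (a l i x)
      rw [abs_sub_comm (w x i)] at this
      exact this
  have hsum : Tendsto (fun k => C * ∑ i, ∫ x in B, |a k i x - w x i|) atTop (𝓝 0) := by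
    have := (tendsto_finsetSum Finset.univ fun i _ => halim i).const_mul C
    simpa using this
  obtain ⟨U, hU, hUl⟩ := exists_tendsto_integral_abs_of_cauchy (μ := volume.restrict B) hui (by
    intro ε hε
    obtain ⟨n, hn⟩ := (hsum.eventually (gt_mem_nhds (half_pos hε))).exists_forall_of_atTop
    refine ⟨n, fun k hk l hl => (hest k l).trans_lt ?_⟩
    rw [Finset.sum_add_distrib, mul_add]
    linarith [hn k hk, hn l hl])
  refine ⟨U, hU, fun i => ?_⟩
  suffices hs : HasWeakPartial B i U fun x => w x i from hs.congr_ae (ae_eq_refl _)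
    (indicator_ae_eq_restrict (Metric.ball_subset_closedBall.trans
      (Metric.closedBall_subset_closedBall (by linarith))) measurableSet_ball _).symm
  intro φ hφ
  have h1 := tendsto_integral_mul_of_integral_abs hui hU hUl (continuous_partialD hφ.1 i)
    (hasCompactSupport_partialD hφ.2.1 i)
  have h2 := tendsto_integral_mul_of_integral_abs (fun n => hai n i) (hw i).integrableOn
    (halim i) hφ.1.continuous hφ.2.1
  refine tendsto_nhds_unique h1 (h2.neg.congr fun n => ?_)
  exact (hasWeakPartial_of_hasFDerivAt (fun i => (hac n i).continuous) (hud n)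
    Metric.isOpen_ball i φ hφ).symm

/-! ### Gluing local potentials -/

/-- A locally constant `1`-cocycle on a cover of a simply connected space by connected open sets is
a coboundary. -/
theorem exists_primitive_of_cocycle {X : Type*} [TopologicalSpace X] [SimplyConnectedSpace X]
    [LocallyPathConnectedSpace X] {ι A : Type*} [AddCommGroup A] (B : ι → Set X)
    (hB : ∀ i, IsOpen (B i)) (hconn : ∀ i, IsPreconnected (B i)) (hcov : ∀ x, ∃ i, x ∈ B i)
    (c : ι → ι → A)
    (hc : ∀ i j k x, x ∈ B i → x ∈ B j → x ∈ B k → c i j + c j k = c i k) :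
    ∃ a : ι → A, ∀ i j, (B i ∩ B j).Nonempty → a j = a i + c i j := by
  -- With the discrete topology on the fibre, the bundle with transition maps `v ↦ v + c i j` is a
  -- covering of `X`.
  let _ : TopologicalSpace A := ⊥
  have : DiscreteTopology A := ⟨rfl⟩
  choose ind hind using hcov
  let Z : FiberBundleCore ι X A :=
    { baseSet := B
      isOpen_baseSet := hB
      indexAt := ind
      mem_baseSet_at := hind
      coordChange := fun i j _ v => v + c i j
      coordChange_self := fun i x hx v => by
        have := hc i i i x hx hx hx
        rw [add_eq_left.1 this, add_zero]
      continuousOn_coordChange := fun i j =>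
        (Continuous.comp (g := fun v : A => v + c i j) continuous_of_discreteTopology
          continuous_snd).continuousOn
      coordChange_comp := fun i j k x hx v => by
        rw [add_assoc, hc i j k x hx.1.1 hx.1.2 hx.2] }
  have hcovering : IsCoveringMap Z.proj :=
    IsFiberBundle.isCoveringMap fun x => ⟨Z.localTriv (ind x), hind x⟩
  have x₀ : X := Classical.arbitrary X
  -- Simple connectivity enters here: the identity of `X` lifts to a global section.
  obtain ⟨s, ⟨-, hs⟩, -⟩ := hcovering.existsUnique_continuousMap_lifts (ContinuousMap.id X) x₀
    (⟨x₀, (0 : A)⟩ : Z.TotalSpace) rfl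
  have hsx : ∀ x, Z.proj (s x) = x := fun x => congrFun hs x
  have hcont : ∀ i, ContinuousOn (fun x => (Z.localTriv i (s x)).2) (B i) := fun i =>
    continuous_snd.comp_continuousOn ((Z.localTriv i).continuousOn.comp s.continuous.continuousOn
      fun x hx => by
        rw [FiberBundleCore.mem_localTriv_source]
        change Z.proj (s x) ∈ B i
        rwa [hsx])
  -- A continuous map from a preconnected set to a discrete fibre is constant. The section read in
  -- chart `i` is the sought `a i`, and the change of charts is the coboundary relation.
  have hconst : ∀ i, ∃ a : A, ∀ x ∈ B i, (Z.localTriv i (s x)).2 = a := by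
    intro i
    rcases (B i).eq_empty_or_nonempty with h | ⟨x, hx⟩
    · exact ⟨0, by simp [h]⟩
    · exact ⟨_, fun y hy => (hconn i).constant (hcont i) hy hx⟩
  choose a ha using hconst
  refine ⟨a, fun i j ⟨x, hxi, hxj⟩ => ?_⟩
  rw [← ha i x hxi, ← ha j x hxj, FiberBundleCore.localTriv_apply, FiberBundleCore.localTriv_apply]
  have key : ∀ w : A, w + c (ind (Z.proj (s x))) j = w + c (ind (Z.proj (s x))) i + c i j := by
    intro w
    rw [hsx, add_assoc, hc (ind x) i j x (hind x) hxi hxj]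
  exact key (s x).2

theorem partialD_sum {ι : Type*} (s : Finset ι) {φ : ι → Space N → ℝ}
    (hφ : ∀ k, ContDiff ℝ ∞ (φ k)) (i : Fin N) (x : Space N) :
    partialD i (fun x => ∑ k ∈ s, φ k x) x = ∑ k ∈ s, partialD i (φ k) x := by
  have := (HasFDerivAt.fun_sum (u := s) fun k _ =>
    ((hφ k).differentiable (by simp) x).hasFDerivAt).fderiv
  rw [partialD, this, _root_.sum_apply]
  rfl

theorem tsupport_partialD_subset (φ : Space N → ℝ) (i : Fin N) :
    tsupport (partialD i φ) ⊆ tsupport φ :=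
  closure_minimal (fun x hx => by
    by_contra h
    exact hx (partialD_eq_zero_of_notMem i h)) (isClosed_tsupport φ)

/-- Being a weak derivative is a local property. -/
theorem hasWeakPartial_of_locally {D : Set (Space N)} {u g : Space N → ℝ} {i : Fin N}
    (hu : LocallyIntegrableOn u D) (hg : LocallyIntegrableOn g D)
    (h : ∀ x ∈ D, ∃ V, IsOpen V ∧ x ∈ V ∧ HasWeakPartial V i u g) :
    HasWeakPartial D i u g := by
  classical
  intro φ hφ
  choose! V hVo hxV hV using h
  obtain ⟨t, htK, ht⟩ := hφ.2.1.isCompact.elim_nhds_subcover V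
    fun x hx => (hVo x (hφ.2.2 hx)).mem_nhds (hxV x (hφ.2.2 hx))
  -- The partition of unity splits `φ` into finitely many test functions, each supported in one `V
  -- k`.
  obtain ⟨ρ, hρ⟩ := SmoothPartitionOfUnity.exists_isSubordinate
    (modelWithCornersSelf ℝ (Space N)) (isClosed_tsupport φ) (fun k : t => V k)
    (fun k => hVo k (hφ.2.2 (htK k k.2))) (fun x hx => by
      obtain ⟨y, hy, hxy⟩ := Set.mem_iUnion₂.1 (ht hx)
      exact Set.mem_iUnion.2 ⟨⟨y, hy⟩, hxy⟩)
  have hρs : ∀ k, ContDiff ℝ ∞ (ρ k) := fun k => (ρ k).contMDiff.contDiff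
  have hsum : φ = fun x => ∑ k, ρ k x * φ x := by
    funext x
    by_cases hx : x ∈ tsupport φ
    · rw [← Finset.sum_mul, ← finsum_eq_sum_of_fintype, ρ.sum_eq_one hx, one_mul]
    · simp [image_eq_zero_of_notMem_tsupport hx]
  have htest : ∀ k : t, IsTest (V k) fun x => ρ k x * φ x := fun k =>
    ⟨(hρs k).mul hφ.1, hφ.2.1.mul_left, (tsupport_mul_subset_left).trans (hρ k)⟩
  have htestD : ∀ k, IsTest D fun x => ρ k x * φ x := fun k =>
    ⟨(hρs k).mul hφ.1, hφ.2.1.mul_left, (tsupport_mul_subset_right).trans hφ.2.2⟩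
  have h1 : ∀ x, u x * partialD i φ x = ∑ k, u x * partialD i (fun x => ρ k x * φ x) x := by
    intro x
    rw [← Finset.mul_sum, ← partialD_sum _ (fun k => (htest k).1), ← hsum]
  have h2 : ∀ x, g x * φ x = ∑ k, g x * (ρ k x * φ x) := by
    intro x
    rw [← Finset.mul_sum, ← congrFun hsum x]
  simp_rw [h1, h2]
  rw [integral_finsetSum, integral_finsetSum, ← Finset.sum_neg_distrib]
  · refine Finset.sum_congr rfl fun k _ => ?_
    have := hV k (hφ.2.2 (htK k k.2)) _ (htest k)
    rwa [setIntegral_mul_test (htest k).2.2, setIntegral_mul_partialD (htest k).2.2,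
      ← setIntegral_mul_test (htestD k).2.2, ← setIntegral_mul_partialD (htestD k).2.2] at this
  · exact fun k _ => (integrable_mul_of_tsupport_subset hg (htestD k).1.continuous
      (htestD k).2.1 (htestD k).2.2).integrableOn
  · exact fun k _ => (integrable_mul_of_tsupport_subset hu (continuous_partialD (htestD k).1 i)
      (hasCompactSupport_partialD (htestD k).2.1 i)
      ((tsupport_partialD_subset _ i).trans (htestD k).2.2)).integrableOn

theorem HasWeakPartial.sub {D : Set (Space N)} {i : Fin N} {u g u' g' : Space N → ℝ}
    (h : HasWeakPartial D i u g) (h' : HasWeakPartial D i u' g')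
    (hu : LocallyIntegrableOn u D) (hu' : LocallyIntegrableOn u' D)
    (hg : LocallyIntegrableOn g D) (hg' : LocallyIntegrableOn g' D) :
    HasWeakPartial D i (fun x => u x - u' x) (fun x => g x - g' x) := by
  intro φ hφ
  have hp : ∀ w, LocallyIntegrableOn w D → IntegrableOn (fun x => w x * partialD i φ x) D :=
    fun w hw => (integrable_mul_of_tsupport_subset hw (continuous_partialD hφ.1 i)
      (hasCompactSupport_partialD hφ.2.1 i)
      ((tsupport_partialD_subset _ i).trans hφ.2.2)).integrableOn
  have ht : ∀ w, LocallyIntegrableOn w D → IntegrableOn (fun x => w x * φ x) D :=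
    fun w hw => (integrable_mul_of_tsupport_subset hw hφ.1.continuous hφ.2.1 hφ.2.2).integrableOn
  simp only [sub_mul]
  rw [integral_sub (hp u hu) (hp u' hu'), integral_sub (ht g hg) (ht g' hg'), h φ hφ, h' φ hφ]
  ring

theorem integral_partialD_eq_zero {φ : Space N → ℝ} (hφ : ContDiff ℝ ∞ φ)
    (hc : HasCompactSupport φ) (i : Fin N) : ∫ x, partialD i φ x = 0 := by
  have hp : Integrable (partialD i φ) := (continuous_partialD hφ i).integrable_of_hasCompactSupport
    (hasCompactSupport_partialD hc i)
  have ht : Integrable φ := hφ.continuous.integrable_of_hasCompactSupport hc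
  have := integral_mul_fderiv_eq_neg_fderiv_mul_of_integrable (μ := (volume : Measure (Space N)))
    (f := fun _ => (1 : ℝ)) (g := φ) (v := EuclideanSpace.single i (1 : ℝ)) (by simp)
    (by simp only [one_mul]; exact hp) (by simpa using ht)
    (fun x _ => differentiableAt_const _) (fun x _ => hφ.differentiable (by simp) x)
  simpa [partialD] using this

theorem HasWeakPartial.add_const {D : Set (Space N)} {i : Fin N} {u g : Space N → ℝ}
    (h : HasWeakPartial D i u g) (hu : LocallyIntegrableOn u D) (a : ℝ) :
    HasWeakPartial D i (fun x => u x + a) g := by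
  intro φ hφ
  have h0 := integral_partialD_eq_zero hφ.1 hφ.2.1 i
  have hpi : Integrable (fun x => u x * partialD i φ x) :=
    integrable_mul_of_tsupport_subset hu (continuous_partialD hφ.1 i)
      (hasCompactSupport_partialD hφ.2.1 i) ((tsupport_partialD_subset _ i).trans hφ.2.2)
  rw [← h φ hφ, setIntegral_mul_partialD hφ.2.2, setIntegral_mul_partialD hφ.2.2]
  simp only [add_mul]
  rw [integral_add hpi (((continuous_partialD hφ.1 i).integrable_of_hasCompactSupport
    (hasCompactSupport_partialD hφ.2.1 i)).const_mul a), integral_const_mul, h0, mul_zero, add_zero]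

/-- An irrotational field on a simply connected open set has a potential. -/
theorem exists_potential {D : Set (Space N)} (hD : IsOpen D) (hsc : IsSimplyConnected D)
    {v : Space N → Fin N → ℝ} (hv : ∀ i, LocallyIntegrableOn (fun x => v x i) D)
    (hcurl : HasWeakCurl D v 0) :
    ∃ u, LocallyIntegrableOn u D ∧ ∀ i, HasWeakPartial D i u (fun x => v x i) := by
  have hloc : ∀ x : D, ∃ r > 0, Metric.ball (x : Space N) r ⊆ D ∧
      ∃ u, IntegrableOn u (Metric.ball (x : Space N) r) ∧
        ∀ i, HasWeakPartial (Metric.ball (x : Space N) r) i u (fun x => v x i) := by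
    rintro ⟨x, hx⟩
    obtain ⟨ε, hε, hεD⟩ := Metric.nhds_basis_closedBall.mem_iff.1 (hD.mem_nhds hx)
    have hr : 0 < ε / 3 := by positivity
    refine ⟨ε / 3, hr, (Metric.ball_subset_closedBall.trans
      (Metric.closedBall_subset_closedBall (by linarith))).trans hεD, ?_⟩
    exact exists_potential_ball hv hcurl hr (by rwa [mul_div_cancel₀ _ three_ne_zero])
  choose r hr hrD u hui hu using hloc
  have hli : ∀ x : D, LocallyIntegrableOn (u x) (Metric.ball (x : Space N) (r x)) := fun x =>
    (hui x).locallyIntegrableOn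
  -- On an overlap, convex and hence connected, two local potentials have the same gradient and so
  -- differ by a constant. These constants form the cocycle.
  have hcex : ∀ x y : D, ∃ c, ∀ᵐ z, z ∈ Metric.ball (x : Space N) (r x) ∩
      Metric.ball (y : Space N) (r y) → u x z - u y z = c := by
    intro x y
    refine exists_ae_eq_const (Metric.isOpen_ball.inter Metric.isOpen_ball)
      ((convex_ball _ _).inter (convex_ball _ _)).isPreconnected
      (((hli x).mono_set Set.inter_subset_left).sub ((hli y).mono_set Set.inter_subset_right))
      fun i => ?_
    have hvi := (hv i).mono_set (Set.inter_subset_left.trans (hrD x) :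
      Metric.ball (x : Space N) (r x) ∩ Metric.ball (y : Space N) (r y) ⊆ D)
    have := ((hu x i).mono Set.inter_subset_left).sub
      ((hu y i).mono Set.inter_subset_right) ((hli x).mono_set Set.inter_subset_left)
      ((hli y).mono_set Set.inter_subset_right) hvi hvi
    exact this.congr_ae (ae_eq_refl _) (ae_of_all _ fun z => by simp)
  choose c hc using hcex
  have := hsc.simplyConnectedSpace
  have := hD.locallyPathConnectedSpace
  obtain ⟨a, ha⟩ := exists_primitive_of_cocycle
    (fun x : D => ((↑) : D → Space N) ⁻¹' Metric.ball (x : Space N) (r x))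
    (fun x => Metric.isOpen_ball.preimage continuous_subtype_val)
    (fun x => (convex_ball (x : Space N) (r x)).isPreconnected.preimage_of_isOpenMap
      Subtype.val_injective hD.isOpenMap_subtype_val (by simpa using hrD x))
    (fun x => ⟨x, Metric.mem_ball_self (hr x)⟩) c (fun x y z p hx hy hz => by
      refine eq_of_ae_eq_const (u := fun q => u x q - u z q)
        (V := Metric.ball (x : Space N) (r x) ∩ Metric.ball (y : Space N) (r y) ∩
          Metric.ball (z : Space N) (r z))
        ((Metric.isOpen_ball.inter Metric.isOpen_ball).inter Metric.isOpen_ball)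
        ⟨(p : Space N), ⟨hx, hy⟩, hz⟩ ?_ ?_
      · filter_upwards [hc x y, hc y z] with q h1 h2 hq
        rw [← h1 hq.1, ← h2 ⟨hq.1.2, hq.2⟩]
        ring
      · filter_upwards [hc x z] with q h1 hq
        exact h1 ⟨hq.1.1, hq.2⟩)
  -- A countable subcover keeps the union of the exceptional null sets null.
  obtain ⟨S, hS, hScov⟩ := TopologicalSpace.isOpen_iUnion_countable
    (fun x : D => Metric.ball (x : Space N) (r x)) fun x => Metric.isOpen_ball
  have hsel : ∀ z : Space N, z ∈ D → ∃ x ∈ S, z ∈ Metric.ball (x : Space N) (r x) := by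
    intro z hz
    have : z ∈ ⋃ x : D, Metric.ball (x : Space N) (r x) :=
      Set.mem_iUnion.2 ⟨⟨z, hz⟩, Metric.mem_ball_self (hr _)⟩
    rw [← hScov] at this
    obtain ⟨x, hx, hzx⟩ := Set.mem_iUnion₂.1 this
    exact ⟨x, hx, hzx⟩
  obtain ⟨x₀⟩ : Nonempty D := hsc.nonempty.to_subtype
  have : Nonempty D := ⟨x₀⟩
  -- The selection of a ball need not be measurable: the glued function agrees almost everywhere on
  -- each ball with the corrected potential `u y + a y`, from which it inherits integrability.
  choose! sel hselS hselB using hsel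
  have hU : ∀ y : D, ∀ᵐ z, z ∈ Metric.ball (y : Space N) (r y) →
      u (sel z) z + a (sel z) = u y z + a y := by
    intro y
    have : ∀ᵐ z, ∀ x ∈ S, z ∈ Metric.ball (x : Space N) (r x) ∩ Metric.ball (y : Space N) (r y) →
        u x z - u y z = c x y := (ae_ball_iff hS).2 fun x _ => hc x y
    filter_upwards [this] with z hz hzy
    have hzD := hrD y hzy
    have h1 := hz _ (hselS z hzD) ⟨hselB z hzD, hzy⟩
    have h2 := ha (sel z) y ⟨⟨z, hzD⟩, hselB z hzD, hzy⟩
    linarith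
  have hUr : ∀ y : D, (fun z => u y z + a y) =ᵐ[volume.restrict (Metric.ball (y : Space N) (r y))]
      fun z => u (sel z) z + a (sel z) := fun y => by
    filter_upwards [ae_restrict_of_ae (hU y), ae_restrict_mem measurableSet_ball] with z hz hzy
    exact (hz hzy).symm
  have hUl : LocallyIntegrableOn (fun z => u (sel z) z + a (sel z)) D := by
    intro y hy
    refine ⟨_, mem_nhdsWithin_of_mem_nhds (Metric.ball_mem_nhds y (hr ⟨y, hy⟩)), ?_⟩
    exact Integrable.congr ((hui ⟨y, hy⟩).add (integrableOn_const measure_ball_lt_top.ne))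
      (hUr ⟨y, hy⟩)
  refine ⟨_, hUl, fun i => hasWeakPartial_of_locally hUl (hv i) fun y hy =>
    ⟨_, Metric.isOpen_ball, Metric.mem_ball_self (hr ⟨y, hy⟩), ?_⟩⟩
  exact ((hu ⟨y, hy⟩ i).add_const (hli _) (a ⟨y, hy⟩)).congr_ae (hUr ⟨y, hy⟩) (ae_eq_refl _)

/-! ### The chain rule for weak derivatives -/

/-- Chain rule for a function with bounded continuous derivative. -/
theorem HasWeakPartial.comp {D : Set (Space N)} (hD : IsOpen D) {u g : Space N → ℝ} {i : Fin N}
    (hu : LocallyIntegrableOn u D) (hg : LocallyIntegrableOn g D) (h : HasWeakPartial D i u g)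
    {F F' : ℝ → ℝ} (hF : ∀ s, HasDerivAt F (F' s) s) (hF' : Continuous F')
    (hb : ∀ s, |F' s| ≤ 1) (hF0 : F 0 = 0) :
    HasWeakPartial D i (fun x => F (u x)) (fun x => F' (u x) * g x) := by
  intro φ hφ
  have hFc : Continuous F := continuous_iff_continuousAt.2 fun s => (hF s).continuousAt
  have hlip : ∀ a b, |F a - F b| ≤ |a - b| := by
    intro a b
    have := Convex.norm_image_sub_le_of_norm_hasDerivWithin_le (s := Set.univ) (C := 1)
      (fun s _ => (hF s).hasDerivWithinAt) (fun s _ => hb s) convex_univ (Set.mem_univ b)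
      (Set.mem_univ a)
    simpa using this
  obtain ⟨δ, hδ, hδD⟩ := hφ.2.1.isCompact.exists_cthickening_subset_open hD hφ.2.2
  set K := Metric.cthickening δ (tsupport φ)
  have hK : IsCompact K := hφ.2.1.isCompact.cthickening
  have hφK : tsupport φ ⊆ K := Metric.self_subset_cthickening _
  set w := K.indicator u
  set q := K.indicator g
  have hw : Integrable w := integrable_indicator_of_locallyIntegrableOn hu hK hδD
  have hq : Integrable q := integrable_indicator_of_locallyIntegrableOn hg hK hδD
  have hTK : Metric.thickening δ (tsupport φ) ⊆ K := Metric.thickening_subset_cthickening _ _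
  have hwq : HasWeakPartial (Metric.thickening δ (tsupport φ)) i w q :=
    (h.mono (hTK.trans hδD)).congr_ae
      (indicator_ae_eq_restrict hTK Metric.isOpen_thickening.measurableSet u)
      (indicator_ae_eq_restrict hTK Metric.isOpen_thickening.measurableSet g)
  obtain ⟨n₀, hn₀⟩ := exists_nat_one_div_lt hδ
  set a : ℕ → Space N → ℝ := fun n => moll (n + n₀) w
  set b : ℕ → Space N → ℝ := fun n => moll (n + n₀) q
  have ha : ∀ n, ContDiff ℝ ∞ (a n) := fun n => contDiff_moll _ hw.locallyIntegrable
  have hbc : ∀ n, Continuous (b n) := fun n => (contDiff_moll _ hq.locallyIntegrable).continuous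
  have hai : ∀ n, Integrable (a n) := fun n => integrable_moll _ hw
  have hbi : ∀ n, Integrable (b n) := fun n => integrable_moll _ hq
  have hal : Tendsto (fun n => ∫ x, |a n x - w x|) atTop (𝓝 0) :=
    (tendsto_add_atTop_iff_nat n₀).2 (tendsto_integral_abs_moll_sub hw)
  have hbl : Tendsto (fun n => ∫ x, |b n x - q x|) atTop (𝓝 0) :=
    (tendsto_add_atTop_iff_nat n₀).2 (tendsto_integral_abs_moll_sub hq)
  have hab : ∀ n, ∀ x ∈ tsupport φ, partialD i (a n) x = b n x := by
    intro n x hx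
    refine partialD_moll_eq hw.locallyIntegrable hwq fun t ht => ?_
    rw [Metric.mem_closedBall] at ht
    have h1 : (1 : ℝ) / ((n + n₀ : ℕ) + 1) ≤ 1 / (n₀ + 1) :=
      one_div_le_one_div_of_le (by positivity) (by push_cast; linarith [n.cast_nonneg (α := ℝ)])
    exact Metric.mem_thickening_iff.2 ⟨x, hx, by linarith⟩
  have hIBP : ∀ n, ∫ x, F (a n x) * partialD i φ x = -∫ x, F' (a n x) * b n x * φ x := by
    intro n
    have hd : ∀ x, HasFDerivAt (fun x => F (a n x)) (F' (a n x) • fderiv ℝ (a n) x) x := fun x =>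
      (hF (a n x)).comp_hasFDerivAt x (((ha n).differentiable (by simp)) x).hasFDerivAt
    have heq : ∀ x, fderiv ℝ (fun x => F (a n x)) x (EuclideanSpace.single i 1) * φ x =
        F' (a n x) * b n x * φ x := by
      intro x
      by_cases hx : x ∈ tsupport φ
      · rw [(hd x).fderiv, ← hab n x hx]
        rfl
      · rw [image_eq_zero_of_notMem_tsupport hx, mul_zero, mul_zero]
    have hloc : ∀ f : Space N → ℝ, Continuous f → LocallyIntegrableOn f Set.univ :=
      fun f hf => hf.locallyIntegrable.locallyIntegrableOn _
    have := integral_mul_fderiv_eq_neg_fderiv_mul_of_integrable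
      (μ := (volume : Measure (Space N))) (f := fun x => F (a n x)) (g := φ)
      (v := EuclideanSpace.single i (1 : ℝ)) ?_ ?_ ?_
      (fun x _ => (hd x).differentiableAt) (fun x _ => hφ.1.differentiable (by simp) x)
    · simp only [heq] at this
      exact this
    · simp only [heq]
      exact integrable_mul_of_tsupport_subset
        (hloc _ ((hF'.comp (ha n).continuous).mul (hbc n))) hφ.1.continuous hφ.2.1
        (Set.subset_univ _)
    · exact integrable_mul_of_tsupport_subset (hloc _ (hFc.comp (ha n).continuous))
        (continuous_partialD hφ.1 i) (hasCompactSupport_partialD hφ.2.1 i) (Set.subset_univ _)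
    · exact integrable_mul_of_tsupport_subset (hloc _ (hFc.comp (ha n).continuous))
        hφ.1.continuous hφ.2.1 (Set.subset_univ _)
  -- With `F 0 = 0` and Lipschitz constant one, `|F (f x)| ≤ |f x|`.
  have hFi : ∀ f : Space N → ℝ, Integrable f → Integrable fun x => F (f x) := fun f hf =>
    hf.mono (hFc.comp_aestronglyMeasurable hf.aestronglyMeasurable)
      (ae_of_all _ fun x => by simpa [hF0] using hlip (f x) 0)
  have hA : Tendsto (fun n => ∫ x, F (a n x) * partialD i φ x) atTop
      (𝓝 (∫ x, F (w x) * partialD i φ x)) := by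
    refine tendsto_integral_mul_of_integral_abs (fun n => hFi _ (hai n)) (hFi _ hw) ?_
      (continuous_partialD hφ.1 i) (hasCompactSupport_partialD hφ.2.1 i)
    refine squeeze_zero (fun n => integral_nonneg fun _ => abs_nonneg _) (fun n => ?_) hal
    exact integral_mono ((hFi _ (hai n)).sub (hFi _ hw)).abs ((hai n).sub hw).abs
      fun x => hlip _ _
  obtain ⟨C, hC⟩ := hφ.2.1.exists_bound_of_continuous hφ.1.continuous
  have hprod : ∀ f p : Space N → ℝ, AEStronglyMeasurable f volume → Integrable p →
      Integrable fun x => F' (f x) * p x * φ x := fun f p hf hp =>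
    (hp.bdd_mul (c := 1) (hF'.comp_aestronglyMeasurable hf) (ae_of_all _ fun x => hb _)).mul_bdd
      (c := C) hφ.1.continuous.aestronglyMeasurable (ae_of_all _ hC)
  -- `F' (a n x)` converges only almost everywhere, so the limit is taken in two stages: `b n` is
  -- replaced by `q` using `|F'| ≤ 1` and `L¹` convergence, then dominated convergence handles `F'
  -- (a n x)` against the fixed `q`.
  have hB1 : Tendsto (fun n => (∫ x, F' (a n x) * b n x * φ x) - ∫ x, F' (a n x) * q x * φ x)
      atTop (𝓝 0) := by
    refine squeeze_zero_norm (fun n => ?_) (by simpa using hbl.mul_const C)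
    rw [← integral_sub (hprod _ _ (hai n).1 (hbi n)) (hprod _ _ (hai n).1 hq),
      ← integral_mul_const]
    refine abs_integral_le_integral_abs.trans (integral_mono
      ((hprod _ _ (hai n).1 (hbi n)).sub (hprod _ _ (hai n).1 hq)).abs
      (((hbi n).sub hq).abs.mul_const C) fun x => ?_)
    simp only [← sub_mul, ← mul_sub, abs_mul]
    calc |F' (a n x)| * |b n x - q x| * |φ x| ≤ 1 * |b n x - q x| * C := by
          gcongr
          · exact hb _
          · exact hC x
      _ = _ := by rw [one_mul]
  have hB2 : Tendsto (fun n => ∫ x, F' (a n x) * q x * φ x) atTop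
      (𝓝 (∫ x, F' (w x) * q x * φ x)) := by
    refine tendsto_integral_of_dominated_convergence (fun x => |q x| * C)
      (fun n => (hprod _ _ (hai n).1 hq).1) (hq.abs.mul_const C) (fun n => ae_of_all _ fun x => ?_)
      ?_
    · rw [Real.norm_eq_abs, abs_mul, abs_mul]
      calc |F' (a n x)| * |q x| * |φ x| ≤ 1 * |q x| * C := by
            gcongr
            · exact hb _
            · exact hC x
        _ = _ := by rw [one_mul]
    · filter_upwards [ae_tendsto_moll hw.locallyIntegrable] with x hx
      exact (((hF'.tendsto _).comp ((tendsto_add_atTop_iff_nat n₀).2 hx)).mul_const _).mul_const _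
  have hB : Tendsto (fun n => ∫ x, F' (a n x) * b n x * φ x) atTop
      (𝓝 (∫ x, F' (w x) * q x * φ x)) := by
    simpa using hB1.add hB2
  have hfin := tendsto_nhds_unique hA (hB.neg.congr fun n => (hIBP n).symm)
  rw [setIntegral_mul_partialD hφ.2.2, setIntegral_mul_test hφ.2.2]
  have h1 : ∫ x, F (u x) * partialD i φ x = ∫ x, F (w x) * partialD i φ x := by
    refine integral_congr_ae (ae_of_all _ fun x => ?_)
    by_cases hx : x ∈ tsupport φ
    · simp only [w, Set.indicator_of_mem (hφK hx)]
    · simp only [partialD_eq_zero_of_notMem i hx, mul_zero]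
  have h2 : ∫ x, F' (u x) * g x * φ x = ∫ x, F' (w x) * q x * φ x := by
    refine integral_congr_ae (ae_of_all _ fun x => ?_)
    by_cases hx : x ∈ tsupport φ
    · simp only [w, q, Set.indicator_of_mem (hφK hx)]
    · simp only [image_eq_zero_of_notMem_tsupport hx, mul_zero]
  rw [h1, h2]
  exact hfin

/-! ### Poincaré's inequality from Rellich's selection theorem -/

theorem HasWeakPartial.const_mul {D : Set (Space N)} {i : Fin N} {u g : Space N → ℝ}
    (h : HasWeakPartial D i u g) (a : ℝ) :
    HasWeakPartial D i (fun x => a * u x) (fun x => a * g x) := by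
  intro φ hφ
  simp only [mul_assoc]
  rw [integral_const_mul, integral_const_mul, h φ hφ, mul_neg]

theorem vecNorm_smul (Ω : Set (Space N)) (a : ℝ) (v : Space N → Fin N → ℝ) :
    vecNorm Ω (fun x i => a * v x i) = |a| * vecNorm Ω v := by
  unfold vecNorm
  simp_rw [mul_pow, ← Finset.mul_sum]
  rw [integral_const_mul, Real.sqrt_mul (sq_nonneg a), Real.sqrt_sq_eq_abs]

theorem MemH1.const_mul {D : Set (Space N)} {u : Space N → ℝ} {g : Space N → Fin N → ℝ}
    (h : MemH1 D u g) (a : ℝ) : MemH1 D (fun x => a * u x) (fun x i => a * g x i) :=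
  ⟨h.1.const_mul a, fun i => (h.2.1 i).const_mul a, fun i => (h.2.2 i).const_mul a⟩

theorem MemH1.sub_const {D : Set (Space N)} (hb : Bornology.IsBounded D) {u : Space N → ℝ}
    {g : Space N → Fin N → ℝ} (h : MemH1 D u g) (a : ℝ) : MemH1 D (fun x => u x - a) g :=
  ⟨h.1.sub (scalarL2_const hb a), h.2.1, fun i => by
    simpa [sub_eq_add_neg] using
      (h.2.2 i).add_const (h.1.integrableOn hb).locallyIntegrableOn (-a)⟩

/-- Counterexamples normalised to mean zero and norm one have gradients tending to zero. A Rellich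
limit has vanishing weak gradient, so it is constant, and mean zero makes it zero, against norm one.
-/
theorem exists_poincare_const {D : Set (Space N)} (hD : IsOpen D) (hc : IsConnected D)
    (hb : Bornology.IsBounded D) (hR : Rellich D) :
    ∃ C : ℝ, 0 ≤ C ∧ ∀ u g, MemH1 D u g →
      scalarNorm D (fun x => u x - ⨍ y in D, u y) ≤ C * vecNorm D g := by
  by_contra! hcon
  choose u g hu hlt using fun k : ℕ => hcon (k + 1) (by positivity)
  set m : ℕ → ℝ := fun k => scalarNorm D (fun x => u k x - ⨍ y in D, u k y)
  have hm : ∀ k, 0 < m k := fun k =>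
    (mul_nonneg (by positivity) (vecNorm_nonneg D (g k))).trans_lt (hlt k)
  set w : ℕ → Space N → ℝ := fun k x => (m k)⁻¹ * (u k x - ⨍ y in D, u k y)
  set q : ℕ → Space N → Fin N → ℝ := fun k x i => (m k)⁻¹ * g k x i
  have hwq : ∀ k, MemH1 D (w k) (q k) := fun k => ((hu k).sub_const hb _).const_mul _
  have hw1 : ∀ k, scalarNorm D (w k) = 1 := by
    intro k
    rw [scalarNorm_smul, abs_of_pos (inv_pos.2 (hm k)), inv_mul_cancel₀ (hm k).ne']
  have hq1 : ∀ k, vecNorm D (q k) ≤ 1 / (k + 1) := by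
    intro k
    rw [vecNorm_smul, abs_of_pos (inv_pos.2 (hm k)), inv_mul_le_iff₀ (hm k), mul_one_div,
      le_div_iff₀ (by positivity), mul_comm]
    exact (hlt k).le
  have hw0 : ∀ k, ∫ x in D, w k x = 0 := by
    intro k
    have : IsFiniteMeasure (volume.restrict D) := ⟨by simpa using hb.measure_lt_top⟩
    rw [integral_const_mul, integral_sub_average, mul_zero]
  obtain ⟨s, u₀, hs, hu₀, hlim⟩ := hR w q 1 fun k => ⟨hwq k, (hw1 k).le, (hq1 k).trans
    (by rw [div_le_one (by positivity)]; linarith [k.cast_nonneg (α := ℝ)])⟩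
  have hgrad : ∀ i, HasWeakPartial D i u₀ 0 := by
    intro i φ hφ
    have h1 := tendsto_integral_mul_of_scalarNorm (fun k => (hwq (s k)).1) hu₀
      (scalarL2_of_continuous (continuous_partialD hφ.1 i)
        (hasCompactSupport_partialD hφ.2.1 i)) hlim
    have hφ2 : ScalarL2 D φ := scalarL2_of_continuous hφ.1.continuous hφ.2.1
    have h2 : Tendsto (fun k => ∫ x in D, w (s k) x * partialD i φ x) atTop (𝓝 0) := by
      refine squeeze_zero_norm (a := fun k => 1 / ((s k : ℝ) + 1) * scalarNorm D φ) (fun k => ?_) ?_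
      · rw [(hwq (s k)).2.2 i φ hφ, norm_neg]
        refine (abs_integral_mul_le ((hwq (s k)).2.1 i) hφ2).trans ?_
        gcongr
        · exact scalarNorm_nonneg _ _
        · exact (scalarNorm_le_vecNorm (hwq (s k)).2.1 i).trans (hq1 _)
      · simpa using ((tendsto_one_div_add_atTop_nhds_zero_nat (𝕜 := ℝ)).comp
          hs.tendsto_atTop).mul_const (scalarNorm D φ)
    simp [tendsto_nhds_unique h1 h2]
  obtain ⟨c, hcc⟩ := exists_ae_eq_const hD hc.isPreconnected
    (hu₀.integrableOn hb).locallyIntegrableOn hgrad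
  have hcr : u₀ =ᵐ[volume.restrict D] fun _ => c := by
    filter_upwards [ae_restrict_of_ae hcc, ae_restrict_mem hD.measurableSet] with x hx hxD
    exact hx hxD
  have h0 : ∫ x in D, u₀ x = 0 := by
    have h1 := tendsto_integral_mul_of_scalarNorm (fun k => (hwq (s k)).1) hu₀
      (scalarL2_const hb 1) hlim
    simp only [mul_one, hw0] at h1
    exact tendsto_nhds_unique h1 tendsto_const_nhds
  have hV : volume.real D ≠ 0 := by
    rw [measureReal_def, ENNReal.toReal_ne_zero]
    exact ⟨(hD.measure_pos volume hc.nonempty).ne', hb.measure_lt_top.ne⟩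
  have hc0 : c = 0 := by
    rw [integral_congr_ae hcr, setIntegral_const, smul_eq_mul] at h0
    exact (mul_eq_zero.1 h0).resolve_left hV
  have hfin : ∀ k, scalarNorm D (fun x => w (s k) x - u₀ x) = 1 := by
    intro k
    rw [← hw1 (s k)]
    refine scalarNorm_congr_ae (hcr.mono fun x hx => ?_)
    simp [hx, hc0]
  simp only [hfin] at hlim
  exact one_ne_zero (tendsto_nhds_unique tendsto_const_nhds hlim)

/-! ### Square integrability of potentials -/

/-- This is the difference quotient at zero of `y ↦ arctan (s * y)`, taken along `y = 1 / (k + 1)`.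
-/
theorem tendsto_mul_arctan_div (s : ℝ) :
    Tendsto (fun k : ℕ => ((k : ℝ) + 1) * Real.arctan (s / (k + 1))) atTop (𝓝 s) := by
  have h0 : Tendsto (fun k : ℕ => ((k : ℝ) + 1)⁻¹) atTop (𝓝[≠] 0) :=
    tendsto_nhdsWithin_iff.2 ⟨by
      simpa using tendsto_one_div_add_atTop_nhds_zero_nat (𝕜 := ℝ),
      Eventually.of_forall fun k => by
        have : (k : ℝ) + 1 ≠ 0 := by positivity
        simpa using this⟩
  have hd : HasDerivAt (fun y => Real.arctan (s * y)) s 0 := by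
    have h1 : HasDerivAt (fun y : ℝ => s * y) s 0 := by
      simpa using (hasDerivAt_id (0 : ℝ)).const_mul s
    have h2 := (Real.hasDerivAt_arctan (s * 0)).comp 0 h1
    simpa [Function.comp_def] using h2
  have := (hasDerivAt_iff_tendsto_slope.1 hd).comp h0
  refine this.congr fun k => ?_
  simp [slope, div_eq_mul_inv]

theorem exists_ae_tendsto_of_scalarNorm {D : Set (Space N)} {u : ℕ → Space N → ℝ}
    {w : Space N → ℝ} (hu : ∀ k, ScalarL2 D (u k)) (hw : ScalarL2 D w)
    (h : Tendsto (fun k => scalarNorm D (fun x => u k x - w x)) atTop (𝓝 0)) :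
    ∃ s : ℕ → ℕ, StrictMono s ∧
      ∀ᵐ x ∂volume.restrict D, Tendsto (fun k => u (s k) x) atTop (𝓝 (w x)) := by
  refine (tendstoInMeasure_of_tendsto_eLpNorm (p := 2) two_ne_zero (fun k => (hu k).memLp.1)
    hw.memLp.1 ?_).exists_seq_tendsto_ae
  rw [← ENNReal.tendsto_toReal_iff (fun k => ((hu k).memLp.sub hw.memLp).2.ne) ENNReal.zero_ne_top]
  refine h.congr fun k => ?_
  rw [scalarNorm_eq_toReal ((hu k).sub hw)]
  rfl

/-- If Rellich's selection theorem holds in a bounded domain, then functions with square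
integrable weak gradient are square integrable. -/
theorem scalarL2_of_weakGradient {D : Set (Space N)} (hD : IsOpen D) (hc : IsConnected D)
    (hb : Bornology.IsBounded D) (hR : Rellich D) {u : Space N → ℝ} {g : Space N → Fin N → ℝ}
    (hu : LocallyIntegrableOn u D) (hg : VecL2 D g)
    (h : ∀ i, HasWeakPartial D i u fun x => g x i) : ScalarL2 D u := by
  have hfin : IsFiniteMeasure (volume.restrict D) := ⟨by simpa using hb.measure_lt_top⟩
  obtain ⟨C, hC0, hC⟩ := exists_poincare_const hD hc hb hR
  have hum : AEStronglyMeasurable u (volume.restrict D) := hu.aestronglyMeasurable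
  -- Smooth bounded truncations tending pointwise to the identity, with derivatives in `(0, 1]`:
  -- each `F k ∘ u` is in `H¹`, and its gradient is dominated by `g` uniformly in `k`.
  set F : ℕ → ℝ → ℝ := fun k s => ((k : ℝ) + 1) * Real.arctan (s / (k + 1))
  set F' : ℕ → ℝ → ℝ := fun k s => 1 / (1 + (s / (k + 1)) ^ 2)
  have hF : ∀ k s, HasDerivAt (F k) (F' k s) s := by
    intro k s
    have hk : (k : ℝ) + 1 ≠ 0 := by positivity
    have h1 := ((Real.hasDerivAt_arctan (s / (k + 1))).comp s
      ((hasDerivAt_id s).div_const ((k : ℝ) + 1))).const_mul ((k : ℝ) + 1)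
    refine h1.congr_deriv ?_
    simp only [F']
    field_simp
  have hF'c : ∀ k, Continuous (F' k) := fun k =>
    continuous_const.div (by fun_prop) fun s => by positivity
  have hF'b : ∀ k s, |F' k s| ≤ 1 := by
    intro k s
    rw [abs_of_nonneg (by positivity), div_le_one (by positivity)]
    linarith [sq_nonneg (s / ((k : ℝ) + 1))]
  have hFc : ∀ k, Continuous (F k) := fun k =>
    continuous_iff_continuousAt.2 fun s => (hF k s).continuousAt
  have hgi : ∀ i, LocallyIntegrableOn (fun x => g x i) D := fun i =>
    ((hg i).integrableOn hb).locallyIntegrableOn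
  set v : ℕ → Space N → ℝ := fun k x => F k (u x)
  set q : ℕ → Space N → Fin N → ℝ := fun k x i => F' k (u x) * g x i
  have hq : ∀ k i, ScalarL2 D fun x => q k x i := fun k i =>
    MemLp.of_le (hg i) (((hF'c k).comp_aestronglyMeasurable hum).mul (hg i).memLp.1)
      (ae_of_all _ fun x => by
        rw [norm_mul]
        exact mul_le_of_le_one_left (norm_nonneg _) (hF'b k _))
  have hv : ∀ k, MemH1 D (v k) (q k) := by
    refine fun k => ⟨?_, hq k, fun i => (h i).comp hD hu (hgi i) (hF k) (hF'c k) (hF'b k)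
      (by simp [F])⟩
    refine MemLp.of_bound ((hFc k).comp_aestronglyMeasurable hum) (((k : ℝ) + 1) * (Real.pi / 2))
      (ae_of_all _ fun x => ?_)
    rw [norm_mul, Real.norm_eq_abs, Real.norm_eq_abs, abs_of_nonneg (by positivity)]
    gcongr
    exact abs_le.2 ⟨(Real.neg_pi_div_two_lt_arctan _).le, (Real.arctan_lt_pi_div_two _).le⟩
  have hqn : ∀ k, vecNorm D (q k) ≤ vecNorm D g := by
    intro k
    refine Real.sqrt_le_sqrt (integral_mono (integrable_finsetSum _ fun i _ =>
      (hq k i).sq_integrable) (integrable_finsetSum _ fun i _ => (hg i).sq_integrable)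
      fun x => Finset.sum_le_sum fun i _ => ?_)
    rw [sq_le_sq, abs_mul]
    exact mul_le_of_le_one_left (abs_nonneg _) (hF'b k _)
  set m : ℕ → ℝ := fun k => ⨍ x in D, v k x
  have hvm : ∀ k, MemH1 D (fun x => v k x - m k) (q k) := fun k => (hv k).sub_const hb _
  obtain ⟨s, w, hs, hw, hlim⟩ := hR (fun k x => v k x - m k) q (max (C * vecNorm D g) (vecNorm D g))
    fun k => ⟨hvm k, ((hC _ _ (hv k)).trans (mul_le_mul_of_nonneg_left (hqn k) hC0)).trans
      (le_max_left _ _), (hqn k).trans (le_max_right _ _)⟩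
  obtain ⟨t, ht, hae⟩ := exists_ae_tendsto_of_scalarNorm (fun k => (hvm (s k)).1) hw hlim
  have hst : Tendsto (fun k => s (t k)) atTop atTop := hs.tendsto_atTop.comp ht.tendsto_atTop
  have hvl : ∀ x, Tendsto (fun k => v (s (t k)) x) atTop (𝓝 (u x)) := fun x =>
    (tendsto_mul_arctan_div (u x)).comp hst
  -- The means do not depend on `x`, hence neither does their limit `u x - w x`; so `u` is the `L²`
  -- function `w` plus a constant.
  have hml : ∀ᵐ x ∂volume.restrict D, Tendsto (fun k => m (s (t k))) atTop (𝓝 (u x - w x)) := by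
    filter_upwards [hae] with x hx
    simpa using (hvl x).sub hx
  have : NeZero (volume.restrict D) := ⟨by
    rw [Ne, Measure.restrict_eq_zero]
    exact (hD.measure_pos volume hc.nonempty).ne'⟩
  obtain ⟨x₀, hx₀⟩ := hml.exists
  have hfinal : (fun x => w x + (u x₀ - w x₀)) =ᵐ[volume.restrict D] u := by
    filter_upwards [hml] with x hx
    rw [tendsto_nhds_unique hx₀ hx]
    ring
  exact (memLp_congr_ae hfinal).1 (hw.add (scalarL2_const hb _))

/-! ### Compactness of irrotational fields with small symmetric part -/

theorem MemH1.sub {D : Set (Space N)} (hb : Bornology.IsBounded D) {u u' : Space N → ℝ}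
    {g g' : Space N → Fin N → ℝ} (h : MemH1 D u g) (h' : MemH1 D u' g') :
    MemH1 D (fun x => u x - u' x) (fun x i => g x i - g' x i) :=
  ⟨h.1.sub h'.1, fun i => (h.2.1 i).sub (h'.2.1 i), fun i => (h.2.2 i).sub (h'.2.2 i)
    (h.1.integrableOn hb).locallyIntegrableOn (h'.1.integrableOn hb).locallyIntegrableOn
    ((h.2.1 i).integrableOn hb).locallyIntegrableOn
    ((h'.2.1 i).integrableOn hb).locallyIntegrableOn⟩

/-- The sequence `u` is a Cauchy sequence for the `L²(D)` norm. -/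
def L2Cauchy (D : Set (Space N)) (u : ℕ → Space N → ℝ) : Prop :=
  ∀ ε > 0, ∃ n, ∀ k ≥ n, ∀ l ≥ n, scalarNorm D (fun x => u k x - u l x) < ε

theorem L2Cauchy.comp {D : Set (Space N)} {u : ℕ → Space N → ℝ} (h : L2Cauchy D u)
    {t : ℕ → ℕ} (ht : StrictMono t) : L2Cauchy D (fun k => u (t k)) := by
  intro ε hε
  obtain ⟨n, hn⟩ := h ε hε
  exact ⟨n, fun k hk l hl => hn _ (hk.trans (ht.id_le k)) _ (hl.trans (ht.id_le l))⟩

theorem l2Cauchy_of_tendsto {D : Set (Space N)} {u : ℕ → Space N → ℝ} {w : Space N → ℝ}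
    (hu : ∀ k, ScalarL2 D (u k)) (hw : ScalarL2 D w)
    (h : Tendsto (fun k => scalarNorm D (fun x => u k x - w x)) atTop (𝓝 0)) :
    L2Cauchy D u := by
  intro ε hε
  obtain ⟨n, hn⟩ := (h.eventually (gt_mem_nhds (half_pos hε))).exists_forall_of_atTop
  refine ⟨n, fun k hk l hl => ?_⟩
  have h1 := scalarNorm_sub_le ((hu k).sub hw) ((hu l).sub hw)
  simp only [sub_sub_sub_cancel_right] at h1
  linarith [hn k hk, hn l hl]

theorem vecNorm_row_le {D : Set (Space N)} {T : Space N → Matrix (Fin N) (Fin N) ℝ}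
    (hT : TensorL2 D T) (n : Fin N) : vecNorm D (fun x => T x n) ≤ N * tensorNorm D T := by
  refine (vecNorm_le_sum (hT n)).trans ?_
  refine (Finset.sum_le_sum fun j _ => scalarNorm_le_tensorNorm hT n j).trans_eq ?_
  simp

/-- The triangle inequality entry by entry; the factor `N * N` counts entries and does no harm in a
Cauchy estimate. -/
theorem tensorNorm_symPart_sub_le {D : Set (Space N)} {T S : Space N → Matrix (Fin N) (Fin N) ℝ}
    (hT : TensorL2 D T) (hS : TensorL2 D S) :
    tensorNorm D (fun x => symPart (T x - S x)) ≤
      N * (N * (tensorNorm D (fun x => symPart (T x)) + tensorNorm D fun x => symPart (S x))) := by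
  have hTS : TensorL2 D fun x => T x - S x := fun i j => (hT i j).sub (hS i j)
  refine (tensorNorm_le_sum hTS.symPart).trans ?_
  refine (Finset.sum_le_sum fun i _ => Finset.sum_le_sum fun j _ => ?_).trans_eq
    (b := ∑ _ : Fin N, ∑ _ : Fin N, (tensorNorm D (fun x => symPart (T x)) +
      tensorNorm D fun x => symPart (S x))) (by simp; ring)
  have h1 := scalarNorm_sub_le (hT.symPart i j) (hS.symPart i j)
  refine le_trans (le_of_eq ?_) (h1.trans (add_le_add (scalarNorm_le_tensorNorm hT.symPart i j)
    (scalarNorm_le_tensorNorm hS.symPart i j)))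
  congr 1
  funext x
  simp only [symPart, Matrix.smul_apply, Matrix.add_apply, Matrix.transpose_apply,
    Matrix.sub_apply, smul_eq_mul]
  ring

/-- An irrotational square integrable tensor field on a simply connected domain with Rellich's
selection theorem is a gradient; the potential can be chosen with the bound of Poincaré's
inequality. -/
theorem exists_bounded_potential {D : Set (Space N)} (hD : IsOpen D) (hsc : IsSimplyConnected D)
    (hb : Bornology.IsBounded D) (hR : Rellich D) :
    ∃ C : ℝ, 0 ≤ C ∧ ∀ g : Space N → Fin N → ℝ, VecL2 D g → HasWeakCurl D g 0 →
      ∃ u, MemH1 D u g ∧ scalarNorm D u ≤ C * vecNorm D g := by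
  have hc : IsConnected D := hsc.isPathConnected.isConnected
  obtain ⟨C, hC0, hC⟩ := exists_poincare_const hD hc hb hR
  refine ⟨C, hC0, fun g hg hcurl => ?_⟩
  obtain ⟨u, hu, hug⟩ := exists_potential hD hsc
    (fun i => ((hg i).integrableOn hb).locallyIntegrableOn) hcurl
  have hu1 : MemH1 D u g := ⟨scalarL2_of_weakGradient hD hc hb hR hu hg hug, hg, hug⟩
  exact ⟨_, hu1.sub_const hb _, hC u g hu1⟩

/-- The rows have potentials bounded in `H¹`, so Rellich's theorem makes a subsequence of the
potentials Cauchy. Korn's second inequality bounds differences of the fields by differences of the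
potentials and by symmetric parts, both of which become small. -/
theorem exists_l2Cauchy_subseq_piece {D : Set (Space N)} (hD : IsOpen D)
    (hsc : IsSimplyConnected D) (hb : Bornology.IsBounded D) (hK : KornProperty D)
    {T : ℕ → Space N → Matrix (Fin N) (Fin N) ℝ} (hT : ∀ k, TensorL2 D (T k))
    (hcurl : ∀ k n, HasWeakCurl D (fun x => T k x n) 0) {M : ℝ} (hM : ∀ k, tensorNorm D (T k) ≤ M)
    (hsym : Tendsto (fun k => tensorNorm D fun x => symPart (T k x)) atTop (𝓝 0)) :
    ∃ s : ℕ → ℕ, StrictMono s ∧ ∀ i j, L2Cauchy D fun k x => T (s k) x i j := by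
  obtain ⟨C, hC0, hC⟩ := exists_bounded_potential hD hsc hb hK.2
  choose u hu hub using fun k n => hC (fun x => T k x n) (hT k n) (hcurl k n)
  have hrow : ∀ k n, vecNorm D (fun x => T k x n) ≤ N * M := fun k n =>
    (vecNorm_row_le (hT k) n).trans (by gcongr; exact hM k)
  obtain ⟨s, hs, hcs⟩ := exists_common_subseq (fun n s => L2Cauchy D fun k => u (s k) n)
    (fun n s t ht h => h.comp ht) (fun n s hs => by
      obtain ⟨t, w, ht, hw, hlim⟩ := hK.2 (fun k => u (s k) n) (fun k x => T (s k) x n)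
        (max (C * (N * M)) (N * M)) fun k => ⟨hu _ _, ((hub _ _).trans
          (mul_le_mul_of_nonneg_left (hrow _ _) hC0)).trans (le_max_left _ _),
          (hrow _ _).trans (le_max_right _ _)⟩
      exact ⟨t, ht, l2Cauchy_of_tendsto (fun k => (hu _ _).1) hw hlim⟩)
  refine ⟨s, hs, fun i j ε hε => ?_⟩
  obtain ⟨c, hc, hKorn⟩ := hK.1
  -- The `N` potentials contribute `N * δ` and the two symmetric parts `2 * N * N * δ`; the extra
  -- `1` makes the final inequality strict and the denominator positive.
  have hδ : 0 < c * ε / (N + 2 * N * N + 1) := by positivity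
  set δ := c * ε / (N + 2 * N * N + 1) with hδd
  choose m hm using fun n => hcs n δ hδ
  obtain ⟨m', hm'⟩ := ((hsym.comp hs.tendsto_atTop).eventually
    (gt_mem_nhds hδ)).exists_forall_of_atTop
  simp only [Function.comp_apply] at hm'
  -- The sum serves as a common upper bound for the thresholds `m n`.
  refine ⟨max m' (∑ n, m n), fun k hk l hl => ?_⟩
  have hmn : ∀ n, m n ≤ max m' (∑ n, m n) := fun n =>
    (Finset.single_le_sum (fun _ _ => Nat.zero_le _) (Finset.mem_univ n)).trans (le_max_right _ _)
  have hTd : TensorL2 D fun x => T (s k) x - T (s l) x := fun i j => (hT _ i j).sub (hT _ i j)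
  have h1 := hKorn (fun x n => u (s k) n x - u (s l) n x) (fun x => T (s k) x - T (s l) x)
    fun n => (hu (s k) n).sub hb (hu (s l) n)
  have h2 : vecNorm D (fun x n => u (s k) n x - u (s l) n x) ≤ N * δ := by
    refine (vecNorm_le_sum fun n => (hu (s k) n).1.sub (hu (s l) n).1).trans ?_
    refine (Finset.sum_le_sum fun n _ =>
      (hm n k ((hmn n).trans hk) l ((hmn n).trans hl)).le).trans_eq
      ?_
    simp
  have h3 := tensorNorm_symPart_sub_le (hT (s k)) (hT (s l))
  have h4 : (N : ℝ) * (N * ((tensorNorm D fun x => symPart (T (s k) x)) +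
      tensorNorm D fun x => symPart (T (s l) x))) ≤ N * (N * (δ + δ)) := by
    gcongr
    · exact (hm' k ((le_max_left _ _).trans hk)).le
    · exact (hm' l ((le_max_left _ _).trans hl)).le
  have h5 : (N + 2 * N * N + 1) * δ = c * ε := by
    rw [hδd]
    field_simp
  have h6 : c * tensorNorm D (fun x => T (s k) x - T (s l) x) < c * ε := by
    rw [← h5]
    linarith
  exact (scalarNorm_le_tensorNorm hTd i j).trans_lt (lt_of_mul_lt_mul_left h6 hc.le)

/-- Squared norms add over disjoint slices that exhaust `Ω` up to a null set. -/
theorem scalarNorm_le_sum_slices {Ω Γt : Set (Space N)} {J : ℕ} {P : Fin J → Set (Space N)}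
    (hP : IsSlicing Ω Γt P) {u : Space N → ℝ} (hu : ScalarL2 Ω u) :
    scalarNorm Ω u ≤ ∑ j, scalarNorm (P j) u := by
  refine abs_le_of_sq_le_sq' ?_ (Finset.sum_nonneg fun _ _ => scalarNorm_nonneg _ _) |>.2
  refine le_trans (le_of_eq ?_) (sum_sq_le_sq_sum _ _ fun _ => scalarNorm_nonneg _ _)
  simp_rw [scalarNorm_sq]
  have hae : Ω =ᵐ[volume] ⋃ j, P j := by
    refine Filter.EventuallyLE.antisymm (ae_le_set.2 hP.null) ?_
    exact (Set.iUnion_subset hP.subset).eventuallyLE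
  rw [setIntegral_congr_set hae, integral_iUnion_fintype (fun j => (hP.isOpen j).measurableSet)
    hP.disjoint fun j => hu.sq_integrable.mono_set (hP.subset j)]

/-- A bounded sequence of irrotational fields whose symmetric parts tend to zero has a convergent
subsequence. -/
theorem exists_tendsto_subseq {Ω Γt : Set (Space N)} (hb : Bornology.IsBounded Ω) {J : ℕ}
    {P : Fin J → Set (Space N)} (hP : IsSlicing Ω Γt P)
    {T : ℕ → Space N → Matrix (Fin N) (Fin N) ℝ} (hT : ∀ k, TensorL2 Ω (T k))
    (hcurl : ∀ k n, HasWeakCurl Ω (fun x => T k x n) 0) {M : ℝ} (hM : ∀ k, tensorNorm Ω (T k) ≤ M)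
    (hsym : Tendsto (fun k => tensorNorm Ω fun x => symPart (T k x)) atTop (𝓝 0)) :
    ∃ (s : ℕ → ℕ) (S : Space N → Matrix (Fin N) (Fin N) ℝ), StrictMono s ∧ TensorL2 Ω S ∧
      ∀ i j, Tendsto (fun k => scalarNorm Ω fun x => T (s k) x i j - S x i j) atTop (𝓝 0) := by
  have hmono : ∀ j {A : Space N → Matrix (Fin N) (Fin N) ℝ}, TensorL2 Ω A →
      tensorNorm (P j) A ≤ tensorNorm Ω A := by
    intro j A hA
    refine abs_le_of_sq_le_sq' ?_ (tensorNorm_nonneg _ _) |>.2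
    rw [tensorNorm_sq hA, tensorNorm_sq fun i i' => (hA i i').mono (hP.subset j)]
    gcongr with i _ i' _
    · exact scalarNorm_nonneg _ _
    · exact scalarNorm_mono_set (hP.subset j) (hA i i')
  obtain ⟨s, hs, hcs⟩ := exists_common_subseq
    (fun (j : Fin J) s => ∀ i i', L2Cauchy (P j) fun k x => T (s k) x i i')
    (fun j s t ht h i i' => (h i i').comp ht) (fun j s hs =>
      exists_l2Cauchy_subseq_piece (hP.isOpen j) (hP.simplyConnected j) (hb.subset (hP.subset j))
        (hP.korn j) (fun k i i' => (hT (s k) i i').mono (hP.subset j))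
        (fun k n => (hcurl (s k) n).mono (hP.subset j))
        (fun k => (hmono j (hT (s k))).trans (hM (s k)))
        (squeeze_zero (fun k => tensorNorm_nonneg _ _) (fun k => hmono j (hT (s k)).symPart)
          (hsym.comp hs.tendsto_atTop)))
  have hΩ : ∀ i i', L2Cauchy Ω fun k x => T (s k) x i i' := by
    intro i i' ε hε
    have hδ : 0 < ε / (J + 1) := by positivity
    choose m hm using fun j => hcs j i i' _ hδ
    refine ⟨∑ j, m j, fun k hk l hl => ?_⟩
    have hmn : ∀ j, m j ≤ ∑ j, m j := fun j =>
      Finset.single_le_sum (fun _ _ => Nat.zero_le _) (Finset.mem_univ j)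
    refine (scalarNorm_le_sum_slices hP ((hT (s k) i i').sub (hT (s l) i i'))).trans_lt ?_
    refine (Finset.sum_le_sum fun j _ =>
      (hm j k ((hmn j).trans hk) l ((hmn j).trans hl)).le).trans_lt ?_
    simp only [Finset.sum_const, Finset.card_univ, Fintype.card_fin, nsmul_eq_mul]
    rw [mul_div_assoc', div_lt_iff₀ (by positivity)]
    linarith
  choose S hS hSl using fun i j => exists_tendsto_of_cauchy (fun k => hT (s k) i j) (hΩ i j)
  exact ⟨s, fun x => Matrix.of fun i j => S i j x, hs, hS, hSl⟩

/-- Coercivity of the symmetric part on a class of irrotational fields, provided that limits of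
such fields with vanishing symmetric part vanish. -/
theorem exists_coercivity_const {Ω Γt : Set (Space N)} (hb : Bornology.IsBounded Ω) {J : ℕ}
    {P : Fin J → Set (Space N)} (hP : IsSlicing Ω Γt P)
    (Q : (Space N → Matrix (Fin N) (Fin N) ℝ) → Prop)
    (hQ : ∀ T, Q T → TensorL2 Ω T ∧ ∀ n, HasWeakCurl Ω (fun x => T x n) 0)
    (hsmul : ∀ (a : ℝ) T, Q T → Q fun x => a • T x)
    (hlim : ∀ (T : ℕ → Space N → Matrix (Fin N) (Fin N) ℝ) (S), (∀ k, Q (T k)) → TensorL2 Ω S →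
      (∀ i j, Tendsto (fun k => scalarNorm Ω fun x => T k x i j - S x i j) atTop (𝓝 0)) →
      (∀ᵐ x ∂volume.restrict Ω, symPart (S x) = 0) → ∀ᵐ x ∂volume.restrict Ω, S x = 0) :
    ∃ c : ℝ, ∀ T, Q T → tensorNorm Ω T ≤ c * tensorNorm Ω fun x => symPart (T x) := by
  by_contra! hcon
  choose T hT hlt using fun k : ℕ => hcon (k + 1)
  have hpos : ∀ k, 0 < tensorNorm Ω (T k) := fun k =>
    (mul_nonneg (by positivity) (tensorNorm_nonneg Ω _)).trans_lt (hlt k)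
  set R : ℕ → Space N → Matrix (Fin N) (Fin N) ℝ := fun k x => (tensorNorm Ω (T k))⁻¹ • T k x
  have hR : ∀ k, Q (R k) := fun k => hsmul _ _ (hT k)
  have hR1 : ∀ k, tensorNorm Ω (R k) = 1 := fun k => by
    rw [tensorNorm_smul, abs_of_pos (inv_pos.2 (hpos k)), inv_mul_cancel₀ (hpos k).ne']
  have hRs : ∀ k, tensorNorm Ω (fun x => symPart (R k x)) ≤ 1 / (k + 1) := by
    intro k
    have : (fun x => symPart (R k x)) =
        fun x => (tensorNorm Ω (T k))⁻¹ • symPart (T k x) := by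
      funext x
      simp only [R, symPart, Matrix.transpose_smul, ← smul_add]
      rw [smul_comm]
    rw [this, tensorNorm_smul, abs_of_pos (inv_pos.2 (hpos k)), inv_mul_le_iff₀ (hpos k),
      mul_one_div, le_div_iff₀ (by positivity), mul_comm]
    exact (hlt k).le
  have hRs0 : Tendsto (fun k => tensorNorm Ω fun x => symPart (R k x)) atTop (𝓝 0) :=
    squeeze_zero (fun k => tensorNorm_nonneg _ _) hRs tendsto_one_div_add_atTop_nhds_zero_nat
  obtain ⟨s, S, hs, hS, hSl⟩ := exists_tendsto_subseq hb hP (fun k => (hQ _ (hR k)).1)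
    (fun k => (hQ _ (hR k)).2) (fun k => (hR1 k).le) hRs0
  have hsym : ∀ i j, scalarNorm Ω (fun x => symPart (S x) i j) = 0 := by
    intro i j
    -- From `sym S = sym (R (s k)) - sym (R (s k) - S)`, where both terms tend to zero.
    have hbd : ∀ k, scalarNorm Ω (fun x => symPart (S x) i j) ≤
        1 / 2 * scalarNorm Ω (fun x => R (s k) x i j - S x i j) +
        1 / 2 * scalarNorm Ω (fun x => R (s k) x j i - S x j i) +
        tensorNorm Ω fun x => symPart (R (s k) x) := by
      intro k
      have hRk := (hQ _ (hR (s k))).1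
      have e1 := (hRk i j).sub (hS i j)
      have e2 := (hRk j i).sub (hS j i)
      have h1 := scalarNorm_add_le (e1.const_mul (1 / 2)) (e2.const_mul (1 / 2))
      have h2 := scalarNorm_sub_le (hRk.symPart i j)
        ((e1.const_mul (1 / 2)).add (e2.const_mul (1 / 2)))
      rw [scalarNorm_smul, scalarNorm_smul, abs_of_pos (by norm_num : (0 : ℝ) < 1 / 2)] at h1
      have h3 := scalarNorm_le_tensorNorm hRk.symPart i j
      have h4 : (fun x => symPart (S x) i j) = fun x => symPart (R (s k) x) i j -
          (1 / 2 * (R (s k) x i j - S x i j) + 1 / 2 * (R (s k) x j i - S x j i)) := by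
        funext x
        simp only [symPart, Matrix.smul_apply, Matrix.add_apply, Matrix.transpose_apply,
          smul_eq_mul]
        ring
      rw [h4]
      linarith
    have hl : Tendsto (fun k => 1 / 2 * scalarNorm Ω (fun x => R (s k) x i j - S x i j) +
        1 / 2 * scalarNorm Ω (fun x => R (s k) x j i - S x j i) +
        tensorNorm Ω fun x => symPart (R (s k) x)) atTop (𝓝 0) := by
      have h := (((hSl i j).const_mul (1 / 2)).add ((hSl j i).const_mul (1 / 2))).add
        (hRs0.comp hs.tendsto_atTop)
      simp only [mul_zero, add_zero] at h
      exact h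
    exact le_antisymm (ge_of_tendsto' hl hbd) (scalarNorm_nonneg _ _)
  have hSsym : ∀ᵐ x ∂volume.restrict Ω, symPart (S x) = 0 := by
    have : ∀ᵐ x ∂volume.restrict Ω, ∀ i j, symPart (S x) i j = 0 :=
      ae_all_iff.2 fun i => ae_all_iff.2 fun j => scalarNorm_eq_zero (hS.symPart i j) (hsym i j)
    filter_upwards [this] with x hx
    ext i j
    exact hx i j
  have hS0 := hlim _ S (fun k => hR (s k)) hS hSl hSsym
  have hcomp : ∀ i j, Tendsto (fun k => scalarNorm Ω fun x => R (s k) x i j) atTop (𝓝 0) := by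
    intro i j
    refine (hSl i j).congr fun k => scalarNorm_congr_ae (hS0.mono fun x hx => ?_)
    simp [hx]
  have hsum : Tendsto (fun k => ∑ i, ∑ j, scalarNorm Ω fun x => R (s k) x i j) atTop (𝓝 0) := by
    simpa using tendsto_finsetSum Finset.univ fun i _ =>
      tendsto_finsetSum Finset.univ fun j _ => hcomp i j
  have h1 : (1 : ℝ) ≤ 0 := ge_of_tendsto' hsum fun k => by
    rw [← hR1 (s k)]
    exact tensorNorm_le_sum (hQ _ (hR (s k))).1
  linarith

/-! ### Irrotational fields: limits and constants -/

theorem ScalarL2.integrable_mul {U : Set (Space N)} {u w : Space N → ℝ} (hu : ScalarL2 U u)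
    (hw : ScalarL2 U w) : Integrable (fun x => u x * w x) (volume.restrict U) :=
  MemLp.integrable_mul hu hw

theorem HasWeakCurl.zero_of_tendsto {U : Set (Space N)} {v : ℕ → Space N → Fin N → ℝ}
    {w : Space N → Fin N → ℝ} (hv : ∀ k, VecL2 U (v k)) (hw : VecL2 U w)
    (h : ∀ i, Tendsto (fun k => scalarNorm U fun x => v k x i - w x i) atTop (𝓝 0))
    (hc : ∀ k, HasWeakCurl U (v k) 0) : HasWeakCurl U w 0 := by
  intro i j φ hφ
  have hd : ∀ l, ScalarL2 U (partialD l φ) := fun l =>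
    scalarL2_of_continuous (continuous_partialD hφ.1 l) (hasCompactSupport_partialD hφ.2.1 l)
  have hlim := (tendsto_integral_mul_of_scalarNorm (fun k => hv k j) (hw j) (hd i) (h j)).sub
    (tendsto_integral_mul_of_scalarNorm (fun k => hv k i) (hw i) (hd j) (h i))
  have hint : ∀ u : Space N → Fin N → ℝ, VecL2 U u →
      ∫ x in U, (u x j * partialD i φ x - u x i * partialD j φ x) =
        (∫ x in U, u x j * partialD i φ x) - ∫ x in U, u x i * partialD j φ x := fun u hu =>
    integral_sub ((hu j).integrable_mul (hd i)) ((hu i).integrable_mul (hd j))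
  have h0 : ∀ k,
      (∫ x in U, v k x j * partialD i φ x) - ∫ x in U, v k x i * partialD j φ x = 0 := by
    intro k
    rw [← hint (v k) (hv k), hc k i j φ hφ]
    simp
  simp only [h0] at hlim
  rw [hint w hw, ← tendsto_nhds_unique tendsto_const_nhds hlim]
  simp

theorem HasWeakCurl.sub_const {U : Set (Space N)} {v : Space N → Fin N → ℝ}
    {w : Space N → Matrix (Fin N) (Fin N) ℝ} (hv : VecL2 U v) (h : HasWeakCurl U v w)
    (a : Fin N → ℝ) : HasWeakCurl U (fun x => v x - a) w := by
  intro i j φ hφ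
  have hd : ∀ l, ScalarL2 U (partialD l φ) := fun l =>
    scalarL2_of_continuous (continuous_partialD hφ.1 l) (hasCompactSupport_partialD hφ.2.1 l)
  have hi : ∀ (b : ℝ) l, Integrable (fun x => b * partialD l φ x) (volume.restrict U) :=
    fun b l => (((continuous_partialD hφ.1 l).integrable_of_hasCompactSupport
      (hasCompactSupport_partialD hφ.2.1 l)).const_mul b).restrict
  have h0 : ∀ (b : ℝ) l, ∫ x in U, b * partialD l φ x = 0 := fun b l => by
    rw [setIntegral_mul_partialD hφ.2.2 (fun _ => b), integral_const_mul,
      integral_partialD_eq_zero hφ.1 hφ.2.1, mul_zero]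
  have hs : ∫ x in U, (a j * partialD i φ x - a i * partialD j φ x) = 0 := by
    rw [integral_sub (hi _ _) (hi _ _), h0, h0, sub_zero]
  rw [← h i j φ hφ, ← sub_zero (∫ x in U, (v x j * partialD i φ x - v x i * partialD j φ x)), ← hs,
    ← integral_sub (by exact ((hv j).integrable_mul (hd i)).sub ((hv i).integrable_mul (hd j)))
      (by exact (hi _ _).sub (hi _ _))]
  refine integral_congr_ae (ae_of_all _ fun x => ?_)
  simp only [Pi.sub_apply]
  ring

theorem MemHCurlZero.tensorL2 {Ω : Set (Space N)} {T : Space N → Matrix (Fin N) (Fin N) ℝ}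
    (hT : MemHCurlZero Ω T) : TensorL2 Ω T :=
  fun n => (hT n).1.1

theorem MemHCurlZero.sub_const {Ω : Set (Space N)} (hb : Bornology.IsBounded Ω)
    {T : Space N → Matrix (Fin N) (Fin N) ℝ} (hT : MemHCurlZero Ω T)
    (A : Matrix (Fin N) (Fin N) ℝ) : MemHCurlZero Ω fun x => T x - A := by
  intro n
  have h := (hT n).2.sub_const (hT.tensorL2 n) (A n)
  exact ⟨⟨fun i => (hT.tensorL2 n i).sub (scalarL2_const hb _), 0, fun _ _ => scalarL2_const hb 0,
    h⟩, h⟩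

/-! ### Orthogonal projection onto the constant skew-symmetric fields -/

theorem skewPart_mem_so (M : Matrix (Fin N) (Fin N) ℝ) : skewPart M ∈ so N := by
  ext i j
  simp only [skewPart, Matrix.transpose_apply, Matrix.smul_apply, Matrix.sub_apply,
    Matrix.neg_apply, smul_eq_mul]
  ring

theorem sub_mem_so {A B : Matrix (Fin N) (Fin N) ℝ} (hA : A ∈ so N) (hB : B ∈ so N) :
    A - B ∈ so N := by
  have hA' : Aᵀ = -A := hA
  have hB' : Bᵀ = -B := hB
  change (A - B)ᵀ = -(A - B)
  rw [Matrix.transpose_sub, hA', hB']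
  abel

theorem zero_mem_so : (0 : Matrix (Fin N) (Fin N) ℝ) ∈ so N := by
  change (0 : Matrix (Fin N) (Fin N) ℝ)ᵀ = -0
  simp

theorem symPart_sub_of_mem_so (A : Matrix (Fin N) (Fin N) ℝ) {B : Matrix (Fin N) (Fin N) ℝ}
    (hB : B ∈ so N) :
    symPart (A - B) = symPart A := by
  have hB' : Bᵀ = -B := hB
  rw [symPart, symPart, Matrix.transpose_sub, hB']
  congr 1
  abel

/-- Symmetric and skew matrices are orthogonal for the Frobenius product, so a skew `B` sees only
the skew part. -/
theorem sum_mul_eq_sum_skewPart_mul {M B : Matrix (Fin N) (Fin N) ℝ} (hB : B ∈ so N) :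
    ∑ i, ∑ j, M i j * B i j = ∑ i, ∑ j, skewPart M i j * B i j := by
  have hB' : ∀ i j, B j i = -B i j := fun i j => congr_fun (congr_fun (show Bᵀ = -B from hB) i) j
  have h : ∑ i, ∑ j, M j i * B i j = -∑ i, ∑ j, M i j * B i j := by
    rw [Finset.sum_comm, ← Finset.sum_neg_distrib]
    refine Finset.sum_congr rfl fun i _ => ?_
    rw [← Finset.sum_neg_distrib]
    refine Finset.sum_congr rfl fun j _ => ?_
    rw [hB' i j]
    ring
  have h2 : ∑ i, ∑ j, skewPart M i j * B i j =
      1 / 2 * (∑ i, ∑ j, M i j * B i j - ∑ i, ∑ j, M j i * B i j) := by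
    simp only [← Finset.sum_sub_distrib, Finset.mul_sum]
    refine Finset.sum_congr rfl fun i _ => Finset.sum_congr rfl fun j _ => ?_
    simp only [skewPart, Matrix.transpose_apply, Matrix.smul_apply, Matrix.sub_apply, smul_eq_mul]
    ring
  rw [h2, h]
  ring

theorem tensorInner_sub_const {Ω : Set (Space N)} (hb : Bornology.IsBounded Ω)
    (hpos : 0 < volume.real Ω) {T : Space N → Matrix (Fin N) (Fin N) ℝ} (hT : TensorL2 Ω T)
    (A B : Matrix (Fin N) (Fin N) ℝ) :
    tensorInner Ω (fun x => T x - A) (fun _ => B) =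
      volume.real Ω * ∑ i, ∑ j, (tensorMean Ω T i j - A i j) * B i j := by
  have : IsFiniteMeasure (volume.restrict Ω) := ⟨by simpa using hb.measure_lt_top⟩
  have hi : ∀ i j, Integrable (fun x => (T x - A) i j * B i j) (volume.restrict Ω) := fun i j =>
    (((hT i j).integrableOn hb).sub (integrable_const _)).mul_const _
  rw [tensorInner, integral_finsetSum _ fun i _ => integrable_finsetSum _ fun j _ => hi i j,
    Finset.mul_sum]
  refine Finset.sum_congr rfl fun i _ => ?_
  rw [integral_finsetSum _ fun j _ => hi i j, Finset.mul_sum]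
  refine Finset.sum_congr rfl fun j _ => ?_
  have h1 : ∫ x in Ω, (T x i j - A i j) = (∫ x in Ω, T x i j) - volume.real Ω * A i j := by
    rw [integral_sub ((hT i j).integrableOn hb) (integrable_const _)]
    simp
  simp only [Matrix.sub_apply]
  rw [integral_mul_const, h1]
  simp only [tensorMean, Matrix.of_apply, setAverage_eq, smul_eq_mul]
  field_simp

/-- Against a constant field only the mean of `T` matters, and against a skew one only its skew
part. The condition thus says that `skewMean Ω T - A` is orthogonal to every skew matrix; being
skew, it can be tested against itself. -/
theorem perpSo_sub_const_iff {Ω : Set (Space N)} (hb : Bornology.IsBounded Ω)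
    (hpos : 0 < volume.real Ω) {T : Space N → Matrix (Fin N) (Fin N) ℝ} (hT : TensorL2 Ω T)
    {A : Matrix (Fin N) (Fin N) ℝ} (hA : A ∈ so N) :
    PerpSo Ω (fun x => T x - A) ↔ A = skewMean Ω T := by
  have key : ∀ B ∈ so N, tensorInner Ω (fun x => T x - A) (fun _ => B) =
      volume.real Ω * ∑ i, ∑ j, (skewMean Ω T i j - A i j) * B i j := by
    intro B hB
    rw [tensorInner_sub_const hb hpos hT]
    simp only [sub_mul, Finset.sum_sub_distrib]
    rw [sum_mul_eq_sum_skewPart_mul hB, skewMean]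
  constructor
  · intro h
    have h0 := h _ (sub_mem_so (skewPart_mem_so _) hA : skewMean Ω T - A ∈ so N)
    rw [key _ (sub_mem_so (skewPart_mem_so _) hA : skewMean Ω T - A ∈ so N)] at h0
    have h1 := (mul_eq_zero.1 h0).resolve_left hpos.ne'
    simp only [Matrix.sub_apply] at h1
    rw [Finset.sum_eq_zero_iff_of_nonneg fun i _ => Finset.sum_nonneg fun j _ =>
      mul_self_nonneg _] at h1
    ext i j
    have h2 := (Finset.sum_eq_zero_iff_of_nonneg fun j _ => mul_self_nonneg _).1
      (h1 i (Finset.mem_univ i)) j (Finset.mem_univ j)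
    exact (sub_eq_zero.1 (mul_self_eq_zero.1 h2)).symm
  · intro h B hB
    rw [key B hB, ← h]
    simp

theorem isSoProjection_iff {Ω : Set (Space N)} (hb : Bornology.IsBounded Ω)
    (hpos : 0 < volume.real Ω) {T : Space N → Matrix (Fin N) (Fin N) ℝ} (hT : TensorL2 Ω T)
    (S : Matrix (Fin N) (Fin N) ℝ) : IsSoProjection Ω T S ↔ S = skewMean Ω T :=
  ⟨fun h => (perpSo_sub_const_iff hb hpos hT h.1).1 h.2, fun h =>
    have hS : S ∈ so N := h ▸ skewPart_mem_so _
    ⟨hS, (perpSo_sub_const_iff hb hpos hT hS).2 h⟩⟩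

theorem skewMean_eq_zero_iff {Ω : Set (Space N)} (hb : Bornology.IsBounded Ω)
    (hpos : 0 < volume.real Ω) {T : Space N → Matrix (Fin N) (Fin N) ℝ} (hT : TensorL2 Ω T) :
    skewMean Ω T = 0 ↔ PerpSo Ω T := by
  have h := perpSo_sub_const_iff hb hpos hT zero_mem_so
  simp only [sub_zero] at h
  rw [h, eq_comm]

theorem PerpSo.smul {Ω : Set (Space N)} {T : Space N → Matrix (Fin N) (Fin N) ℝ}
    (hT : PerpSo Ω T) (a : ℝ) : PerpSo Ω fun x => a • T x := by
  intro B hB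
  have h := hT B hB
  rw [tensorInner] at h ⊢
  simp only [Matrix.smul_apply, smul_eq_mul, mul_assoc, ← Finset.mul_sum]
  rw [integral_const_mul, h, mul_zero]

theorem HasWeakCurl.zero_smul {Ω : Set (Space N)} {v : Space N → Fin N → ℝ}
    (hv : HasWeakCurl Ω v 0) (a : ℝ) : HasWeakCurl Ω (fun x => a • v x) 0 := by
  intro i j φ hφ
  have h := hv i j φ hφ
  simp only [Pi.zero_apply, Matrix.zero_apply, zero_mul, integral_zero, neg_zero] at h ⊢
  simp only [Pi.smul_apply, smul_eq_mul, mul_assoc, ← mul_sub]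
  rw [integral_const_mul, h, mul_zero]

/-- Orthogonality to the constant skew-symmetric fields is stable under `L²`-limits. -/
theorem PerpSo.of_tendsto {Ω : Set (Space N)} (hb : Bornology.IsBounded Ω)
    {T : ℕ → Space N → Matrix (Fin N) (Fin N) ℝ} {S : Space N → Matrix (Fin N) (Fin N) ℝ}
    (hT : ∀ k, TensorL2 Ω (T k)) (hS : TensorL2 Ω S)
    (h : ∀ i j, Tendsto (fun k => scalarNorm Ω fun x => T k x i j - S x i j) atTop (𝓝 0))
    (hp : ∀ k, PerpSo Ω (T k)) : PerpSo Ω S := by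
  intro B hB
  have hsum : ∀ R : Space N → Matrix (Fin N) (Fin N) ℝ, TensorL2 Ω R →
      tensorInner Ω R (fun _ => B) = ∑ i, ∑ j, ∫ x in Ω, R x i j * B i j := by
    intro R hR
    have hi : ∀ i j, Integrable (fun x => R x i j * B i j) (volume.restrict Ω) := fun i j =>
      ((hR i j).integrableOn hb).mul_const _
    rw [tensorInner, integral_finsetSum _ fun i _ => integrable_finsetSum _ fun j _ => hi i j]
    exact Finset.sum_congr rfl fun i _ => integral_finsetSum _ fun j _ => hi i j
  have hl : Tendsto (fun k => tensorInner Ω (T k) fun _ => B) atTop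
      (𝓝 (tensorInner Ω S fun _ => B)) := by
    simp only [hsum _ hS, hsum _ (hT _)]
    exact tendsto_finsetSum _ fun i _ => tendsto_finsetSum _ fun j _ =>
      tendsto_integral_mul_of_scalarNorm (fun k => hT k i j) (hS i j) (scalarL2_const hb _) (h i j)
  simp only [hp _ B hB] at hl
  exact tendsto_nhds_unique hl tendsto_const_nhds

/-- A limit with vanishing symmetric part is a constant skew matrix, hence its own projection onto
`so N`; orthogonality survives the limit and makes that projection zero. -/
theorem exists_korn_const_perpSo {Ω Γt : Set (Space N)} (hΩ : IsBoundedDomain Ω) {J : ℕ}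
    {P : Fin J → Set (Space N)} (hP : IsSlicing Ω Γt P) :
    ∃ c : ℝ, ∀ T, MemHCurlZero Ω T → PerpSo Ω T →
      tensorNorm Ω T ≤ c * tensorNorm Ω fun x => symPart (T x) := by
  obtain ⟨ho, hc, hb⟩ := hΩ
  have hpos : 0 < volume.real Ω := ENNReal.toReal_pos (ho.measure_pos _ hc.nonempty).ne'
    hb.measure_lt_top.ne
  refine (exists_coercivity_const hb hP
    (fun T => (TensorL2 Ω T ∧ ∀ n, HasWeakCurl Ω (fun x => T x n) 0) ∧ PerpSo Ω T)
    (fun T hT => hT.1)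
    (fun a T hT => ⟨⟨fun i j => (hT.1.1 i j).const_mul a, fun n => (hT.1.2 n).zero_smul a⟩,
      hT.2.smul a⟩) ?_).imp fun c h T hT hp => h T ⟨⟨hT.tensorL2, fun n => (hT n).2⟩, hp⟩
  intro T S hT hS hl hsym
  have hp := PerpSo.of_tendsto hb (fun k => (hT k).1.1) hS hl fun k => (hT k).2
  have hcurl : ∀ n, HasWeakCurl Ω (fun x => S x n) 0 := fun n =>
    HasWeakCurl.zero_of_tendsto (fun k => (hT k).1.1 n) (hS n) (hl n) fun k => (hT k).1.2 n
  rw [ae_restrict_iff' ho.measurableSet] at hsym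
  obtain ⟨A, hA, hSA⟩ := exists_ae_eq_so ho hc
    (fun i j => ((hS i j).integrableOn hb).locallyIntegrableOn) hcurl hsym
  rw [← ae_restrict_iff' ho.measurableSet] at hSA
  have h0 : PerpSo Ω fun x => S x - A := by
    intro B _
    rw [tensorInner, integral_congr_ae (g := fun _ => 0)]
    · simp
    · filter_upwards [hSA] with x hx
      simp [hx]
  have hA0 : A = 0 := by
    rw [(perpSo_sub_const_iff hb hpos hS hA).1 h0, (skewMean_eq_zero_iff hb hpos hS).2 hp]
  rwa [hA0] at hSA

/-! ### Extension by zero across the boundary part -/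

theorem scalarNorm_sub_comm (Ω : Set (Space N)) (u w : Space N → ℝ) :
    scalarNorm Ω (fun x => u x - w x) = scalarNorm Ω (fun x => w x - u x) := by
  rw [← scalarNorm_neg]
  simp only [neg_sub]

/-- There is no boundary term although `φ` need not vanish on `Γt`: the zero extension of `Φ` is
differentiable on the support of `φ`. A point of that support outside `Ω` lies either in `Γt`, where
`Φ` vanishes on `Ω` within distance `δ`, or off `closure Ω`. -/
theorem integral_boundaryTest_mul_partialD {Ω Γt W : Set (Space N)} (hΩ : IsOpen Ω)
    (hW : W ∩ frontier Ω ⊆ Γt) {Φ : Space N → Fin N → ℝ} (hΦ : IsBoundaryTest Ω Γt Φ)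
    {φ : Space N → ℝ} (hφ : IsTest (Ω ∪ W) φ) (i k : Fin N) :
    ∫ x in Ω, Φ x k * partialD i φ x = -∫ x in Ω, partialD i (fun y => Φ y k) x * φ x := by
  obtain ⟨hs, hc, δ, hδ, hdist⟩ := hΦ
  have hsk : ContDiff ℝ ∞ fun y => Φ y k := contDiff_pi.1 hs k
  have hck : HasCompactSupport fun y => Φ y k :=
    hc.comp_left (g := fun v : Fin N → ℝ => v k) rfl
  set f : Space N → ℝ := Ω.indicator fun y => Φ y k with hf
  have hin : ∀ x ∈ Ω, f =ᶠ[𝓝 x] fun y => Φ y k := fun x hx => by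
    filter_upwards [hΩ.mem_nhds hx] with y hy
    exact Set.indicator_of_mem hy _
  have hout : ∀ x ∈ tsupport φ, x ∉ Ω → f =ᶠ[𝓝 x] fun _ => 0 := by
    intro x hx hxΩ
    by_cases hfr : x ∈ closure Ω
    · have hxΓ : x ∈ Γt := hW ⟨(hφ.2.2 hx).resolve_left hxΩ,
        hfr, by rwa [hΩ.interior_eq]⟩
      filter_upwards [Metric.ball_mem_nhds x hδ] with y hy
      by_cases hyΩ : y ∈ Ω
      · rw [hf, Set.indicator_of_mem hyΩ]
        by_contra hne
        have := hdist y hyΩ (fun h => hne (by rw [h]; rfl)) x hxΓ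
        exact absurd (Metric.mem_ball.1 hy) (not_lt.2 this)
      · exact Set.indicator_of_notMem hyΩ _
    · filter_upwards [isClosed_closure.isOpen_compl.mem_nhds hfr] with y hy
      exact Set.indicator_of_notMem (fun h => hy (subset_closure h)) _
  have hdf : (fun x => fderiv ℝ f x (EuclideanSpace.single i 1) * φ x) =
      Ω.indicator fun x => partialD i (fun y => Φ y k) x * φ x := by
    funext x
    by_cases hx : x ∈ Ω
    · rw [Set.indicator_of_mem hx, (hin x hx).fderiv_eq]
      rfl
    · rw [Set.indicator_of_notMem hx]
      by_cases hxφ : x ∈ tsupport φ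
      · rw [(hout x hxφ hx).fderiv_eq]
        simp
      · rw [image_eq_zero_of_notMem_tsupport hxφ, mul_zero]
  have hmul : ∀ ψ : Space N → ℝ, (fun x => f x * ψ x) = Ω.indicator fun x => Φ x k * ψ x := by
    intro ψ
    funext x
    by_cases hx : x ∈ Ω <;> simp [f, hx]
  have hint : ∀ a b : Space N → ℝ, Continuous a → Continuous b → HasCompactSupport b →
      Integrable (Ω.indicator fun x => a x * b x) := fun a b ha hb hcb =>
    ((ha.mul hb).integrable_of_hasCompactSupport hcb.mul_left).indicator hΩ.measurableSet
  have h := integral_mul_fderiv_eq_neg_fderiv_mul_of_integrable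
    (μ := (volume : Measure (Space N))) (f := f) (g := φ) (v := EuclideanSpace.single i (1 : ℝ))
    (by rw [hdf]; exact hint _ _ (continuous_partialD hsk i) hφ.1.continuous hφ.2.1)
    (by
      rw [hmul]
      exact hint _ _ hsk.continuous (continuous_partialD hφ.1 i)
        (hasCompactSupport_partialD hφ.2.1 i))
    (by rw [hmul]; exact hint _ _ hsk.continuous hφ.1.continuous hφ.2.1)
    (fun x hx => by
      by_cases hxΩ : x ∈ Ω
      · exact (hsk.differentiable (by simp) x).congr_of_eventuallyEq (hin x hxΩ)
      · exact (differentiableAt_const (0 : ℝ)).congr_of_eventuallyEq (hout x hx hxΩ))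
    (fun x _ => hφ.1.differentiable (by simp) x)
  rw [hdf, hmul, integral_indicator hΩ.measurableSet, integral_indicator hΩ.measurableSet] at h
  exact h

/-- Uniqueness of the weak curl, needed to identify the field `w` in `MemHcurlCirc`, the limit of
the approximating curls, with zero. -/
theorem ae_eq_zero_of_hasWeakCurl {Ω : Set (Space N)} (hΩ : IsOpen Ω)
    (hb : Bornology.IsBounded Ω) {v : Space N → Fin N → ℝ}
    {w : Space N → Matrix (Fin N) (Fin N) ℝ} (hw : TensorL2 Ω w) (h : HasWeakCurl Ω v w)
    (h0 : HasWeakCurl Ω v 0) (i j : Fin N) : ∀ᵐ x, x ∈ Ω → w x i j = 0 := by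
  refine hΩ.ae_eq_zero_of_integral_contDiff_smul_eq_zero
    ((hw i j).integrableOn hb).locallyIntegrableOn fun φ h1 h2 h3 => ?_
  have e := (h i j φ ⟨h1, h2, h3⟩).symm.trans (h0 i j φ ⟨h1, h2, h3⟩)
  rw [setIntegral_mul_test h3 fun x => w x i j] at e
  simp only [smul_eq_mul, mul_comm (φ _)]
  simpa using e

/-- The extension by zero of an irrotational field with vanishing tangential trace on a part of
the boundary is irrotational across this part. -/
theorem hasWeakCurl_indicator {Ω Γt W : Set (Space N)} (hΩ : IsOpen Ω)
    (hb : Bornology.IsBounded Ω) (hW : W ∩ frontier Ω ⊆ Γt) {v : Space N → Fin N → ℝ}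
    (hv : MemHcurlCirc Ω Γt v) (hv0 : HasWeakCurl Ω v 0) :
    HasWeakCurl (Ω ∪ W) (Ω.indicator v) 0 := by
  intro i j φ hφ
  obtain ⟨hv2, w, hw, hvw, happ⟩ := hv
  choose Φ hΦ hΦv hΦw using fun k : ℕ => happ (1 / (k + 1)) Nat.one_div_pos_of_nat
  have hd : ∀ l, ScalarL2 Ω (partialD l φ) := fun l =>
    scalarL2_of_continuous (continuous_partialD hφ.1 l) (hasCompactSupport_partialD hφ.2.1 l)
  have hsk : ∀ k l, ContDiff ℝ ∞ fun y => Φ k y l := fun k l => contDiff_pi.1 (hΦ k).1 l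
  have hck : ∀ k l, HasCompactSupport fun y => Φ k y l := fun k l =>
    (hΦ k).2.1.comp_left (g := fun v : Fin N → ℝ => v l) rfl
  have hΦ2 : ∀ k, VecL2 Ω (Φ k) := fun k l =>
    scalarL2_of_continuous (hsk k l).continuous (hck k l)
  have hdΦ : ∀ k l m, ScalarL2 Ω (partialD l fun y => Φ k y m) := fun k l m =>
    scalarL2_of_continuous (continuous_partialD (hsk k m) l)
      (hasCompactSupport_partialD (hck k m) l)
  have hcΦ : ∀ k, TensorL2 Ω (classicalCurl (Φ k)) := fun k l m => (hdΦ k l m).sub (hdΦ k m l)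
  have hφ2 : ScalarL2 Ω φ := scalarL2_of_continuous hφ.1.continuous hφ.2.1
  have hlv : ∀ l, Tendsto (fun k => scalarNorm Ω fun x => Φ k x l - v x l) atTop (𝓝 0) := by
    intro l
    refine squeeze_zero (fun _ => scalarNorm_nonneg _ _) (fun k => ?_)
      tendsto_one_div_add_atTop_nhds_zero_nat
    rw [scalarNorm_sub_comm]
    exact (scalarNorm_le_vecNorm (v := fun x => v x - Φ k x)
      (fun l => (hv2 l).sub (hΦ2 k l)) l).trans (hΦv k).le
  have hlw : Tendsto (fun k => scalarNorm Ω fun x => classicalCurl (Φ k) x i j - w x i j) atTop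
      (𝓝 0) := by
    refine squeeze_zero (fun _ => scalarNorm_nonneg _ _) (fun k => ?_)
      tendsto_one_div_add_atTop_nhds_zero_nat
    rw [scalarNorm_sub_comm]
    exact (scalarNorm_le_tensorNorm (T := fun x => w x - classicalCurl (Φ k) x)
      (fun l m => (hw l m).sub (hcΦ k l m)) i j).trans (hΦw k).le
  have h1 := (tendsto_integral_mul_of_scalarNorm (fun k => hΦ2 k j) (hv2 j) (hd i) (hlv j)).sub
    (tendsto_integral_mul_of_scalarNorm (fun k => hΦ2 k i) (hv2 i) (hd j) (hlv i))
  have h2 := tendsto_integral_mul_of_scalarNorm (fun k => hcΦ k i j) (hw i j) hφ2 hlw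
  -- For the approximants the identity holds with test functions reaching across `Γt`; both sides
  -- pass to the limit, and the right one tends to zero.
  have h3 : ∀ k, (∫ x in Ω, Φ k x j * partialD i φ x) - ∫ x in Ω, Φ k x i * partialD j φ x =
      -∫ x in Ω, classicalCurl (Φ k) x i j * φ x := by
    intro k
    rw [integral_boundaryTest_mul_partialD hΩ hW (hΦ k) hφ,
      integral_boundaryTest_mul_partialD hΩ hW (hΦ k) hφ]
    have : ∫ x in Ω, classicalCurl (Φ k) x i j * φ x =
        (∫ x in Ω, partialD i (fun y => Φ k y j) x * φ x) -
          ∫ x in Ω, partialD j (fun y => Φ k y i) x * φ x := by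
      rw [← integral_sub ((hdΦ k i j).integrable_mul hφ2) ((hdΦ k j i).integrable_mul hφ2)]
      simp only [classicalCurl, Matrix.of_apply, sub_mul]
    rw [this]
    ring
  have h4 : ∫ x in Ω, w x i j * φ x = 0 := by
    rw [← integral_zero (Space N) ℝ (μ := volume.restrict Ω)]
    refine integral_congr_ae ?_
    have := ae_eq_zero_of_hasWeakCurl hΩ hb hw hvw hv0 i j
    rw [← ae_restrict_iff' hΩ.measurableSet] at this
    filter_upwards [this] with x hx
    rw [hx, zero_mul]
  simp only [h3] at h1
  have h5 := tendsto_nhds_unique h1 h2.neg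
  rw [h4, neg_zero, ← integral_sub ((hv2 j).integrable_mul (hd i))
    ((hv2 i).integrable_mul (hd j))] at h5
  have h6 : (fun x => Ω.indicator v x j * partialD i φ x - Ω.indicator v x i * partialD j φ x) =
      Ω.indicator fun x => v x j * partialD i φ x - v x i * partialD j φ x := by
    funext x
    by_cases hx : x ∈ Ω <;> simp [hx]
  rw [h6, setIntegral_indicator hΩ.measurableSet, Set.inter_eq_right.2 Set.subset_union_left, h5]
  simp

theorem HasWeakCurl.congr_on {Ω : Set (Space N)} (hΩ : IsOpen Ω) {v v' : Space N → Fin N → ℝ}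
    {w : Space N → Matrix (Fin N) (Fin N) ℝ} (h : HasWeakCurl Ω v w) (hv : ∀ x ∈ Ω, v x = v' x) :
    HasWeakCurl Ω v' w := by
  intro i j φ hφ
  rw [← h i j φ hφ]
  exact setIntegral_congr_fun hΩ.measurableSet fun x hx => by simp only [hv x hx]

theorem scalarL2_indicator {Ω U : Set (Space N)} (hΩ : IsOpen Ω) {u : Space N → ℝ}
    (hu : ScalarL2 Ω u) : ScalarL2 U (Ω.indicator u) :=
  ((memLp_indicator_iff_restrict hΩ.measurableSet).2 hu).restrict U

theorem scalarNorm_indicator {Ω U : Set (Space N)} (hΩ : IsOpen Ω) (hU : Ω ⊆ U)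
    (u : Space N → ℝ) : scalarNorm U (Ω.indicator u) = scalarNorm Ω u := by
  have h : (fun x => Ω.indicator u x ^ 2) = Ω.indicator fun x => u x ^ 2 := by
    funext x
    by_cases hx : x ∈ Ω <;> simp [hx]
  rw [scalarNorm, scalarNorm, h, setIntegral_indicator hΩ.measurableSet,
    Set.inter_eq_right.2 hU]

/-- Points outside of the closure accumulate at Lipschitz boundary points. -/
theorem LipschitzBoundaryAt.exists_notMem_closure {Ω W : Set (Space N)} {x : Space N}
    (h : LipschitzBoundaryAt Ω x) (hx : x ∈ frontier Ω) (hW : W ∈ 𝓝 x) :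
    (W \ closure Ω).Nonempty := by
  obtain ⟨e, i, -, hxe, -, -, he⟩ := h
  have h0 : e x i = 0 := (he x hxe).2.1 hx
  -- In the chart, a small move against the `i`-th direction makes that coordinate negative, and
  -- such points lie neither in `Ω` nor on its boundary.
  set p : ℝ → Space N := fun t => e x - t • EuclideanSpace.single i (1 : ℝ)
  have hp : Continuous p := by fun_prop
  have hp0 : p 0 = e x := by simp [p]
  have ht : ∀ᶠ t in 𝓝 (0 : ℝ), p t ∈ e.target :=
    hp.continuousAt.eventually_mem (by
      rw [hp0]
      exact e.open_target.mem_nhds (e.map_source hxe))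
  have hc : ContinuousAt (fun t => e.symm (p t)) 0 :=
    ContinuousAt.comp (f := p) (g := e.symm)
      (by rw [hp0]; exact e.continuousAt_symm (e.map_source hxe)) hp.continuousAt
  have hw : ∀ᶠ t in 𝓝 (0 : ℝ), e.symm (p t) ∈ W :=
    hc.eventually_mem (by rwa [hp0, e.left_inv hxe])
  obtain ⟨t, ⟨htt, htw⟩, ht0⟩ := (((ht.and hw).filter_mono nhdsWithin_le_nhds).and
    (self_mem_nhdsWithin (a := (0 : ℝ)) (s := Set.Ioi 0))).exists
  have hneg : e (e.symm (p t)) i < 0 := by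
    rw [e.right_inv htt]
    simp only [p, PiLp.sub_apply, PiLp.smul_apply, h0, PiLp.single_apply, if_true]
    simpa using ht0
  refine ⟨_, htw, fun hcl => ?_⟩
  rw [closure_eq_self_union_frontier] at hcl
  obtain ⟨h1, h2⟩ := he _ (e.map_target htt)
  rcases hcl with hcl | hcl
  · exact absurd (h1.1 hcl) (not_lt.2 hneg.le)
  · exact hneg.ne (h2.1 hcl)

/-- Korn's first inequality for irrotational fields with vanishing tangential traces. -/
theorem exists_korn_const_circ {Ω Γt : Set (Space N)} (hΩ : IsBoundedDomain Ω)
    (hΓt : IsBoundaryPart Ω Γt) (hLip : ∀ x ∈ Γt, LipschitzBoundaryAt Ω x) (hne : Γt.Nonempty)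
    {J : ℕ} {P : Fin J → Set (Space N)} (hP : IsSlicing Ω Γt P) :
    ∃ c : ℝ, ∀ T, MemHCurlCircZero Ω Γt T →
      tensorNorm Ω T ≤ c * tensorNorm Ω fun x => symPart (T x) := by
  obtain ⟨ho, hc, hb⟩ := hΩ
  obtain ⟨O, hO, rfl⟩ := hΓt
  obtain ⟨x₀, hx₀O, hx₀⟩ := hne
  obtain ⟨r, hr, hrO⟩ := Metric.isOpen_iff.1 hO x₀ hx₀O
  -- This ball meets the boundary only inside `Γt`, and it meets `Ω` because `x₀` is a boundary
  -- point, so `Ω ∪ W` is connected.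
  set W := Metric.ball x₀ r
  have hW : W ∩ frontier Ω ⊆ O ∩ frontier Ω := Set.inter_subset_inter_left _ hrO
  have hWo : IsOpen W := Metric.isOpen_ball
  have hUo : IsOpen (Ω ∪ W) := ho.union hWo
  have hUb : Bornology.IsBounded (Ω ∪ W) := hb.union Metric.isBounded_ball
  have hUc : IsConnected (Ω ∪ W) := by
    refine IsConnected.union ?_ hc ⟨⟨x₀, Metric.mem_ball_self hr⟩, (convex_ball _ _).isPreconnected⟩
    rw [Set.inter_comm]
    exact mem_closure_iff.1 hx₀.1 W hWo (Metric.mem_ball_self hr)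
  obtain ⟨z, hz⟩ := (hLip x₀ ⟨hx₀O, hx₀⟩).exists_notMem_closure hx₀
    (hWo.mem_nhds (Metric.mem_ball_self hr))
  have hentry : ∀ (R : Space N → Matrix (Fin N) (Fin N) ℝ) i j,
      (fun x => Ω.indicator R x i j) = Ω.indicator fun x => R x i j := by
    intro R i j
    funext x
    by_cases hx : x ∈ Ω <;> simp [hx]
  have hL2 : ∀ R : Space N → Matrix (Fin N) (Fin N) ℝ, TensorL2 Ω R →
      TensorL2 (Ω ∪ W) (Ω.indicator R) := by
    intro R hR i j
    rw [hentry]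
    exact scalarL2_indicator ho (hR i j)
  -- The class consists of the `L²` fields whose zero extension is irrotational on `Ω ∪ W`. This is
  -- preserved by `L²` limits, with no need to approximate the limit by boundary test fields.
  refine (exists_coercivity_const hb hP
    (fun T => TensorL2 Ω T ∧ ∀ n, HasWeakCurl (Ω ∪ W) (fun x => Ω.indicator T x n) 0)
    (fun T hT => ⟨hT.1, fun n => ((hT.2 n).mono Set.subset_union_left).congr_on ho
      fun x hx => by rw [Set.indicator_of_mem hx]⟩)
    (fun a T hT => ⟨fun i j => (hT.1 i j).const_mul a, fun n => ?_⟩) ?_).imp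
    fun c h T hT => h T ⟨fun n => (hT n).1.1, fun n => ?_⟩
  · convert (hT.2 n).zero_smul a using 2 with x
    by_cases hx : x ∈ Ω
    · simp only [Set.indicator_of_mem hx]
      rfl
    · simp only [Set.indicator_of_notMem hx]
      exact (smul_zero a).symm
  · intro T S hT hS hl hsym
    have hcurl : ∀ n, HasWeakCurl (Ω ∪ W) (fun x => Ω.indicator S x n) 0 := by
      refine fun n => HasWeakCurl.zero_of_tendsto (fun k => hL2 _ (hT k).1 n) (hL2 _ hS n)
        (fun i => (hl n i).congr fun k => ?_) fun k => (hT k).2 n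
      rw [← scalarNorm_indicator ho (Set.subset_union_left (t := W))]
      congr 1
      funext x
      by_cases hx : x ∈ Ω <;> simp [hx]
    rw [ae_restrict_iff' ho.measurableSet] at hsym
    obtain ⟨A, -, hSA⟩ := exists_ae_eq_so hUo hUc
      (fun i j => ((hL2 _ hS i j).integrableOn hUb).locallyIntegrableOn) hcurl (by
        filter_upwards [hsym] with x hx _
        by_cases hxΩ : x ∈ Ω
        · rw [Set.indicator_of_mem hxΩ, hx hxΩ]
        · rw [Set.indicator_of_notMem hxΩ]
          simp [symPart])
    -- The extension vanishes on the nonempty open set `W \ closure Ω`, which fixes the constant.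
    have hA : A = 0 := by
      ext i j
      refine eq_of_ae_eq_const (V := W \ closure Ω) (u := fun x => Ω.indicator S x i j)
        (hWo.sdiff isClosed_closure) ⟨z, hz⟩ ?_ ?_
      · filter_upwards [hSA] with x hx hxV
        rw [hx (Or.inr hxV.1)]
      · refine ae_of_all _ fun x hxV => ?_
        rw [Set.indicator_of_notMem fun h => hxV.2 (subset_closure h)]
    rw [ae_restrict_iff' ho.measurableSet]
    filter_upwards [hSA] with x hx hxΩ
    rw [← hA, ← hx (Or.inl hxΩ), Set.indicator_of_mem hxΩ]
  · refine (hasWeakCurl_indicator ho hb hW (hT n).1 (hT n).2).congr_on hUo fun x _ => ?_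
    by_cases hx : x ∈ Ω
    · simp only [Set.indicator_of_mem hx]
    · simp only [Set.indicator_of_notMem hx]
      rfl

end KornIrrot

end

/-! ### The theorem, assembled from the two coercivity constants -/

open KornIrrot
theorem lemma3p3 (N : ℕ) (Ω Γt : Set (Space N)) (hΩ : IsBoundedDomain Ω)
    (hΓt : IsBoundaryPart Ω Γt) (hLip : ∀ x ∈ Γt, LipschitzBoundaryAt Ω x)
    (J : ℕ) (P : Fin J → Set (Space N)) (hP : IsSlicing Ω Γt P) :
    ∀ c₀ : ℝ, 0 < c₀ → ∃ c : ℝ, c₀ ≤ c ∧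
      (Γt.Nonempty → ∀ T, MemHCurlCircZero Ω Γt T →
        tensorNorm Ω T ≤ c * tensorNorm Ω (fun x => symPart (T x))) ∧
      (Γt = ∅ → ∀ T, MemHCurlZero Ω T →
        ∃ S, IsPiecewiseConstSkew P S ∧
          tensorNorm Ω (fun x => T x - S x) ≤ c * tensorNorm Ω (fun x => symPart (T x))) ∧
      (Γt = ∅ → IsSimplyConnected Ω → ∀ T, MemHCurlZero Ω T →
        (∀ S, IsSoProjection Ω T S ↔ S = skewMean Ω T) ∧
        tensorNorm Ω (fun x => T x - skewMean Ω T)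
          ≤ c * tensorNorm Ω (fun x => symPart (T x)) ∧
        MemHCurlZero Ω (fun x => T x - skewMean Ω T) ∧
        PerpSo Ω (fun x => T x - skewMean Ω T) ∧
        (skewMean Ω T = 0 ↔ PerpSo Ω T) ∧
        (PerpSo Ω T → tensorNorm Ω T ≤ c * tensorNorm Ω (fun x => symPart (T x)))) := by
  intro c₀ _
  obtain ⟨c₁, h₁⟩ := exists_korn_const_perpSo hΩ hP
  obtain ⟨c₂, h₂⟩ : ∃ c₂ : ℝ, Γt.Nonempty → ∀ T, MemHCurlCircZero Ω Γt T →
      tensorNorm Ω T ≤ c₂ * tensorNorm Ω fun x => symPart (T x) := by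
    by_cases hne : Γt.Nonempty
    · exact (exists_korn_const_circ hΩ hΓt hLip hne hP).imp fun _ h _ => h
    · exact ⟨0, fun h => absurd h hne⟩
  have hb := hΩ.2.2
  have hpos : 0 < volume.real Ω := ENNReal.toReal_pos
    (hΩ.1.measure_pos _ hΩ.2.1.nonempty).ne' hb.measure_lt_top.ne
  have hperp : ∀ T, MemHCurlZero Ω T → PerpSo Ω (fun x => T x - skewMean Ω T) := fun T hT =>
    (perpSo_sub_const_iff hb hpos hT.tensorL2 (skewPart_mem_so _)).2 rfl
  have hmain : ∀ T, MemHCurlZero Ω T → tensorNorm Ω (fun x => T x - skewMean Ω T) ≤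
      c₁ * tensorNorm Ω fun x => symPart (T x) := by
    intro T hT
    have h := h₁ _ (hT.sub_const hb (skewMean Ω T)) (hperp T hT)
    have hs : skewMean Ω T ∈ so N := skewPart_mem_so _
    simpa only [symPart_sub_of_mem_so _ hs] using h
  -- The signs of `c₁` and `c₂` are not known; enlarging them to the maximum is allowed because
  -- norms are nonnegative.
  have hc₁ : ∀ T : Space N → Matrix (Fin N) (Fin N) ℝ, c₁ * tensorNorm Ω (fun x => symPart (T x)) ≤
      max c₀ (max c₁ c₂) * tensorNorm Ω fun x => symPart (T x) := fun T =>
    mul_le_mul_of_nonneg_right ((le_max_left _ _).trans (le_max_right _ _)) (tensorNorm_nonneg _ _)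
  have hc₂ : ∀ T : Space N → Matrix (Fin N) (Fin N) ℝ, c₂ * tensorNorm Ω (fun x => symPart (T x)) ≤
      max c₀ (max c₁ c₂) * tensorNorm Ω fun x => symPart (T x) := fun T =>
    mul_le_mul_of_nonneg_right ((le_max_right _ _).trans (le_max_right _ _)) (tensorNorm_nonneg _ _)
  -- The piecewise constant field of (ii) is taken equal to `skewMean Ω T` on every slice.
  refine ⟨max c₀ (max c₁ c₂), le_max_left _ _, fun hne T hT => (h₂ hne T hT).trans (hc₂ T),
    fun _ T hT => ⟨fun _ => skewMean Ω T, fun _ => ⟨_, skewPart_mem_so _, fun _ _ => rfl⟩,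
      (hmain T hT).trans (hc₁ T)⟩, fun _ _ T hT => ⟨isSoProjection_iff hb hpos hT.tensorL2,
      (hmain T hT).trans (hc₁ T), hT.sub_const hb _, hperp T hT,
      skewMean_eq_zero_iff hb hpos hT.tensorL2, fun hp => (h₁ T hT hp).trans (hc₁ T)⟩⟩
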